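/- An instance of the word-model counting problem with unary bound consists of a finite set $\mathit{AP}$ of atomic propositions (listed explicitly), an LTL formula $\varphi$ over $\mathit{AP}$ (built from atomic propositions and the constant true with $\neg,\wedge,\vee$ and the temporal operators Next, Until, Release), and a bound $k\in\mathbb N$ written in unary. A $k$-word-model of $\varphi$ is a pair $(u,v)$ of finite words over the alphabet $2^{\mathit{AP}}$ with $v\neq\varepsilon$, $|uv|=k$ and $uv^\omega\models\varphi$. Let $f$ be the function that maps the word encoding an instance $(\mathit{AP},\varphi,k)$ to the number of $k$-word-models of $\varphi$ over $\mathit{AP}$, and every word that encodes no instance to $0$. A function $g\colon\Sigma^*\to\mathbb N$ (with $\Sigma$ a finite alphabet) is in $\#\mathrm P$ if there is a nondeterministic Turing machine $\mathcal M$ and a polynomial $p$ such that every run of $\mathcal M$ on every input of length $n$ has at most $p(n)$ steps and $g(w)$ is the number of accepting runs of $\mathcal M$ on $w$, for every $w\in\Sigma^*$. **Theorem.** The function $f$ is $\#\mathrm P$-complete under parsimonious reductions: $f\in\#\mathrm P$, and for every function $g\colon\Sigma^*\to\mathbb N$ in $\#\mathrm P$ there is a polynomial-time computable function $r$ such that $g(x)=f(r(x))$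 for all $x\in\Sigma^*$. -/

import Mathlib

namespace LTLCount

/-! ## Nondeterministic Turing machines and the class #P -/

/-- Head movements. -/
inductive Move where
  | left
  | stay
  | right

/-- The displacement of the head caused by a movement. -/
def Move.offset : Move → ℤ
  | .left => -1
  | .stay => 0
  | .right => 1

/-- A nondeterministic Turing machine with input alphabet `A`, with finitely many tapes (one of
which is the input tape), each of them infinite in both directions. -/
structure NTM (A : Type) where
  /-- states -/
  Q : Type
  [finiteQ : Finite Q]
  /-- tape alphabet -/
  Γ : Type
  [finiteΓ : Finite Γ]
  /-- indices of the tapes -/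
  K : Type
  [finiteK : Finite K]
  [decEqK : DecidableEq K]
  /-- the tape that holds the input -/
  inputTape : K
  /-- the blank symbol -/
  blank : Γ
  /-- the input alphabet as a part of the tape alphabet, which does not contain the blank -/
  symb : A → Γ
  symb_injective : Function.Injective symb
  symb_ne_blank : ∀ a, symb a ≠ blank
  /-- initial state -/
  start : Q
  /-- accepting states; they are terminal, see `NTM.Step` -/
  accept : Set Q
  /-- the possible transitions (new state, symbols written, head movements), given the current
  state and the symbols that are read -/
  δ : Q → (K → Γ) → Set (Q × (K → Γ) × (K → Move))

attribute [instance] NTM.finiteQ NTM.finiteΓ NTM.finiteK NTM.decEqK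

namespace NTM

/-- Configurations: state, absolute head positions, tape contents. -/
@[ext]
structure Cfg {A : Type} (M : NTM A) where
  state : M.Q
  head : M.K → ℤ
  tape : M.K → ℤ → M.Γ

/-- The initial configuration on input `w`: the input `w` is written in the cells
`0, …, |w| - 1` of the input tape, all other cells are blank, all heads are at cell `0`. -/
def init {A : Type} (M : NTM A) (w : List A) : M.Cfg where
  state := M.start
  head := fun _ => 0
  tape := fun k i =>
    if k = M.inputTape ∧ 0 ≤ i then (w[i.toNat]?).elim M.blank M.symb else M.blank

/-- The symbols under the heads. -/
def Cfg.read {A : Type} {M : NTM A} (c : M.Cfg) : M.K → M.Γ :=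
  fun k => c.tape k (c.head k)

/-- The configuration after performing a transition. -/
def Cfg.apply {A : Type} {M : NTM A} (c : M.Cfg)
    (t : M.Q × (M.K → M.Γ) × (M.K → Move)) : M.Cfg where
  state := t.1
  head := fun k => c.head k + (t.2.2 k).offset
  tape := fun k => Function.update (c.tape k) (c.head k) (t.2.1 k)

/-- The successor relation on configurations. Accepting configurations have no successor. -/
def Step {A : Type} (M : NTM A) (c c' : M.Cfg) : Prop :=
  c.state ∉ M.accept ∧ ∃ t ∈ M.δ c.state c.read, c' = c.apply t

/-- `ρ` is a (possibly unfinished) run on input `w`: a nonempty sequence of configurations that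
starts in the initial configuration and follows the successor relation. -/
def IsRun {A : Type} (M : NTM A) (w : List A) (ρ : List M.Cfg) : Prop :=
  ρ.head? = some (M.init w) ∧ ρ.IsChain M.Step

/-- `ρ` is an accepting run on `w`: a run that ends in an accepting state. -/
def IsAcceptingRun {A : Type} (M : NTM A) (w : List A) (ρ : List M.Cfg) : Prop :=
  M.IsRun w ρ ∧ ∃ c, ρ.getLast? = some c ∧ c.state ∈ M.accept

/-- The number of accepting runs of `M` on `w`. -/
noncomputable def numAcceptingRuns {A : Type} (M : NTM A) (w : List A) : ℕ :=
  {ρ : List M.Cfg | M.IsAcceptingRun w ρ}.ncard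

/-- `M` is polynomial-time bounded: for some polynomial `p`, every run of `M` (accepting or not)
on every input of length `n` makes at most `p n` steps. -/
def IsPolyTime {A : Type} (M : NTM A) : Prop :=
  ∃ p : Polynomial ℕ, ∀ (w : List A) (ρ : List M.Cfg), M.IsRun w ρ →
    ρ.length ≤ p.eval w.length + 1

end NTM

/-- The class #P of functions from words to natural numbers. -/
def InSharpP {A : Type} (f : List A → ℕ) : Prop :=
  ∃ M : NTM A, M.IsPolyTime ∧ ∀ w, f w = M.numAcceptingRuns w

/-- Polynomial-time computable functions between words (by a deterministic Turing machine). -/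
def PolyTimeComputable {A B : Type} (r : List A → List B) : Prop :=
  Nonempty (Turing.TM2ComputableInPolyTime (id : List A → List A) (id : List B → List B) r)

/-- Hardness for #P under parsimonious reductions. -/
def SharpPHard {B : Type} (g : List B → ℕ) : Prop :=
  ∀ (A : Type) [Finite A] (f : List A → ℕ), InSharpP f →
    ∃ r : List A → List B, PolyTimeComputable r ∧ ∀ x, f x = g (r x)

/-- Completeness for #P under parsimonious reductions. -/
def SharpPComplete {B : Type} (g : List B → ℕ) : Prop :=
  SharpPHard g ∧ InSharpP g

/-! ## Linear-time temporal logic -/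

/-- LTL formulas over the atomic propositions `AP`. Further operators are derived as usual, for
instance `F φ = tt U φ` and `G φ = (¬ tt) V φ`. -/
inductive LTL (AP : Type) where
  | tt : LTL AP
  | atom : AP → LTL AP
  | neg : LTL AP → LTL AP
  | and : LTL AP → LTL AP → LTL AP
  | or : LTL AP → LTL AP → LTL AP
  | next : LTL AP → LTL AP
  | untl : LTL AP → LTL AP → LTL AP
  | release : LTL AP → LTL AP → LTL AP

/-- `φ.SatAt σ i`: the suffix of the infinite word `σ` from position `i` on satisfies `φ`. -/
def LTL.SatAt {AP : Type} (σ : ℕ → Set AP) : ℕ → LTL AP → Prop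
  | _, .tt => True
  | i, .atom p => p ∈ σ i
  | i, .neg φ => ¬ SatAt σ i φ
  | i, .and φ ψ => SatAt σ i φ ∧ SatAt σ i ψ
  | i, .or φ ψ => SatAt σ i φ ∨ SatAt σ i ψ
  | i, .next φ => SatAt σ (i + 1) φ
  | i, .untl φ ψ => ∃ j, i ≤ j ∧ SatAt σ j ψ ∧ ∀ l, i ≤ l → l < j → SatAt σ l φ
  | i, .release φ ψ => ∀ j, i ≤ j → SatAt σ j ψ ∨ ∃ l, i ≤ l ∧ l < j ∧ SatAt σ l φ

/-- `σ ⊨ φ`. -/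
def LTL.Sat {AP : Type} (σ : ℕ → Set AP) (φ : LTL AP) : Prop :=
  LTL.SatAt σ 0 φ

/-- The infinite word `u v^ω` for a nonempty word `v`. -/
def omegaWord {α : Type} (u v : List α) (hv : v ≠ []) : ℕ → α := fun n =>
  if h : n < u.length then u[n]
  else v[(n - u.length) % v.length]'(Nat.mod_lt _ (List.length_pos_iff.mpr hv))

/-- `(u, v)` is a `k`-word-model of `φ`: `|uv| = k` and `u v^ω ⊨ φ` (so `v` is nonempty). -/
def LTL.IsWordModel {AP : Type} (φ : LTL AP) (k : ℕ) (m : List (Set AP) × List (Set AP)) : Prop :=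
  m.1.length + m.2.length = k ∧ ∃ hv : m.2 ≠ [], LTL.Sat (omegaWord m.1 m.2 hv) φ

/-- The number of `k`-word-models of `φ`. -/
noncomputable def LTL.numWordModels {AP : Type} (φ : LTL AP) (k : ℕ) : ℕ :=
  {m : List (Set AP) × List (Set AP) | φ.IsWordModel k m}.ncard

/-! ## The counting problem as a function on words -/

/-- An instance: the set of atomic propositions `{0, …, numProps - 1}`, a formula, a bound. -/
structure Instance where
  numProps : ℕ
  formula : LTL (Fin numProps)
  bound : ℕ

/-- The alphabet in which instances are written. -/
inductive Symb where
  | one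
  | sep
  | tt
  | atom
  | neg
  | and
  | or
  | next
  | untl
  | release
deriving DecidableEq

instance : Fintype Symb :=
  ⟨{.one, .sep, .tt, .atom, .neg, .and, .or, .next, .untl, .release}, by
    intro x; cases x <;> simp⟩

/-- A formula in prefix notation; the atomic proposition `i` is written `atom 1^i sep`. -/
def LTL.encode {n : ℕ} : LTL (Fin n) → List Symb
  | .tt => [.tt]
  | .atom i => .atom :: (List.replicate i.val .one ++ [.sep])
  | .neg φ => .neg :: φ.encode
  | .and φ ψ => .and :: (φ.encode ++ ψ.encode)
  | .or φ ψ => .or :: (φ.encode ++ ψ.encode)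
  | .next φ => .next :: φ.encode
  | .untl φ ψ => .untl :: (φ.encode ++ ψ.encode)
  | .release φ ψ => .release :: (φ.encode ++ ψ.encode)

/-- The word `1^n sep φ 1^k` for a formula `φ` over `n` atomic propositions and a bound `k`, which
is thus given in unary. -/
def Instance.encode (x : Instance) : List Symb :=
  List.replicate x.numProps .one ++ (.sep :: (x.formula.encode ++ List.replicate x.bound .one))

theorem replicate_one_sep_inj : ∀ (m n : ℕ) (s t : List Symb),
    List.replicate m .one ++ (.sep :: s) = List.replicate n .one ++ (.sep :: t) →
      m = n ∧ s = t
  | 0, 0, s, t, h => by simpa using h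
  | 0, n + 1, s, t, h => by simp [List.replicate_succ] at h
  | m + 1, 0, s, t, h => by simp [List.replicate_succ] at h
  | m + 1, n + 1, s, t, h => by
    have h' : List.replicate m Symb.one ++ (.sep :: s) = List.replicate n .one ++ (.sep :: t) := by
      simpa [List.replicate_succ] using h
    obtain ⟨h1, h2⟩ := replicate_one_sep_inj m n s t h'
    exact ⟨by omega, h2⟩

theorem LTL.encode_append_inj {n : ℕ} (φ : LTL (Fin n)) : ∀ (ψ : LTL (Fin n)) (s t : List Symb),
    φ.encode ++ s = ψ.encode ++ t → φ = ψ ∧ s = t := by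
  induction φ with
  | tt => intro ψ s t h; cases ψ <;> simp_all [LTL.encode]
  | atom i =>
    intro ψ s t h
    cases ψ <;> simp [LTL.encode] at h
    obtain ⟨h1, h2⟩ := replicate_one_sep_inj _ _ _ _ h
    exact ⟨by rw [Fin.ext h1], h2⟩
  | neg φ ih =>
    intro ψ s t h
    cases ψ <;> simp [LTL.encode] at h
    obtain ⟨h1, h2⟩ := ih _ _ _ h
    exact ⟨by rw [h1], h2⟩
  | next φ ih =>
    intro ψ s t h
    cases ψ <;> simp [LTL.encode] at h
    obtain ⟨h1, h2⟩ := ih _ _ _ h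
    exact ⟨by rw [h1], h2⟩
  | and φ φ' ih ih' | or φ φ' ih ih' | untl φ φ' ih ih' | release φ φ' ih ih' =>
    intro ψ s t h
    cases ψ <;> simp [LTL.encode] at h
    obtain ⟨h1, h2⟩ := ih _ _ _ h
    obtain ⟨h3, h4⟩ := ih' _ _ _ h2
    exact ⟨by rw [h1, h3], h4⟩

/-- Different instances are written as different words. -/
theorem Instance.encode_injective : Function.Injective Instance.encode := by
  rintro ⟨m, φ, k⟩ ⟨n, ψ, l⟩ h
  obtain ⟨h1, h2⟩ := replicate_one_sep_inj _ _ _ _ h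
  dsimp only at h1 h2
  subst h1
  obtain ⟨h3, h4⟩ := LTL.encode_append_inj _ _ _ _ h2
  have h5 : k = l := by simpa using congrArg List.length h4
  rw [h3, h5]

/-- Counting word-models for unary bounds: the word that encodes `(φ, k)` is mapped to the number
of `k`-word-models of `φ`, and a word that encodes no instance is mapped to `0`. -/
noncomputable def countWordModelsUnary : List Symb → ℕ :=
  Function.extend Instance.encode (fun x => x.formula.numWordModels x.bound) (fun _ => 0)

end LTLCount

/-!
Membership in `#P`. A lasso `u v^ω` with `|u v| = k` is a row of `k` letters with a loop position,
and the truth values of a formula on it form a row of `k` bits. The formula is written in prefix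
notation, so reading it from right to left and keeping the rows of the subformulas on a stack
evaluates it. A row of `Until` or `Release` is computed in a single backward sweep, provided the
value that enters the end of the loop is known; the sweep therefore computes the rows for both
possible values, and the right one is recognised at the loop position, because the least (or
greatest) solution of the fixed point equation on the loop is obtained by starting from `false`
(or `true`). Hence only the lasso is guessed, and accepting runs correspond to word-models.

Hardness. Pad the runs of a machine by repeating accepting configurations, so that they all have
`T` steps; a run is then a sequence of `T` transitions. Write the configurations, as seen from the
heads, one after the other in rows of the same width, in an infinite word that is continued by a
padding symbol. The correct words are characterised by an initial part, by constraints on letters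
at bounded or row-width offsets, and by the place where the padding begins, all of which a formula
of polynomial size expresses. The transition of a row is written into its cells, so that the word
determines the sequence of transitions and conversely. A model of the formula has exactly one
lasso of size `m + 2`, where `m` is the last position before the padding: the last letter of `u`
differs from the padding, so `v` can only be the padding symbol itself. The reduction only
concatenates constants, copies of input letters and polynomially long repetitions, and such maps
are computed by a Turing machine with one stack for every instruction of the program.
-/

namespace LTLCount

/-! ## Runs of nondeterministic Turing machines -/

namespace NTM

variable {A : Type} {M : NTM A} {c c₁ c₂ : M.Cfg} {ρ : List M.Cfg} {N T T' : ℕ}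

/-- Runs from an arbitrary configuration; `NTM.IsRun` is the case of an initial one. -/
def IsRunFrom (M : NTM A) (c : M.Cfg) (ρ : List M.Cfg) : Prop :=
  ρ.head? = some c ∧ ρ.IsChain M.Step

/-- The set of accepting runs from an arbitrary configuration. -/
def acceptingFrom (M : NTM A) (c : M.Cfg) : Set (List M.Cfg) :=
  {ρ | M.IsRunFrom c ρ ∧ ∃ d, ρ.getLast? = some d ∧ d.state ∈ M.accept}

/-- From the configuration `c` there are exactly `N` accepting runs, and no run from `c` makes more
than `T` steps. -/
def CountsFrom (M : NTM A) (c : M.Cfg) (N T : ℕ) : Prop :=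
  (M.acceptingFrom c).encard = N ∧ ∀ ρ, M.IsRunFrom c ρ → ρ.length ≤ T + 1

theorem isRunFrom_iff :
    M.IsRunFrom c ρ ↔ ρ = [c] ∨ ∃ c' ρ', M.Step c c' ∧ M.IsRunFrom c' ρ' ∧ ρ = c :: ρ' := by
  constructor
  · rintro ⟨hhead, hchain⟩
    match ρ with
    | [] => simp at hhead
    | [d] => left; simpa using hhead
    | d :: e :: ρ' =>
      obtain rfl : d = c := by simpa using hhead
      rw [List.isChain_cons_cons] at hchain
      exact .inr ⟨e, e :: ρ', hchain.1, ⟨rfl, hchain.2⟩, rfl⟩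
  · rintro (rfl | ⟨c', ρ', hstep, ⟨hhead, hchain⟩, rfl⟩)
    · exact ⟨rfl, List.isChain_singleton _⟩
    · match ρ' with
      | [] => simp at hhead
      | d :: ρ' =>
        obtain rfl : d = c' := by simpa using hhead
        exact ⟨rfl, List.isChain_cons_cons.2 ⟨hstep, hchain⟩⟩

theorem IsRunFrom.getLast?_cons (h : M.IsRunFrom c₁ ρ) : (c :: ρ).getLast? = ρ.getLast? := by
  obtain ⟨ρ', rfl⟩ : ∃ ρ', ρ = c₁ :: ρ' := by simpa [← List.head?_eq_some_iff] using h.1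
  exact List.getLast?_cons_cons

theorem IsRunFrom.eq_of_mem_accept (hc : c.state ∈ M.accept) (h : M.IsRunFrom c ρ) : ρ = [c] := by
  rcases isRunFrom_iff.1 h with rfl | ⟨c', ρ', hstep, -⟩
  · rfl
  · exact absurd hc hstep.1

theorem acceptingFrom_of_mem_accept (hc : c.state ∈ M.accept) : M.acceptingFrom c = {[c]} := by
  ext ρ
  refine ⟨fun h => h.1.eq_of_mem_accept hc, ?_⟩
  rintro rfl
  exact ⟨⟨rfl, List.isChain_singleton _⟩, c, rfl, hc⟩

theorem acceptingFrom_of_notMem_accept (hc : c.state ∉ M.accept) :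
    M.acceptingFrom c = ⋃ c' ∈ {c' | M.Step c c'}, List.cons c '' M.acceptingFrom c' := by
  ext ρ
  simp only [acceptingFrom, Set.mem_ofPred_eq, Set.mem_iUnion, Set.mem_image, exists_prop]
  constructor
  · rintro ⟨hρ, d, hlast, hd⟩
    rcases isRunFrom_iff.1 hρ with rfl | ⟨c', ρ', hstep, hρ', rfl⟩
    · obtain rfl : c = d := by simpa using hlast
      exact absurd hd hc
    · exact ⟨c', hstep, ρ', ⟨hρ', d, hρ'.getLast?_cons ▸ hlast, hd⟩, rfl⟩
  · rintro ⟨c', hstep, ρ', ⟨hρ', d, hlast, hd⟩, rfl⟩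
    exact ⟨isRunFrom_iff.2 (.inr ⟨c', ρ', hstep, hρ', rfl⟩), d, hρ'.getLast?_cons.trans hlast, hd⟩

theorem disjoint_cons_acceptingFrom (h : c₁ ≠ c₂) :
    Disjoint (List.cons c '' M.acceptingFrom c₁) (List.cons c '' M.acceptingFrom c₂) := by
  rw [Set.disjoint_left]
  rintro _ ⟨ρ, hρ, rfl⟩ ⟨ρ', hρ', heq⟩
  obtain rfl : ρ' = ρ := by simpa using heq
  exact h (Option.some_injective _ (hρ.1.1.symm.trans hρ'.1.1))

theorem CountsFrom.mono (h : M.CountsFrom c N T) (hT : T ≤ T') : M.CountsFrom c N T' :=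
  ⟨h.1, fun ρ hρ => (h.2 ρ hρ).trans (by omega)⟩

theorem countsFrom_of_mem_accept (hc : c.state ∈ M.accept) : M.CountsFrom c 1 0 :=
  ⟨by simp [acceptingFrom_of_mem_accept hc], fun ρ hρ => by simp [hρ.eq_of_mem_accept hc]⟩

theorem countsFrom_of_no_step (hc : c.state ∉ M.accept) (hstep : ∀ c', ¬ M.Step c c') :
    M.CountsFrom c 0 0 := by
  refine ⟨by simp [acceptingFrom_of_notMem_accept hc, hstep], fun ρ hρ => ?_⟩
  rcases isRunFrom_iff.1 hρ with rfl | ⟨c', ρ', h, -⟩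
  · simp
  · exact absurd h (hstep c')

theorem countsFrom_of_successors {s : Finset M.Cfg} {N : M.Cfg → ℕ} (hc : c.state ∉ M.accept)
    (hs : ∀ c', M.Step c c' ↔ c' ∈ s) (h : ∀ c' ∈ s, M.CountsFrom c' (N c') T) :
    M.CountsFrom c (∑ c' ∈ s, N c') (T + 1) := by
  constructor
  · have hset : {c' | M.Step c c'} = s := Set.ext hs
    rw [acceptingFrom_of_notMem_accept hc, hset, s.finite_toSet.encard_biUnion
      fun c₁ _ c₂ _ hne => disjoint_cons_acceptingFrom hne, finsum_mem_coe_finset, Nat.cast_sum]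
    exact Finset.sum_congr rfl fun c' hc' =>
      List.cons_injective.encard_image _ |>.trans (h c' hc').1
  · intro ρ hρ
    rcases isRunFrom_iff.1 hρ with rfl | ⟨c', ρ', hstep, hρ', rfl⟩
    · simp
    · simpa using (h c' ((hs c').1 hstep)).2 ρ' hρ'

end NTM

/-! ## Stack machines -/

/-- An operation on a stack. -/
inductive StackOp (Γ : Type) where
  | keep
  | pop
  | push (a : Γ)

namespace StackOp

variable {Γ : Type}

/-- The effect of an operation on a stack. -/
def act : StackOp Γ → List Γ → List Γ
  | .keep, l => l
  | .pop, l => l.tail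
  | .push a, l => a :: l

/-- The symbol that an operation pushes, if any. -/
def pushed : StackOp Γ → Option Γ
  | .push a => some a
  | _ => none

/-- The head movement by which a Turing machine performs the operation. -/
def move : StackOp Γ → Move
  | .keep => .stay
  | .pop => .right
  | .push _ => .left

end StackOp

/-- A nondeterministic machine that operates on a family of stacks indexed by `K`. The state and the
topmost symbols determine a list of possible transitions, consisting of a new state and an operation
for each stack; an input is given on one of the stacks, the others being empty at the start. -/
structure StackMachine (Q K Γ : Type) where
  start : Q
  accept : Q
  input : K
  trans : Q → (K → Option Γ) → List (Q × (K → StackOp Γ))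

/-- The part of the tape `τ` from the head position `h` to the right holds the stack `l`, except
that the topmost symbol may be kept in the buffer `x` instead. -/
def Holds {Γ : Type} (x : Option Γ) (τ : ℤ → Option Γ) (h : ℤ) (l : List Γ) : Prop :=
  x.or (τ h) = l.head? ∧ ∀ j : ℕ, τ (h + 1 + j) = l.tail[j]?

theorem Holds.act {Γ : Type} {x : Option Γ} {τ : ℤ → Option Γ} {h : ℤ} {l : List Γ}
    (H : Holds x τ h l) (o : StackOp Γ) :
    Holds o.pushed (Function.update τ h (x.or (τ h))) (h + o.move.offset) (o.act l) := by
  have hright (j : ℕ) : Function.update τ h (x.or (τ h)) (h + 1 + j) = l.tail[j]? := by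
    rw [Function.update_of_ne (by omega), H.2]
  cases o with
  | keep => simpa [Holds, StackOp.pushed, StackOp.move, StackOp.act, Move.offset, hright] using H.1
  | pop =>
    refine ⟨?_, fun j => ?_⟩
    · simpa [StackOp.pushed, StackOp.move, StackOp.act, Move.offset] using hright 0
    · have hcell : h + Move.right.offset + 1 + j = h + 1 + (j + 1 : ℕ) := by
        push_cast [Move.offset]; ring
      simpa [StackOp.move, StackOp.act, hcell] using hright (j + 1)
  | push a =>
    refine ⟨rfl, fun j => ?_⟩
    rcases j with _ | j
    · simpa [StackOp.move, StackOp.act, Move.offset, List.head?_eq_getElem?] using H.1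
    · have hcell : h + Move.left.offset + 1 + (j + 1 : ℕ) = h + 1 + j := by
        push_cast [Move.offset]; ring
      simpa only [StackOp.move, StackOp.act, hcell, List.tail_cons, List.getElem?_tail]
        using hright j

namespace StackMachine

variable {Q K Γ : Type}

/-- The topmost symbols of the stacks. -/
def tops (S : K → List Γ) : K → Option Γ := fun k => (S k).head?

/-- The stacks after an operation on each of them. -/
def actAll (o : K → StackOp Γ) (S : K → List Γ) : K → List Γ := fun k => (o k).act (S k)

variable [Finite Q] [Finite K] [DecidableEq K] [Finite Γ] (M : StackMachine Q K Γ)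

/-- The Turing machine that simulates a stack machine. Each stack is held by a tape, with the
topmost symbol under the head and the others to the right of it. A pushed symbol is kept in the
state until the next step, as it belongs in a cell that the head only reaches by the current one. -/
def toNTM : NTM Γ where
  Q := Q × (K → Option Γ)
  Γ := Option Γ
  K := K
  inputTape := M.input
  blank := none
  symb := some
  symb_injective := Option.some_injective _
  symb_ne_blank := Option.some_ne_none
  start := (M.start, fun _ => none)
  accept := {q | q.1 = M.accept}
  δ := fun q r => {t | ∃ u ∈ M.trans q.1 (fun k => (q.2 k).or (r k)),
    t = ((u.1, fun k => (u.2 k).pushed), fun k => (q.2 k).or (r k), fun k => (u.2 k).move)}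

/-- The configuration `c` of the Turing machine represents the state `q` and the stacks `S`. -/
def Represents (c : M.toNTM.Cfg) (q : Q) (S : K → List Γ) : Prop :=
  c.state.1 = q ∧ ∀ k, Holds (c.state.2 k) (c.tape k) (c.head k) (S k)

/-- The configuration of the Turing machine after the transition `u` of the stack machine. -/
def next (c : M.toNTM.Cfg) (u : Q × (K → StackOp Γ)) : M.toNTM.Cfg :=
  c.apply ((u.1, fun k => (u.2 k).pushed), fun k => (c.state.2 k).or (c.tape k (c.head k)),
    fun k => (u.2 k).move)

/-- From the state `q` and the stacks `S` there are exactly `N` accepting runs, and no run makes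
more than `T` steps. Runs are those of the simulating Turing machine. -/
def Counts (q : Q) (S : K → List Γ) (N T : ℕ) : Prop :=
  ∀ c, M.Represents c q S → M.toNTM.CountsFrom c N T

variable {M} {c c' : M.toNTM.Cfg} {q q' q₁ q₂ : Q} {S S' S₁ S₂ : K → List Γ}
  {o o₁ o₂ : K → StackOp Γ} {N N₁ N₂ T T' : ℕ}

theorem Represents.next (h : M.Represents c q S) (u : Q × (K → StackOp Γ)) :
    M.Represents (M.next c u) u.1 (actAll u.2 S) :=
  ⟨rfl, fun k => (h.2 k).act (u.2 k)⟩

theorem Represents.step_iff (h : M.Represents c q S) (hq : q ≠ M.accept) :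
    M.toNTM.Step c c' ↔ ∃ u ∈ M.trans q (tops S), c' = M.next c u := by
  have htops : (fun k => (c.state.2 k).or (c.tape k (c.head k))) = tops S :=
    funext fun k => (h.2 k).1
  rw [← htops, ← h.1]
  constructor
  · rintro ⟨-, t, ⟨u, hu, rfl⟩, rfl⟩
    exact ⟨u, hu, rfl⟩
  · rintro ⟨u, hu, rfl⟩
    exact ⟨fun haccept => hq (h.1.symm.trans haccept), _, ⟨u, hu, rfl⟩, rfl⟩

theorem Represents.notMem_accept (h : M.Represents c q S) (hq : q ≠ M.accept) :
    c.state ∉ M.toNTM.accept :=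
  fun haccept => hq (h.1.symm.trans haccept)

theorem next_ne_next (h : q₁ ≠ q₂ ∨ ∃ k, (o₁ k).pushed ≠ (o₂ k).pushed) :
    M.next c (q₁, o₁) ≠ M.next c (q₂, o₂) := by
  intro heq
  have hstate : (q₁, fun k => (o₁ k).pushed) = (q₂, fun k => (o₂ k).pushed) :=
    congrArg NTM.Cfg.state heq
  rw [Prod.mk.injEq] at hstate
  rcases h with h | ⟨k, h⟩
  · exact h hstate.1
  · exact h (congrFun hstate.2 k)

theorem represents_init (w : List Γ) :
    M.Represents (M.toNTM.init w) M.start (fun k => if k = M.input then w else []) := by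
  have hcell (k : K) (j : ℕ) : (M.toNTM.init w).tape k j =
      (if k = M.input then w else [])[j]? := by
    by_cases hk : k = M.input
    · simp only [NTM.init, toNTM, hk, true_and, Int.natCast_nonneg, if_true, Int.toNat_natCast]
      cases w[j]? <;> rfl
    · simp [NTM.init, toNTM, hk]
  refine ⟨rfl, fun k => ⟨?_, fun j => ?_⟩⟩
  · exact List.head?_eq_getElem? ▸ hcell k 0
  · have hpos : (M.toNTM.init w).head k + 1 + (j : ℤ) = (j + 1 : ℕ) := by
      push_cast [NTM.init]; ring
    rw [hpos, List.getElem?_tail]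
    exact hcell k (j + 1)

namespace Counts

theorem mono (h : M.Counts q S N T) (hT : T ≤ T') : M.Counts q S N T' :=
  fun c hc => (h c hc).mono hT

theorem accept : M.Counts M.accept S 1 T :=
  fun _ hc => NTM.CountsFrom.mono (NTM.countsFrom_of_mem_accept hc.1) T.zero_le

theorem dead (hq : q ≠ M.accept) (htrans : M.trans q (tops S) = []) : M.Counts q S 0 T :=
  fun _ hc => (NTM.countsFrom_of_no_step (hc.notMem_accept hq) fun c' => by
    simp [hc.step_iff hq, htrans]).mono T.zero_le

theorem step (hq : q ≠ M.accept) (htrans : M.trans q (tops S) = [(q', o)])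
    (hS : actAll o S = S') (h : M.Counts q' S' N T) : M.Counts q S N (T + 1) := by
  subst hS
  intro c hc
  simpa using NTM.countsFrom_of_successors (s := {M.next c (q', o)}) (N := fun _ => N)
    (hc.notMem_accept hq) (by simp [hc.step_iff hq, htrans]) (by simpa using h _ (hc.next (q', o)))

theorem branch (hq : q ≠ M.accept) (htrans : M.trans q (tops S) = [(q₁, o₁), (q₂, o₂)])
    (hne : q₁ ≠ q₂ ∨ ∃ k, (o₁ k).pushed ≠ (o₂ k).pushed)
    (hS₁ : actAll o₁ S = S₁) (hS₂ : actAll o₂ S = S₂)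
    (h₁ : M.Counts q₁ S₁ N₁ T) (h₂ : M.Counts q₂ S₂ N₂ T) :
    M.Counts q S (N₁ + N₂) (T + 1) := by
  classical
  subst hS₁ hS₂
  intro c hc
  have hne' := next_ne_next (M := M) (c := c) hne
  have := NTM.countsFrom_of_successors (s := {M.next c (q₁, o₁), M.next c (q₂, o₂)})
    (N := fun c' => if c' = M.next c (q₁, o₁) then N₁ else N₂) (T := T)
    (hc.notMem_accept hq) (by simp [hc.step_iff hq, htrans])
    (by simpa [hne'.symm] using ⟨h₁ _ (hc.next (q₁, o₁)), h₂ _ (hc.next (q₂, o₂))⟩)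
  simpa [Finset.sum_pair hne', hne'.symm] using this

end Counts

theorem inSharpP_of_counts (f : List Γ → ℕ) (p : Polynomial ℕ)
    (h : ∀ w, M.Counts M.start (fun k => if k = M.input then w else []) (f w)
      (p.eval w.length)) : InSharpP f := by
  refine ⟨M.toNTM, ⟨p, fun w ρ hρ => (h w _ (represents_init w)).2 ρ hρ⟩, fun w => ?_⟩
  have hcount : (M.toNTM.acceptingFrom (M.toNTM.init w)).ncard = f w := by
    rw [Set.ncard, (h w _ (represents_init w)).1, ENat.toNat_natCast]
  exact hcount.symm

end StackMachine

/-! ## Backward evaluation of operators along a lasso -/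

/-- The truth value that an operator passes on to the preceding position, given those of its
operands at the current position and the one passed on from the following position. An operator with
a single operand is treated as a binary one with equal operands. -/
def carry : Symb → Bool → Bool → Bool → Bool
  | .untl, a, b, c => b || (a && c)
  | .release, a, b, c => b && (a || c)
  | _, _, b, _ => b

/-- The truth value of an operator at a position, given those of its operands there and the one
passed on from the following position. -/
def value : Symb → Bool → Bool → Bool → Bool
  | .neg, _, b, _ => !b
  | .and, a, b, _ => a && b
  | .or, a, b, _ => a || b
  | .next, _, _, c => c
  | .untl, a, b, c => b || (a && c)
  | .release, a, b, c => b && (a || c)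
  | _, _, _, _ => false

/-- The truth value of an operator on a loop whose positions pass on what is passed on to them. -/
def loopDefault : Symb → Bool
  | .release => true
  | _ => false

/-- The truth value that the positions `j, …, k - 1` pass on if `x` is passed on to `k - 1`. -/
def carryAt (op : Symb) (a b : ℕ → Bool) (k : ℕ) (x : Bool) (j : ℕ) : Bool :=
  (List.range' j (k - j)).foldr (fun i c => carry op (a i) (b i) c) x

/-- Evaluation of an operator along the positions `0, …, k - 1`, the last of which is followed by
position `s`, gives the values `v`. What is passed on to the last position is found by a first
pass over the loop. -/
def Evaluates (op : Symb) (a b : ℕ → Bool) (s k : ℕ) (v : ℕ → Bool) : Prop :=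
  ∀ j < k, value op (a j) (b j)
    (carryAt op a b k (carryAt op a b k (loopDefault op) s) (j + 1)) = v j

section Evaluation

variable {op : Symb} {a b u v : ℕ → Bool} {i j k s : ℕ} {x y : Bool}

@[simp] theorem carryAt_self : carryAt op a b k x k = x := by
  simp [carryAt]

theorem carryAt_of_lt (hj : j < k) :
    carryAt op a b k x j = carry op (a j) (b j) (carryAt op a b k x (j + 1)) := by
  obtain ⟨n, rfl⟩ : ∃ n, k = j + 1 + n := ⟨k - (j + 1), by omega⟩
  simp [carryAt, show j + 1 + n - j = n + 1 by omega, List.range'_succ]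

theorem carryAt_congr_below (h : carryAt op a b k x i = u i) (hik : i ≤ k)
    (hu : ∀ j < k, carry op (a j) (b j) (u (j + 1)) = u j) (hji : j ≤ i) :
    carryAt op a b k x j = u j := by
  induction hji using Nat.decreasingInduction with
  | self => exact h
  | of_succ j hji ih => rw [carryAt_of_lt (by omega), ih, hu j (by omega)]

/-- The first pass over the loop finds the right value: either some position of the loop ignores
what is passed on to it, or the default value is already right. -/
theorem evaluates_of_periodic (hs : s < k) (hperiodic : u k = u s)
    (hu : ∀ j < k, carry op (a j) (b j) (u (j + 1)) = u j)
    (hv : ∀ j < k, value op (a j) (b j) (u (j + 1)) = v j)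
    (hdefault : u s = loopDefault op ∨ ∃ i, s ≤ i ∧ i < k ∧ ∀ c, carry op (a i) (b i) c = u i) :
    Evaluates op a b s k v := by
  have hstart : carryAt op a b k (loopDefault op) s = u s := by
    rcases hdefault with hdefault | ⟨i, hsi, hik, hi⟩
    · exact carryAt_congr_below (by rw [carryAt_self, ← hdefault, hperiodic]) le_rfl hu hs.le
    · exact carryAt_congr_below (by rw [carryAt_of_lt hik, hi]) hik.le hu hsi
  intro j hj
  rw [hstart, carryAt_congr_below (by rw [carryAt_self, hperiodic]) le_rfl hu hj, hv j hj]

theorem evaluates_of_carry_eq (hs : s < k) (hcarry : ∀ a b c, carry op a b c = b)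
    (hperiodic : b k = b s) (hv : ∀ j < k, value op (a j) (b j) (b (j + 1)) = v j) :
    Evaluates op a b s k v :=
  evaluates_of_periodic hs hperiodic (fun _ _ => hcarry _ _ _) hv
    (.inr ⟨s, le_rfl, hs, fun c => hcarry _ _ c⟩)

theorem evaluates_untl (hs : s < k) (hv : ∀ j, v j = (b j || (a j && v (j + 1))))
    (hperiodic : v k = v s) (hwitness : v s = true → ∃ i, s ≤ i ∧ i < k ∧ b i = true) :
    Evaluates .untl a b s k v := by
  refine evaluates_of_periodic hs hperiodic (fun j _ => (hv j).symm) (fun j _ => (hv j).symm) ?_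
  rcases hvs : v s with _ | _
  · exact .inl rfl
  · obtain ⟨i, hsi, hik, hi⟩ := hwitness hvs
    exact .inr ⟨i, hsi, hik, fun c => by simp [carry, hv i, hi]⟩

theorem evaluates_release (hs : s < k) (hv : ∀ j, v j = (b j && (a j || v (j + 1))))
    (hperiodic : v k = v s) (hwitness : v s = false → ∃ i, s ≤ i ∧ i < k ∧ b i = false) :
    Evaluates .release a b s k v := by
  refine evaluates_of_periodic hs hperiodic (fun j _ => (hv j).symm) (fun j _ => (hv j).symm) ?_
  rcases hvs : v s with _ | _
  · obtain ⟨i, hsi, hik, hi⟩ := hwitness hvs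
    exact .inr ⟨i, hsi, hik, fun c => by simp [carry, hv i, hi]⟩
  · exact .inl rfl

end Evaluation

/-! ## A stack machine that counts word-models -/

/-- The points from which the positions are traversed: guessing the truth values of the next
proposition, processing the next symbol of the formula, and looking up a proposition. -/
inductive Phase where
  | guess
  | main
  | skip
deriving DecidableEq

instance : Fintype Phase :=
  ⟨{.guess, .main, .skip}, by intro p; cases p <;> simp⟩

/-- The states of the machine `checker`. It reads the number of propositions (`readNum`), reverses
the rest of the input (`reverse`), reads the bound from the end while guessing the beginning of the
loop (`readBound`), guesses the word, evaluates the formula from its end to its beginning and checks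
the outcome (`final`). -/
inductive CheckerState where
  | readNum
  | reverse
  | readBound (seen : Bool)
  | phase (p : Phase)
  | rewind (p : Phase)
  | guessRow
  | pushTrue
  | readRow (copy : Bool)
  | restoreWord
  | unload (op : Symb)
  | load (op : Symb)
  | sweep (op : Symb) (c : Bool → Bool) (g : Bool)
  | collect (g : Bool)
  | final (v : Bool)
  | accept
deriving Fintype

/-- The stacks of the machine `checker`: the input, the number of propositions, the reversed
formula, the positions (with a mark for the beginning of the loop), the guessed word, the rows of
truth values of the formulas that have been evaluated, the rows that result from both possible
values passed on to the last position, and the row of the first operand. -/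
inductive CheckerStack where
  | inp
  | num
  | tok
  | pos
  | pos'
  | word
  | word'
  | rows
  | aux₀
  | aux₁
  | arg
deriving DecidableEq

instance : Fintype CheckerStack :=
  ⟨{.inp, .num, .tok, .pos, .pos', .word, .word', .rows, .aux₀, .aux₁, .arg}, by
    intro k; cases k <;> simp⟩

/-- The symbol for a truth value. -/
def bit : Bool → Symb
  | true => .one
  | false => .sep

/-- The truth value of a symbol. -/
def isOne : Symb → Bool
  | .one => true
  | _ => false

@[simp] theorem isOne_bit (b : Bool) : isOne (bit b) = b := by cases b <;> rfl

/-- The operations given by a list, all other stacks being kept. -/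
def ops (l : List (CheckerStack × StackOp Symb)) : CheckerStack → StackOp Symb :=
  fun k => (l.lookup k).getD .keep

/-- Whether an operator has a single operand. -/
def isUnary : Symb → Bool
  | .neg | .next => true
  | _ => false

/-- The transitions of the machine `checker`. Missing operands or propositions leave it without a
successor. -/
def checkerTrans : CheckerState → (CheckerStack → Option Symb) →
    List (CheckerState × (CheckerStack → StackOp Symb))
  | .readNum, t => match t .inp with
    | some .one => [(.readNum, ops [(.inp, .pop), (.num, .push .one)])]
    | some .sep => [(.reverse, ops [(.inp, .pop)])]
    | _ => []
  | .reverse, t => match t .inp with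
    | some a => [(.reverse, ops [(.inp, .pop), (.tok, .push a)])]
    | none => [(.readBound false, ops [])]
  | .readBound false, t => match t .tok with
    | some .one => [(.readBound true, ops [(.tok, .pop), (.pos, .push .one)]),
        (.readBound false, ops [(.tok, .pop), (.pos, .push .sep)])]
    | _ => []
  | .readBound true, t => match t .tok with
    | some .one => [(.readBound true, ops [(.tok, .pop), (.pos, .push .sep)])]
    | _ => [(.phase .guess, ops [])]
  | .phase .guess, t => match t .num with
    | some _ => [(.guessRow, ops [(.num, .pop)])]
    | none => [(.phase .main, ops [])]
  | .guessRow, t => match t .pos with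
    | some m => [(.guessRow, ops [(.pos, .pop), (.pos', .push m), (.word, .push .sep)]),
        (.guessRow, ops [(.pos, .pop), (.pos', .push m), (.word, .push .one)])]
    | none => [(.rewind .guess, ops [])]
  | .rewind p, t => match t .pos' with
    | some m => [(.rewind p, ops [(.pos', .pop), (.pos, .push m)])]
    | none => [(.phase p, ops [])]
  | .phase .main, t => match t .tok with
    | some .tt => [(.pushTrue, ops [(.tok, .pop)])]
    | some .sep => [(.phase .skip, ops [(.tok, .pop)])]
    | some .one | some .atom => []
    | some op => [(.unload op, ops [(.tok, .pop)])]
    | none => [(.final false, ops [])]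
  | .pushTrue, t => match t .pos with
    | some m => [(.pushTrue, ops [(.pos, .pop), (.pos', .push m), (.rows, .push .one)])]
    | none => [(.rewind .main, ops [])]
  | .phase .skip, t => match t .tok with
    | some .one => [(.readRow false, ops [(.tok, .pop)])]
    | some .atom => [(.readRow true, ops [(.tok, .pop)])]
    | _ => []
  | .readRow copy, t => match t .pos, t .word with
    | some m, some b => [(.readRow copy, ops [(.pos, .pop), (.pos', .push m), (.word, .pop),
        (.word', .push b), (.rows, if copy then .push b else .keep)])]
    | some _, none => []
    | none, _ => [(if copy then .restoreWord else .rewind .skip, ops [])]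
  | .restoreWord, t => match t .word' with
    | some b => [(.restoreWord, ops [(.word', .pop), (.word, .push b)])]
    | none => [(.rewind .main, ops [])]
  | .unload op, t => match t .pos, t .rows with
    | some m, some b => [(.unload op, ops [(.pos, .pop), (.pos', .push m), (.rows, .pop),
        (.aux₀, .push b)])]
    | some _, none => []
    | none, _ => [(.load op, ops [])]
  | .load op, t => match t .pos', t .aux₀ with
    | some m, some b => [(.load op, ops [(.pos', .pop), (.pos, .push m), (.aux₀, .pop),
        (.arg, .push b), (.rows, if isUnary op then .push b else .keep)])]
    | some _, none => []
    | none, _ => [(.sweep op id false, ops [])]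
  | .sweep op c g, t => match t .pos, t .rows, t .arg with
    | some m, some b, some a =>
      let c' := fun x => carry op (isOne a) (isOne b) (c x)
      [(.sweep op c' (if isOne m then c' (loopDefault op) else g), ops [(.pos, .pop),
        (.pos', .push m), (.rows, .pop), (.arg, .pop),
        (.aux₀, .push (bit (value op (isOne a) (isOne b) (c false)))),
        (.aux₁, .push (bit (value op (isOne a) (isOne b) (c true))))])]
    | some _, _, _ => []
    | none, _, _ => [(.collect g, ops [])]
  | .collect g, t => match t .pos', t .aux₀, t .aux₁ with
    | some m, some b₀, some b₁ => [(.collect g, ops [(.pos', .pop), (.pos, .push m), (.aux₀, .pop),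
        (.aux₁, .pop), (.rows, .push (bif g then b₁ else b₀))])]
    | some _, _, _ => []
    | none, _, _ => [(.phase .main, ops [])]
  | .final v, t => match t .pos, t .rows with
    | some _, some b => [(.final (isOne b), ops [(.pos, .pop), (.rows, .pop)])]
    | none, none => if v then [(.accept, ops [])] else []
    | _, _ => []
  | .accept, _ => []

/-- The nondeterministic stack machine whose accepting runs on an instance correspond to the
word-models: a run guesses the beginning of the loop and the word, and then evaluates the formula
deterministically at all positions. -/
def checker : StackMachine CheckerState CheckerStack Symb where
  start := .readNum
  accept := .accept
  input := .inp
  trans := checkerTrans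

/-- The stacks of the machine `checker` with the given contents. -/
def stk (inp num tok pos pos' word word' rows aux₀ aux₁ arg : List Symb) : CheckerStack → List Symb
  | .inp => inp
  | .num => num
  | .tok => tok
  | .pos => pos
  | .pos' => pos'
  | .word => word
  | .word' => word'
  | .rows => rows
  | .aux₀ => aux₀
  | .aux₁ => aux₁
  | .arg => arg

/-- The truth values of `f` at the positions below `k`, the last one on top. -/
def row (f : ℕ → Bool) : ℕ → List Symb
  | 0 => []
  | k + 1 => bit (f k) :: row f k

@[simp] theorem length_row (f : ℕ → Bool) (k : ℕ) : (row f k).length = k := by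
  induction k with
  | zero => rfl
  | succ k ih => simp [row, ih]

theorem row_congr {f g : ℕ → Bool} {k : ℕ} (h : ∀ j < k, f j = g j) : row f k = row g k := by
  induction k with
  | zero => rfl
  | succ k ih => rw [row, row, h k (by omega), ih fun j hj => h j (by omega)]

/-! ## The loops of the machine -/

open StackMachine

section Loops

variable {inp num tok pos pos' word word' rows aux₀ aux₁ arg : List Symb} {N T : ℕ}

theorem counts_reverse (l : List Symb) : ∀ {tok},
    checker.Counts (.readBound false)
      (stk [] num (l.reverse ++ tok) pos pos' word word' rows aux₀ aux₁ arg) N T →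
    checker.Counts .reverse (stk l num tok pos pos' word word' rows aux₀ aux₁ arg) N
      (T + l.length + 1) := by
  induction l with
  | nil => exact fun h => .step nofun rfl (by funext k; cases k <;> rfl) h
  | cons a l ih =>
    intro tok h
    refine .step nofun rfl (by funext k; cases k <;> rfl) (ih (tok := a :: tok) ?_)
    simpa using h

theorem counts_readNum (n : ℕ) : ∀ {num},
    checker.Counts .reverse
      (stk inp (List.replicate n .one ++ num) tok pos pos' word word' rows aux₀ aux₁ arg) N T →
    checker.Counts .readNum
      (stk (List.replicate n .one ++ .sep :: inp) num tok pos pos' word word' rows aux₀ aux₁ arg) N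
      (T + n + 1) := by
  induction n with
  | zero => exact fun h => .step nofun rfl (by funext k; cases k <;> rfl) h
  | succ n ih =>
    intro num h
    refine .step nofun rfl (by funext k; cases k <;> rfl) (ih (num := .one :: num) ?_)
    simpa [List.replicate_succ'] using h

theorem counts_rewind (p : Phase) (l : List Symb) : ∀ {pos},
    checker.Counts (.phase p)
      (stk inp num tok (l.reverse ++ pos) [] word word' rows aux₀ aux₁ arg) N T →
    checker.Counts (.rewind p) (stk inp num tok pos l word word' rows aux₀ aux₁ arg) N
      (T + l.length + 1) := by
  induction l with
  | nil => exact fun h => .step nofun rfl (by funext k; cases k <;> rfl) h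
  | cons a l ih =>
    intro pos h
    refine .step nofun rfl (by funext k; cases k <;> rfl) (ih (pos := a :: pos) ?_)
    simpa using h

theorem counts_restoreWord (l : List Symb) : ∀ {word},
    checker.Counts (.rewind .main)
      (stk inp num tok pos pos' (l.reverse ++ word) [] rows aux₀ aux₁ arg) N T →
    checker.Counts .restoreWord (stk inp num tok pos pos' word l rows aux₀ aux₁ arg) N
      (T + l.length + 1) := by
  induction l with
  | nil => exact fun h => .step nofun rfl (by funext k; cases k <;> rfl) h
  | cons a l ih =>
    intro word h
    refine .step nofun rfl (by funext k; cases k <;> rfl) (ih (word := a :: word) ?_)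
    simpa using h

theorem counts_pushTrue_loop (l : List Symb) : ∀ {pos' rows},
    checker.Counts (.rewind .main) (stk inp num tok [] (l.reverse ++ pos') word word'
      (List.replicate l.length .one ++ rows) aux₀ aux₁ arg) N T →
    checker.Counts .pushTrue (stk inp num tok l pos' word word' rows aux₀ aux₁ arg) N
      (T + l.length + 1) := by
  induction l with
  | nil => exact fun h => .step nofun rfl (by funext k; cases k <;> rfl) h
  | cons a l ih =>
    intro pos' rows h
    refine .step nofun rfl (by funext k; cases k <;> rfl)
      (ih (pos' := a :: pos') (rows := .one :: rows) ?_)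
    simpa [List.replicate_succ'] using h

theorem counts_readRow_loop (copy : Bool) (l r : List Symb) (hr : r.length = l.length) :
    ∀ {pos' word' rows},
    checker.Counts (if copy then .restoreWord else .rewind .skip) (stk inp num tok []
      (l.reverse ++ pos') word (r.reverse ++ word') ((if copy then r.reverse else []) ++ rows)
      aux₀ aux₁ arg) N T →
    checker.Counts (.readRow copy)
      (stk inp num tok l pos' (r ++ word) word' rows aux₀ aux₁ arg) N (T + l.length + 1) := by
  induction l generalizing r with
  | nil =>
    obtain rfl := List.eq_nil_of_length_eq_zero hr
    intro _ _ _ h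
    cases word <;> cases copy <;> exact .step nofun rfl (by funext k; cases k <;> rfl) h
  | cons a l ih =>
    intro pos' word' rows h
    obtain ⟨b, r, rfl⟩ := List.exists_cons_of_length_eq_add_one hr
    refine .step nofun rfl (by funext k; cases k <;> cases copy <;> rfl) (ih r (by simpa using hr)
      (pos' := a :: pos') (word' := b :: word') (rows := (if copy then [b] else []) ++ rows) ?_)
    cases copy <;> simpa using h

theorem counts_unload (op : Symb) (l r : List Symb) (hr : r.length = l.length) : ∀ {pos' aux₀},
    checker.Counts (.load op) (stk inp num tok [] (l.reverse ++ pos') word word' rows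
      (r.reverse ++ aux₀) aux₁ arg) N T →
    checker.Counts (.unload op) (stk inp num tok l pos' word word' (r ++ rows) aux₀ aux₁ arg) N
      (T + l.length + 1) := by
  induction l generalizing r with
  | nil =>
    obtain rfl := List.eq_nil_of_length_eq_zero hr
    intro _ _ h
    cases rows <;> exact .step nofun rfl (by funext k; cases k <;> rfl) h
  | cons a l ih =>
    intro pos' aux₀ h
    obtain ⟨b, r, rfl⟩ := List.exists_cons_of_length_eq_add_one hr
    refine .step nofun rfl (by funext k; cases k <;> rfl)
      (ih r (by simpa using hr) (pos' := a :: pos') (aux₀ := b :: aux₀) ?_)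
    simpa using h

theorem counts_load (op : Symb) (l r : List Symb) (hr : r.length = l.length) : ∀ {pos rows arg},
    checker.Counts (.sweep op id false) (stk inp num tok (l.reverse ++ pos) [] word word'
      ((if isUnary op then r.reverse else []) ++ rows) [] aux₁ (r.reverse ++ arg)) N T →
    checker.Counts (.load op) (stk inp num tok pos l word word' rows r aux₁ arg) N
      (T + l.length + 1) := by
  induction l generalizing r with
  | nil =>
    obtain rfl := List.eq_nil_of_length_eq_zero hr
    intro _ _ _ h
    cases hop : isUnary op <;> simp only [hop] at h <;>
      exact .step nofun rfl (by funext k; cases k <;> rfl) h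
  | cons a l ih =>
    intro pos rows arg h
    obtain ⟨b, r, rfl⟩ := List.exists_cons_of_length_eq_add_one hr
    refine .step nofun rfl ?_ (ih r (by simpa using hr) (pos := a :: pos)
      (rows := (if isUnary op then [b] else []) ++ rows) (arg := b :: arg) ?_)
    · funext k
      cases k <;> first | rfl | (simp only [actAll, ops, List.lookup]; cases isUnary op <;> rfl)
    · cases hop : isUnary op <;> simpa [hop] using h

theorem counts_sweep {op : Symb} {a b : ℕ → Bool} {s k : ℕ} (j : ℕ) (hjk : j ≤ k) :
    ∀ {pos' aux₀ aux₁},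
    checker.Counts (.collect (carryAt op a b k (loopDefault op) s)) (stk inp num tok []
      ((row (· == s) j).reverse ++ pos') word word' rows
      ((row (fun i => value op (a i) (b i) (carryAt op a b k false (i + 1))) j).reverse ++ aux₀)
      ((row (fun i => value op (a i) (b i) (carryAt op a b k true (i + 1))) j).reverse ++ aux₁)
      arg) N T →
    checker.Counts (.sweep op (fun x => carryAt op a b k x j)
        (if s < j then false else carryAt op a b k (loopDefault op) s))
      (stk inp num tok (row (· == s) j) pos' word word' (row b j ++ rows) aux₀ aux₁
        (row a j ++ arg)) N (T + j + 1) := by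
  induction j with
  | zero => exact fun h => .step nofun rfl (by funext k; cases k <;> rfl) h
  | succ j ih =>
    intro pos' aux₀ aux₁ h
    have hcarry : (fun x => carryAt op a b k x j) =
        fun x => carry op (a j) (b j) (carryAt op a b k x (j + 1)) :=
      funext fun x => carryAt_of_lt hjk
    have hguess : (if s < j then false else carryAt op a b k (loopDefault op) s) =
        if j == s then carryAt op a b k (loopDefault op) j
        else if s < j + 1 then false else carryAt op a b k (loopDefault op) s := by
      grind
    simp only [row, List.reverse_cons, List.append_assoc, List.singleton_append] at h
    refine .step nofun (o := ops [(.pos, .pop), (.pos', .push (bit (j == s))), (.rows, .pop),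
      (.arg, .pop),
      (.aux₀, .push (bit (value op (a j) (b j) (carryAt op a b k false (j + 1))))),
      (.aux₁, .push (bit (value op (a j) (b j) (carryAt op a b k true (j + 1)))))]) ?_
      (by funext k; cases k <;> rfl) (ih (by omega) h)
    rw [hguess, hcarry, carryAt_of_lt hjk]
    simp [checker, checkerTrans, tops, stk, row]

theorem counts_collect (g : Bool) (l r₀ r₁ : List Symb) (h₀ : r₀.length = l.length)
    (h₁ : r₁.length = l.length) : ∀ {pos rows},
    checker.Counts (.phase .main) (stk inp num tok (l.reverse ++ pos) [] word word'
      ((bif g then r₁ else r₀).reverse ++ rows) aux₀ aux₁ arg) N T →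
    checker.Counts (.collect g)
      (stk inp num tok pos l word word' rows (r₀ ++ aux₀) (r₁ ++ aux₁) arg) N
      (T + l.length + 1) := by
  induction l generalizing r₀ r₁ with
  | nil =>
    obtain rfl := List.eq_nil_of_length_eq_zero h₀
    obtain rfl := List.eq_nil_of_length_eq_zero h₁
    intro _ _ h
    refine .step nofun rfl (by funext k; cases k <;> rfl) ?_
    cases g <;> exact h
  | cons m l ih =>
    intro pos rows h
    obtain ⟨b₀, r₀, rfl⟩ := List.exists_cons_of_length_eq_add_one h₀
    obtain ⟨b₁, r₁, rfl⟩ := List.exists_cons_of_length_eq_add_one h₁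
    refine .step nofun rfl (by funext k; cases k <;> rfl) (ih r₀ r₁ (by simpa using h₀)
      (by simpa using h₁) (pos := m :: pos) (rows := (bif g then b₁ else b₀) :: rows) ?_)
    cases g <;> simpa using h

theorem counts_pushTrue (l : List Symb)
    (h : checker.Counts (.phase .main) (stk inp num tok l [] word word'
      (List.replicate l.length .one ++ rows) aux₀ aux₁ arg) N T) :
    checker.Counts .pushTrue (stk inp num tok l [] word word' rows aux₀ aux₁ arg) N
      (T + 2 * l.length + 2) := by
  have hrewind := counts_rewind (pos := []) .main l.reverse (by simpa using h)
  exact (counts_pushTrue_loop (pos' := []) l (by simpa using hrewind)).mono (by simp; omega)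

theorem counts_skipRow (l r : List Symb) (hr : r.length = l.length)
    (h : checker.Counts (.phase .skip)
      (stk inp num tok l [] word (r.reverse ++ word') rows aux₀ aux₁ arg) N T) :
    checker.Counts (.readRow false) (stk inp num tok l [] (r ++ word) word' rows aux₀ aux₁ arg) N
      (T + 2 * l.length + 2) := by
  have hrewind := counts_rewind (pos := []) .skip l.reverse (by simpa using h)
  exact (counts_readRow_loop (pos' := []) false l r hr (by simpa using hrewind)).mono
    (by simp; omega)

theorem counts_copyRow (l r : List Symb) (hr : r.length = l.length)
    (h : checker.Counts (.phase .main) (stk inp num tok l [] (word'.reverse ++ (r ++ word)) []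
      (r.reverse ++ rows) aux₀ aux₁ arg) N T) :
    checker.Counts (.readRow true) (stk inp num tok l [] (r ++ word) word' rows aux₀ aux₁ arg) N
      (T + word'.length + 3 * l.length + 3) := by
  have hrewind := counts_rewind (pos := []) .main l.reverse (by simpa using h)
  have hrestore := counts_restoreWord (word := word) (r.reverse ++ word')
    (by simpa using hrewind)
  exact (counts_readRow_loop (pos' := []) true l r hr (by simpa using hrestore)).mono
    (by simp; omega)

theorem counts_unload_load (op : Symb) (l r : List Symb) (hr : r.length = l.length)
    (h : checker.Counts (.sweep op id false) (stk inp num tok l [] word word'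
      ((if isUnary op then r else []) ++ rows) [] aux₁ (r ++ arg)) N T) :
    checker.Counts (.unload op) (stk inp num tok l [] word word' (r ++ rows) [] aux₁ arg) N
      (T + 2 * l.length + 2) := by
  have hload := counts_load (pos := []) (rows := rows) (arg := arg) op l.reverse r.reverse
    (by simpa using hr) (by simpa using h)
  exact (counts_unload (pos' := []) (aux₀ := []) op l r hr (by simpa using hload)).mono
    (by simp; omega)

theorem counts_operator {op : Symb} {a b v : ℕ → Bool} {s k : ℕ} (hs : s < k)
    (heval : Evaluates op a b s k v) {rows' : List Symb}
    (hrows : (if isUnary op then row a k else []) ++ rows = row b k ++ rows')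
    (h : checker.Counts (.phase .main) (stk inp num tok (row (· == s) k) [] word word'
      (row v k ++ rows') [] [] arg) N T) :
    checker.Counts (.unload op)
      (stk inp num tok (row (· == s) k) [] word word' (row a k ++ rows) [] [] arg) N
      (T + 4 * k + 4) := by
  set g := carryAt op a b k (loopDefault op) s with hg
  let values (x : Bool) (i : ℕ) := value op (a i) (b i) (carryAt op a b k x (i + 1))
  have hv : row v k = bif g then row (values true) k else row (values false) k := by
    rw [row_congr fun j hj => (heval j hj).symm, ← hg]
    cases g <;> rfl
  have hcollect := counts_collect (pos := []) (rows := rows') (aux₀ := []) (aux₁ := []) (arg := arg)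
    g (row (· == s) k).reverse (row (values false) k).reverse (row (values true) k).reverse
    (by simp) (by simp) (by cases hg' : g <;> simpa [hv, hg'] using h)
  have hsweep := counts_sweep (pos' := []) (aux₀ := []) (aux₁ := []) k le_rfl
    (by simpa using hcollect)
  simp only [carryAt_self, if_pos hs, ← hrows] at hsweep
  exact (counts_unload_load op (row (· == s) k) (row a k) (by simp) hsweep).mono (by simp; omega)

theorem counts_unload_missing {op m : Symb} {l : List Symb} :
    checker.Counts (.unload op) (stk inp num tok (m :: l) pos' word word' [] aux₀ aux₁ arg) 0 T :=
  .dead nofun rfl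

theorem counts_sweep_missing {op m : Symb} {c : Bool → Bool} {g : Bool} {l : List Symb} :
    checker.Counts (.sweep op c g)
      (stk inp num tok (m :: l) pos' word word' [] aux₀ aux₁ arg) 0 T :=
  .dead nofun rfl

theorem counts_readRow_missing {copy : Bool} {m : Symb} {l : List Symb} :
    checker.Counts (.readRow copy)
      (stk inp num tok (m :: l) pos' [] word' rows aux₀ aux₁ arg) 0 T :=
  .dead nofun rfl

theorem counts_final (f : ℕ → Bool) (l : List Symb) : ∀ v : Bool,
    checker.Counts (.final v)
      (stk inp num tok l pos' word word' (row f l.length) aux₀ aux₁ arg)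
      (if (if l = [] then v else f 0) then 1 else 0) (T + l.length + 1) := by
  induction l with
  | nil =>
    rintro (_ | _)
    · exact .dead nofun rfl
    · exact .step nofun rfl rfl .accept
  | cons m l ih =>
    intro v
    have hfirst : (if m :: l = [] then v else f 0) =
        if l = [] then isOne (bit (f l.length)) else f 0 := by
      cases l <;> simp
    rw [hfirst]
    exact .step nofun rfl (by funext k; cases k <;> rfl) (ih (isOne (bit (f l.length))))

theorem counts_final_missing {m : Symb} {l : List Symb} {v : Bool} :
    checker.Counts (.final v) (stk inp num tok (m :: l) pos' word word' [] aux₀ aux₁ arg) 0 T :=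
  .dead nofun rfl

theorem counts_final_excess {b : Symb} (l r : List Symb) (hr : r.length = l.length) : ∀ v : Bool,
    checker.Counts (.final v)
      (stk inp num tok l pos' word word' (r ++ b :: rows) aux₀ aux₁ arg) 0 (T + l.length) := by
  induction l generalizing r with
  | nil =>
    obtain rfl := List.eq_nil_of_length_eq_zero hr
    exact fun _ => .dead nofun rfl
  | cons m l ih =>
    obtain ⟨c, r, rfl⟩ := List.exists_cons_of_length_eq_add_one hr
    exact fun _ => .step nofun rfl (by funext k; cases k <;> rfl) (ih r (by simpa using hr) _)

/-- The sum of the values of `F` at the words that arise from `W` by pushing `j` bits. -/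
def bitSum (F : List Bool → ℕ) : ℕ → List Bool → ℕ
  | 0, W => F W
  | j + 1, W => bitSum F j (false :: W) + bitSum F j (true :: W)

theorem bitSum_add (F : List Bool → ℕ) (i : ℕ) : ∀ (j : ℕ) (W : List Bool),
    bitSum (bitSum F i) j W = bitSum F (i + j) W
  | 0, _ => rfl
  | j + 1, W => by
    rw [← add_assoc, bitSum, bitSum, bitSum_add F i j, bitSum_add F i j]

theorem counts_guessRow {F : List Bool → ℕ} (l : List Symb) : ∀ {pos'} {m : ℕ},
    (∀ W, W.length = m + l.length → checker.Counts (.rewind .guess)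
      (stk inp num tok [] (l.reverse ++ pos') (W.map bit) word' rows aux₀ aux₁ arg) (F W) T) →
    ∀ W, W.length = m → checker.Counts .guessRow
      (stk inp num tok l pos' (W.map bit) word' rows aux₀ aux₁ arg)
      (bitSum F l.length W) (T + l.length + 1) := by
  induction l with
  | nil => exact fun h W hW => .step nofun rfl (by funext k; cases k <;> rfl) (h W hW)
  | cons a l ih =>
    intro pos' m h W hW
    have hcons : ∀ W, W.length = m + 1 + l.length → checker.Counts (.rewind .guess)
        (stk inp num tok [] (l.reverse ++ a :: pos') (W.map bit) word' rows aux₀ aux₁ arg)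
        (F W) T := fun V hV => by
      simpa using h V (by rw [hV, List.length_cons]; omega)
    exact .branch nofun rfl (.inr ⟨.word, nofun⟩) (by funext k; cases k <;> rfl)
      (by funext k; cases k <;> rfl) (ih hcons (false :: W) (by simp [hW]))
      (ih hcons (true :: W) (by simp [hW]))

theorem counts_guess {F : List Bool → ℕ} (n : ℕ) : ∀ {m : ℕ},
    (∀ W, W.length = m + n * pos.length → checker.Counts (.phase .main)
      (stk inp [] tok pos [] (W.map bit) word' rows aux₀ aux₁ arg) (F W) T) →
    ∀ W, W.length = m → checker.Counts (.phase .guess)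
      (stk inp (List.replicate n .one) tok pos [] (W.map bit) word' rows aux₀ aux₁ arg)
      (bitSum F (n * pos.length) W) (T + n * (2 * pos.length + 3) + 1) := by
  induction n with
  | zero =>
    intro m h W hW
    rw [Nat.zero_mul]
    exact .step nofun rfl (by funext k; cases k <;> rfl) ((h W (by omega)).mono (by omega))
  | succ n ih =>
    intro m h W hW
    have hguess := ih (m := m + pos.length) fun V hV => h V (by rw [hV]; ring)
    have hrewind := fun V hV =>
      counts_rewind (pos := []) .guess pos.reverse (by simpa using hguess V hV)
    have hrow := counts_guessRow (pos' := []) pos (by simpa using hrewind) W hW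
    rw [bitSum_add, ← Nat.succ_mul] at hrow
    refine .step nofun rfl (by funext k; cases k <;> rfl) (hrow.mono ?_)
    ring_nf
    omega

theorem counts_readBound_true (s : ℕ) (htok : tok.head? ≠ some .one) (r : ℕ) : ∀ c : ℕ, s < c →
    checker.Counts (.phase .guess)
      (stk inp num tok (row (· == s) (c + r)) pos' word word' rows aux₀ aux₁ arg) N T →
    checker.Counts (.readBound true)
      (stk inp num (List.replicate r .one ++ tok) (row (· == s) c) pos' word word' rows aux₀ aux₁
        arg) N (T + r + 1) := by
  induction r with
  | zero =>
    intro c _ h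
    refine .step (o := ops []) nofun ?_ (by funext k; cases k <;> rfl) h
    rcases tok with _ | ⟨a, tok⟩
    · rfl
    · cases a <;> first | rfl | exact absurd rfl htok
  | succ r ih =>
    intro c hc h
    have hmarked : (c == s) = false := by simpa using hc.ne'
    rw [(by omega : c + (r + 1) = c + 1 + r)] at h
    have hrest := ih (c + 1) (by omega) h
    rw [row, hmarked] at hrest
    exact .step nofun rfl (by funext k; cases k <;> rfl) hrest

theorem counts_readBound_false {F : ℕ → ℕ} (htok : tok.head? ≠ some .one) (r : ℕ) : ∀ c : ℕ,
    (∀ s < c + r, checker.Counts (.phase .guess)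
      (stk inp num tok (row (· == s) (c + r)) pos' word word' rows aux₀ aux₁ arg) (F s) T) →
    checker.Counts (.readBound false)
      (stk inp num (List.replicate r .one ++ tok) (row (fun _ => false) c) pos' word word' rows
        aux₀ aux₁ arg) (∑ s ∈ Finset.Ico c (c + r), F s) (T + r + 1) := by
  induction r with
  | zero =>
    intro c _
    simp only [add_zero, Finset.Ico_self, Finset.sum_empty]
    refine .dead nofun ?_
    rcases tok with _ | ⟨a, tok⟩
    · rfl
    · cases a <;> first | rfl | exact absurd rfl htok
  | succ r ih =>
    intro c h
    rw [Finset.sum_eq_sum_Ico_succ_bot (by omega)]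
    rw [(by omega : c + (r + 1) = c + 1 + r)] at h ⊢
    have hmark := counts_readBound_true c htok r (c + 1) (by omega) (h c (by omega))
    have hrow : row (· == c) (c + 1) = .one :: row (fun _ => false) c := by
      rw [row, beq_self_eq_true, bit, row_congr (g := fun _ => false)]
      exact fun j hj => by simpa using hj.ne
    rw [hrow] at hmark
    exact .branch nofun rfl (.inl nofun) (by funext k; cases k <;> rfl)
      (by funext k; cases k <;> rfl) hmark (ih (c + 1) h)

end Loops

/-! ## Truth values on ultimately periodic words -/

section Semantics

variable {AP : Type} {σ σ' : ℕ → Set AP} {φ φ' ψ ψ' : LTL AP} {i i' : ℕ}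

theorem LTL.satAt_untl_of_shift (hφ : ∀ d, φ.SatAt σ (i + d) → φ'.SatAt σ' (i' + d))
    (hψ : ∀ d, ψ.SatAt σ (i + d) → ψ'.SatAt σ' (i' + d)) :
    (φ.untl ψ).SatAt σ i → (φ'.untl ψ').SatAt σ' i' := by
  rintro ⟨j, hij, hj, hbefore⟩
  obtain ⟨d, rfl⟩ := Nat.exists_eq_add_of_le hij
  refine ⟨i' + d, Nat.le_add_right _ _, hψ d hj, fun l hl hld => ?_⟩
  obtain ⟨e, rfl⟩ := Nat.exists_eq_add_of_le hl
  exact hφ e (hbefore _ (Nat.le_add_right _ _) (by omega))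

theorem LTL.satAt_untl_congr (hφ : ∀ d, φ.SatAt σ (i + d) ↔ φ'.SatAt σ' (i' + d))
    (hψ : ∀ d, ψ.SatAt σ (i + d) ↔ ψ'.SatAt σ' (i' + d)) :
    (φ.untl ψ).SatAt σ i ↔ (φ'.untl ψ').SatAt σ' i' :=
  ⟨satAt_untl_of_shift (fun d => (hφ d).1) fun d => (hψ d).1,
    satAt_untl_of_shift (fun d => (hφ d).2) fun d => (hψ d).2⟩

theorem LTL.satAt_release_iff_not_untl :
    (φ.release ψ).SatAt σ i ↔ ¬ (φ.neg.untl ψ.neg).SatAt σ i := by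
  simp only [SatAt]
  push Not
  exact forall₂_congr fun j _ => or_iff_not_imp_left

theorem LTL.satAt_congr_shift (φ : LTL AP) : ∀ {i i' : ℕ},
    (∀ d, σ (i + d) = σ' (i' + d)) → (φ.SatAt σ i ↔ φ.SatAt σ' i') := by
  have hshift {i i' : ℕ} (h : ∀ d, σ (i + d) = σ' (i' + d)) (e d : ℕ) :
      σ (i + e + d) = σ' (i' + e + d) := by
    rw [add_assoc, h, add_assoc]
  induction φ with
  | tt => exact fun _ => Iff.rfl
  | atom p => exact fun {i i'} h => by rw [SatAt, SatAt, show σ i = σ' i' from h 0]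
  | neg φ ih => exact fun h => not_congr (ih h)
  | and φ ψ ihφ ihψ => exact fun h => and_congr (ihφ h) (ihψ h)
  | or φ ψ ihφ ihψ => exact fun h => or_congr (ihφ h) (ihψ h)
  | next _ ih => exact fun h => ih (hshift h 1)
  | untl φ ψ ihφ ihψ =>
    exact fun h => satAt_untl_congr (fun d => ihφ (hshift h d)) fun d => ihψ (hshift h d)
  | release φ ψ ihφ ihψ =>
    intro i i' h
    rw [satAt_release_iff_not_untl, satAt_release_iff_not_untl]
    exact not_congr (satAt_untl_congr (fun d => not_congr (ihφ (hshift h d)))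
      fun d => not_congr (ihψ (hshift h d)))

theorem LTL.satAt_untl_iff :
    (φ.untl ψ).SatAt σ i ↔ ψ.SatAt σ i ∨ (φ.SatAt σ i ∧ (φ.untl ψ).SatAt σ (i + 1)) := by
  constructor
  · rintro ⟨j, hij, hj, hbefore⟩
    rcases Nat.eq_or_lt_of_le hij with rfl | hij
    · exact .inl hj
    · exact .inr ⟨hbefore i le_rfl hij, j, hij, hj, fun l hl => hbefore l (by omega)⟩
  · rintro (hi | ⟨hi, j, hij, hj, hbefore⟩)
    · exact ⟨i, le_rfl, hi, fun l hl hl' => absurd hl (by omega)⟩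
    · refine ⟨j, by omega, hj, fun l hl hlj => ?_⟩
      rcases Nat.eq_or_lt_of_le hl with rfl | hl
      · exact hi
      · exact hbefore l hl hlj

theorem LTL.satAt_release_iff :
    (φ.release ψ).SatAt σ i ↔ ψ.SatAt σ i ∧ (φ.SatAt σ i ∨ (φ.release ψ).SatAt σ (i + 1)) := by
  rw [satAt_release_iff_not_untl, satAt_release_iff_not_untl, satAt_untl_iff]
  generalize (φ.neg.untl ψ.neg).SatAt σ (i + 1) = x
  simp only [SatAt]
  tauto

open Classical in
/-- The truth value of a formula at a position, as it is stored by the machine. -/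
noncomputable def truth (σ : ℕ → Set AP) (φ : LTL AP) (j : ℕ) : Bool :=
  decide (φ.SatAt σ j)

@[simp] theorem truth_eq_true : truth σ φ i = true ↔ φ.SatAt σ i := by
  simp [truth]

@[simp] theorem truth_eq_false : truth σ φ i = false ↔ ¬ φ.SatAt σ i := by
  simp [truth]

end Semantics

/-- The word `σ` repeats its part between the positions `s` and `k`. -/
structure IsLasso {α : Type*} (σ : ℕ → α) (s k : ℕ) : Prop where
  lt : s < k
  periodic : ∀ i, s ≤ i → σ (i + (k - s)) = σ i

namespace IsLasso

variable {AP : Type} {σ : ℕ → Set AP} {s k : ℕ}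

theorem satAt_add (h : IsLasso σ s k) (φ : LTL AP) {i : ℕ} (hi : s ≤ i) :
    φ.SatAt σ (i + (k - s)) ↔ φ.SatAt σ i := by
  refine φ.satAt_congr_shift fun d => ?_
  rw [← h.periodic (i + d) (by omega), Nat.add_right_comm]

theorem truth_eq (h : IsLasso σ s k) (φ : LTL AP) : truth σ φ k = truth σ φ s := by
  have hperiod := h.satAt_add φ le_rfl
  rw [Nat.add_sub_cancel' h.lt.le] at hperiod
  rw [Bool.eq_iff_iff, truth_eq_true, truth_eq_true, hperiod]

theorem exists_satAt (h : IsLasso σ s k) (φ : LTL AP) {j : ℕ} (hsj : s ≤ j)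
    (hj : φ.SatAt σ j) : ∃ i, s ≤ i ∧ i < k ∧ φ.SatAt σ i := by
  have := h.lt
  induction j using Nat.strong_induction_on with
  | _ j ih =>
    rcases Nat.lt_or_ge j k with hjk | hjk
    · exact ⟨j, hsj, hjk, hj⟩
    · refine ih (j - (k - s)) (by omega) (by omega) ?_
      rwa [← h.satAt_add φ (by omega), Nat.sub_add_cancel (by omega)]

theorem evaluates_untl (h : IsLasso σ s k) (φ ψ : LTL AP) :
    Evaluates .untl (truth σ φ) (truth σ ψ) s k (truth σ (φ.untl ψ)) := by
  refine LTLCount.evaluates_untl h.lt (fun j => ?_) (h.truth_eq _) fun htrue => ?_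
  · rw [Bool.eq_iff_iff]
    simpa using LTL.satAt_untl_iff
  · obtain ⟨j, hsj, hj, -⟩ := truth_eq_true.1 htrue
    simpa using h.exists_satAt ψ hsj hj

theorem evaluates_release (h : IsLasso σ s k) (φ ψ : LTL AP) :
    Evaluates .release (truth σ φ) (truth σ ψ) s k (truth σ (φ.release ψ)) := by
  refine LTLCount.evaluates_release h.lt (fun j => ?_) (h.truth_eq _) fun hfalse => ?_
  · rw [Bool.eq_iff_iff]
    simpa using LTL.satAt_release_iff
  · rw [truth_eq_false, LTL.satAt_release_iff_not_untl, not_not] at hfalse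
    obtain ⟨j, hsj, hj, -⟩ := hfalse
    simpa [LTL.SatAt] using h.exists_satAt ψ.neg hsj hj

theorem evaluates_next (h : IsLasso σ s k) (φ : LTL AP) :
    Evaluates .next (truth σ φ) (truth σ φ) s k (truth σ φ.next) :=
  evaluates_of_carry_eq h.lt (fun _ _ _ => rfl) (h.truth_eq φ) fun _ _ => rfl

theorem evaluates_neg (h : IsLasso σ s k) (φ : LTL AP) :
    Evaluates .neg (truth σ φ) (truth σ φ) s k (truth σ φ.neg) :=
  evaluates_of_carry_eq h.lt (fun _ _ _ => rfl) (h.truth_eq φ) fun j _ => by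
    rw [Bool.eq_iff_iff]
    simp [value, LTL.SatAt]

theorem evaluates_and (h : IsLasso σ s k) (φ ψ : LTL AP) :
    Evaluates .and (truth σ φ) (truth σ ψ) s k (truth σ (φ.and ψ)) :=
  evaluates_of_carry_eq h.lt (fun _ _ _ => rfl) (h.truth_eq ψ) fun j _ => by
    rw [Bool.eq_iff_iff]
    simp [value, LTL.SatAt]

theorem evaluates_or (h : IsLasso σ s k) (φ ψ : LTL AP) :
    Evaluates .or (truth σ φ) (truth σ ψ) s k (truth σ (φ.or ψ)) :=
  evaluates_of_carry_eq h.lt (fun _ _ _ => rfl) (h.truth_eq ψ) fun j _ => by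
    rw [Bool.eq_iff_iff]
    simp [value, LTL.SatAt]

end IsLasso

/-! ## Parsing a formula from right to left -/

/-- Read the reversed word of a formula, given the formulas that have already been read (and the
number of ones that have been read, within an atom). -/
def parse (n : ℕ) : Option ℕ → List Symb → List (LTL (Fin n)) → Option (List (LTL (Fin n)))
  | none, [], fs => some fs
  | none, .tt :: ts, fs => parse n none ts (.tt :: fs)
  | none, .sep :: ts, fs => parse n (some 0) ts fs
  | none, .neg :: ts, φ :: fs => parse n none ts (φ.neg :: fs)
  | none, .next :: ts, φ :: fs => parse n none ts (φ.next :: fs)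
  | none, .and :: ts, φ :: ψ :: fs => parse n none ts (φ.and ψ :: fs)
  | none, .or :: ts, φ :: ψ :: fs => parse n none ts (φ.or ψ :: fs)
  | none, .untl :: ts, φ :: ψ :: fs => parse n none ts (φ.untl ψ :: fs)
  | none, .release :: ts, φ :: ψ :: fs => parse n none ts (φ.release ψ :: fs)
  | some i, .one :: ts, fs => if i < n then parse n (some (i + 1)) ts fs else none
  | some i, .atom :: ts, fs => if h : i < n then parse n none ts (.atom ⟨i, h⟩ :: fs) else none
  | _, _, _ => none

theorem parse_replicate {n : ℕ} {ts : List Symb} {fs : List (LTL (Fin n))} (j : ℕ) :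
    ∀ {i : ℕ}, i + j ≤ n →
      parse n (some i) (List.replicate j .one ++ ts) fs = parse n (some (i + j)) ts fs := by
  induction j with
  | zero => exact fun _ => rfl
  | succ j ih =>
    intro i h
    rw [List.replicate_succ, List.cons_append, parse, if_pos (by omega), ih (by omega),
      Nat.add_right_comm, Nat.add_assoc]

theorem parse_encode {n : ℕ} (φ : LTL (Fin n)) : ∀ (ts : List Symb) (fs : List (LTL (Fin n))),
    parse n none (φ.encode.reverse ++ ts) fs = parse n none ts (φ :: fs) := by
  induction φ with
  | tt => exact fun ts fs => rfl
  | atom p =>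
    intro ts fs
    simp only [LTL.encode, List.reverse_cons, List.reverse_append, List.reverse_replicate,
      List.append_assoc, List.reverse_nil, List.nil_append, List.cons_append]
    rw [parse, parse_replicate _ (by omega), Nat.zero_add, parse, dif_pos p.2]
  | neg φ ih | next φ ih =>
    intro ts fs
    simp only [LTL.encode, List.reverse_cons, List.append_assoc, ih]
    rfl
  | and φ ψ ihφ ihψ | or φ ψ ihφ ihψ | untl φ ψ ihφ ihψ | release φ ψ ihφ ihψ =>
    intro ts fs
    simp only [LTL.encode, List.reverse_cons, List.reverse_append, List.append_assoc, ihφ, ihψ]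
    rfl

theorem flatMap_encode_of_parse {n : ℕ} (m : Option ℕ) (ts : List Symb)
    (fs gs : List (LTL (Fin n))) : parse n m ts fs = some gs →
    gs.flatMap LTL.encode = ts.reverse ++
      (m.elim [] fun i => List.replicate i .one ++ [.sep]) ++ fs.flatMap LTL.encode := by
  induction m, ts, fs using parse.induct n with
  | case1 fs =>
    intro h
    simp only [parse, Option.some.injEq] at h
    simp [h]
  | case10 i ts fs hi ih =>
    intro h
    rw [parse, if_pos hi] at h
    simp [ih h, List.replicate_succ]
  | case11 i ts fs hi => simp [parse, if_neg hi]
  | case12 i ts fs hi ih =>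
    intro h
    rw [parse, dif_pos hi] at h
    simp [ih h, LTL.encode]
  | case13 i ts fs hi => simp [parse, dif_neg hi]
  | case14 => simp_all [parse]
  | _ =>
    rename_i ih
    intro h
    rw [parse] at h
    simp [ih h, LTL.encode]

/-! ## Evaluation of a formula by the machine -/

section Evaluation

variable {n s k : ℕ} {σ : ℕ → Set (Fin n)} {tok : List Symb} {skipped rest : List (Fin n)}
  {fs : List (LTL (Fin n))} {N T : ℕ}

theorem row_const (b : Bool) (k : ℕ) : row (fun _ => b) k = List.replicate k (bit b) := by
  induction k with
  | zero => rfl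
  | succ k ih => rw [row, ih, List.replicate_succ]

theorem exists_row_eq_cons (f : ℕ → Bool) (hk : 0 < k) : ∃ m l, row f k = m :: l := by
  obtain ⟨k, rfl⟩ := Nat.exists_eq_add_one.2 hk
  exact ⟨_, _, rfl⟩

/-- The rows of truth values of formulas, as they are stacked by the machine. -/
noncomputable def rowStack (σ : ℕ → Set (Fin n)) (k : ℕ) (fs : List (LTL (Fin n))) : List Symb :=
  fs.flatMap fun φ => row (truth σ φ) k

/-- The first `k` letters of a word, proposition by proposition, as they are stacked by the
machine. -/
noncomputable def wordStack (σ : ℕ → Set (Fin n)) (k : ℕ) (ps : List (Fin n)) : List Symb :=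
  ps.flatMap fun p => (row (truth σ (.atom p)) k).reverse

theorem rowStack_cons (φ : LTL (Fin n)) (fs : List (LTL (Fin n))) :
    rowStack σ k (φ :: fs) = row (truth σ φ) k ++ rowStack σ k fs := rfl

theorem length_wordStack (ps : List (Fin n)) : (wordStack σ k ps).length = ps.length * k := by
  simp [wordStack, List.length_flatMap]

/-- The stacks of the machine while it evaluates a formula: `tok` is the part of the formula that
has not been read, the values of `fs` have been computed, and the propositions of `skipped` have
been moved out of the way in order to look up one of those in `rest`. -/
noncomputable def evalStk (σ : ℕ → Set (Fin n)) (s k : ℕ) (tok : List Symb)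
    (skipped rest : List (Fin n)) (fs : List (LTL (Fin n))) : CheckerStack → List Symb :=
  stk [] [] tok (row (· == s) k) [] (wordStack σ k rest) (wordStack σ k skipped).reverse
    (rowStack σ k fs) [] [] []

open Classical in
/-- The number of accepting runs after a formula has been parsed with the given result. -/
noncomputable def outcome (σ : ℕ → Set (Fin n)) : Option (List (LTL (Fin n))) → ℕ
  | some [φ] => if φ.Sat σ then 1 else 0
  | _ => 0

theorem counts_main_tt
    (h : checker.Counts (.phase .main) (evalStk σ s k tok skipped rest (.tt :: fs)) N T) :
    checker.Counts (.phase .main) (evalStk σ s k (.tt :: tok) skipped rest fs) N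
      (T + 2 * k + 3) := by
  have hrow : row (truth σ (.tt : LTL (Fin n))) k =
      List.replicate (row (· == s) k).length .one := by
    have htrue : ∀ j < k, truth σ (.tt : LTL (Fin n)) j = true := by simp [LTL.SatAt]
    rw [row_congr htrue, row_const, length_row, bit]
  rw [evalStk, rowStack_cons, hrow] at h
  have hpush := counts_pushTrue _ h
  rw [length_row] at hpush
  exact .step nofun rfl (by funext k; cases k <;> rfl) hpush

theorem counts_main_unary {op : Symb} {c : LTL (Fin n) → LTL (Fin n)} (hs : s < k)
    (hop : isUnary op = true)
    (htrans : ∀ t, t .tok = some op →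
      checkerTrans (.phase .main) t = [(.unload op, ops [(.tok, .pop)])])
    (heval : ∀ φ, Evaluates op (truth σ φ) (truth σ φ) s k (truth σ (c φ)))
    (hmissing : fs = [] → N = 0)
    (h : ∀ φ fs', fs = φ :: fs' →
      checker.Counts (.phase .main) (evalStk σ s k tok skipped rest (c φ :: fs')) N T) :
    checker.Counts (.phase .main) (evalStk σ s k (op :: tok) skipped rest fs) N
      (T + 4 * k + 5) := by
  refine .step (S' := evalStk σ s k tok skipped rest fs) (o := ops [(.tok, .pop)]) nofun
    (htrans _ rfl) (by funext k; cases k <;> rfl) ?_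
  match fs, hmissing, h with
  | [], hmissing, _ =>
    obtain ⟨m, l, hml⟩ := exists_row_eq_cons (· == s) (Nat.zero_lt_of_lt hs)
    rw [hmissing rfl, evalStk, hml]
    exact counts_unload_missing
  | φ :: fs, _, h =>
    exact counts_operator hs (heval φ) (by rw [if_pos hop]) (h φ fs rfl)

theorem counts_main_binary {op : Symb} {c : LTL (Fin n) → LTL (Fin n) → LTL (Fin n)} (hs : s < k)
    (hop : isUnary op = false)
    (htrans : ∀ t, t .tok = some op →
      checkerTrans (.phase .main) t = [(.unload op, ops [(.tok, .pop)])])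
    (heval : ∀ φ ψ, Evaluates op (truth σ φ) (truth σ ψ) s k (truth σ (c φ ψ)))
    (hmissing : fs.length < 2 → N = 0)
    (h : ∀ φ ψ fs', fs = φ :: ψ :: fs' →
      checker.Counts (.phase .main) (evalStk σ s k tok skipped rest (c φ ψ :: fs')) N T) :
    checker.Counts (.phase .main) (evalStk σ s k (op :: tok) skipped rest fs) N
      (T + 4 * k + 5) := by
  refine .step (S' := evalStk σ s k tok skipped rest fs) (o := ops [(.tok, .pop)]) nofun
    (htrans _ rfl) (by funext k; cases k <;> rfl) ?_
  obtain ⟨m, l, hml⟩ := exists_row_eq_cons (· == s) (Nat.zero_lt_of_lt hs)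
  match fs, hmissing, h with
  | [], hmissing, _ =>
    rw [hmissing (by simp), evalStk, hml]
    exact counts_unload_missing
  | [φ], hmissing, _ =>
    rw [hmissing (by simp), evalStk, rowStack_cons]
    refine (counts_unload_load (T := 0) op _ _ (by simp) ?_).mono (by simp; omega)
    rw [hop, hml]
    exact counts_sweep_missing
  | φ :: ψ :: fs, _, h =>
    exact counts_operator hs (heval φ ψ) (by simp [hop]) (h φ ψ fs rfl)

theorem counts_main_nil (hk : 0 < k) :
    checker.Counts (.phase .main) (evalStk σ s k [] skipped rest fs) (outcome σ (some fs))
      (k + 2) := by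
  refine .step (S' := evalStk σ s k [] skipped rest fs) nofun rfl (by funext k; cases k <;> rfl) ?_
  obtain ⟨m, l, hml⟩ := exists_row_eq_cons (· == s) hk
  match fs with
  | [] =>
    rw [evalStk, hml]
    exact counts_final_missing
  | [φ] =>
    have hrow : row (truth σ φ) k = row (truth σ φ) (row (· == s) k).length := by
      rw [length_row]
    have houtcome : outcome σ (some [φ]) =
        if (if row (· == s) k = [] then false else truth σ φ 0) then 1 else 0 := by
      have hne : row (· == s) k ≠ [] := by simp [hml]
      rw [if_neg hne]
      by_cases hφ : φ.SatAt σ 0 <;> simp [outcome, LTL.Sat, truth, hφ]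
    rw [evalStk, rowStack_cons, rowStack, List.flatMap_nil, List.append_nil, hrow, houtcome]
    exact (counts_final (T := 0) _ _ _).mono (by simp)
  | φ :: ψ :: fs =>
    obtain ⟨b, r, hbr⟩ := exists_row_eq_cons (truth σ ψ) hk
    rw [evalStk, rowStack_cons, rowStack_cons, hbr]
    exact (counts_final_excess (T := 0) _ _ (by simp) _).mono (by simp)

theorem counts_skip_one {p : Fin n}
    (h : checker.Counts (.phase .skip) (evalStk σ s k tok (skipped ++ [p]) rest fs) N T) :
    checker.Counts (.phase .skip) (evalStk σ s k (.one :: tok) skipped (p :: rest) fs) N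
      (T + 2 * k + 3) := by
  have hskip := counts_skipRow (inp := []) (num := []) (tok := tok)
    (word := wordStack σ k rest) (word' := (wordStack σ k skipped).reverse)
    (rows := rowStack σ k fs) (aux₀ := []) (aux₁ := []) (arg := []) (N := N) (T := T)
    (row (· == s) k) (row (truth σ (.atom p)) k).reverse (by simp)
    (by simpa [evalStk, wordStack] using h)
  rw [length_row] at hskip
  exact .step nofun rfl (by funext k; cases k <;> rfl) hskip

theorem counts_skip_atom {p : Fin n}
    (h : checker.Counts (.phase .main)
      (evalStk σ s k tok [] (skipped ++ p :: rest) (.atom p :: fs)) N T) :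
    checker.Counts (.phase .skip) (evalStk σ s k (.atom :: tok) skipped (p :: rest) fs) N
      (T + skipped.length * k + 3 * k + 4) := by
  have hcopy := counts_copyRow (inp := []) (num := []) (tok := tok)
    (word := wordStack σ k rest) (word' := (wordStack σ k skipped).reverse)
    (rows := rowStack σ k fs) (aux₀ := []) (aux₁ := []) (arg := []) (N := N) (T := T)
    (row (· == s) k) (row (truth σ (.atom p)) k).reverse (by simp)
    (by simpa [evalStk, wordStack, rowStack_cons] using h)
  rw [List.length_reverse, length_row, length_wordStack] at hcopy
  exact .step nofun rfl (by funext k; cases k <;> rfl) hcopy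

theorem counts_skip_missing {t : Symb} (hk : 0 < k) :
    checker.Counts (.phase .skip) (evalStk σ s k (t :: tok) skipped [] fs) 0 (T + 1) := by
  obtain ⟨m, l, hml⟩ := exists_row_eq_cons (· == s) hk
  rw [evalStk, hml]
  cases t <;>
    first
    | exact .dead nofun rfl
    | exact .step nofun rfl (by funext k; cases k <;> rfl) counts_readRow_missing

theorem counts_main_cons (h : IsLasso σ s k) (t : Symb)
    (hmain : ∀ fs, checker.Counts (.phase .main) (evalStk σ s k tok [] rest fs)
      (outcome σ (parse n none tok fs)) T)
    (hskip : ∀ fs, checker.Counts (.phase .skip) (evalStk σ s k tok [] rest fs)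
      (outcome σ (parse n (some 0) tok fs)) T) :
    checker.Counts (.phase .main) (evalStk σ s k (t :: tok) [] rest fs)
      (outcome σ (parse n none (t :: tok) fs)) (T + 4 * k + 5) := by
  have hshort {op : Symb} (hop : op = .and ∨ op = .or ∨ op = .untl ∨ op = .release) :
      fs.length < 2 → outcome σ (parse n none (op :: tok) fs) = 0 := by
    rcases fs with _ | ⟨φ, _ | ⟨ψ, fs⟩⟩ <;> rcases hop with rfl | rfl | rfl | rfl <;>
      simp [parse, outcome]
  cases t with
  | one | atom => exact .dead nofun rfl
  | sep =>
    exact StackMachine.Counts.mono (.step nofun rfl (by funext k; cases k <;> rfl) (hskip fs))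
      (by omega)
  | tt => exact (counts_main_tt (hmain _)).mono (by omega)
  | neg =>
    refine counts_main_unary h.lt rfl (fun t ht => by simp only [checkerTrans, ht])
      h.evaluates_neg ?_ ?_
    · rintro rfl; rfl
    · rintro φ fs rfl; exact hmain _
  | next =>
    refine counts_main_unary h.lt rfl (fun t ht => by simp only [checkerTrans, ht])
      h.evaluates_next ?_ ?_
    · rintro rfl; rfl
    · rintro φ fs rfl; exact hmain _
  | and =>
    refine counts_main_binary h.lt rfl (fun t ht => by simp only [checkerTrans, ht])
      h.evaluates_and (hshort (by simp)) ?_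
    rintro φ ψ fs rfl; exact hmain _
  | or =>
    refine counts_main_binary h.lt rfl (fun t ht => by simp only [checkerTrans, ht])
      h.evaluates_or (hshort (by simp)) ?_
    rintro φ ψ fs rfl; exact hmain _
  | untl =>
    refine counts_main_binary h.lt rfl (fun t ht => by simp only [checkerTrans, ht])
      h.evaluates_untl (hshort (by simp)) ?_
    rintro φ ψ fs rfl; exact hmain _
  | release =>
    refine counts_main_binary h.lt rfl (fun t ht => by simp only [checkerTrans, ht])
      h.evaluates_release (hshort (by simp)) ?_
    rintro φ ψ fs rfl; exact hmain _

theorem counts_skip_cons (hk : 0 < k) (t : Symb) {i : ℕ}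
    (hmain : ∀ fs, checker.Counts (.phase .main) (evalStk σ s k tok [] (List.finRange n) fs)
      (outcome σ (parse n none tok fs)) T)
    (hskip : i < n → checker.Counts (.phase .skip)
      (evalStk σ s k tok ((List.finRange n).take (i + 1)) ((List.finRange n).drop (i + 1)) fs)
      (outcome σ (parse n (some (i + 1)) tok fs)) T) :
    checker.Counts (.phase .skip)
      (evalStk σ s k (t :: tok) ((List.finRange n).take i) ((List.finRange n).drop i) fs)
      (outcome σ (parse n (some i) (t :: tok) fs)) (T + n * k + 3 * k + 4) := by
  rcases Nat.lt_or_ge i n with hi | hi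
  · have hi' : i < (List.finRange n).length := by simpa using hi
    have hdrop : (List.finRange n).drop i = ⟨i, hi⟩ :: (List.finRange n).drop (i + 1) := by
      rw [List.drop_eq_getElem_cons hi', List.getElem_finRange, Fin.cast_mk]
    have htake : (List.finRange n).take (i + 1) = (List.finRange n).take i ++ [⟨i, hi⟩] := by
      rw [List.take_succ_eq_append_getElem hi', List.getElem_finRange, Fin.cast_mk]
    rw [hdrop]
    cases t with
    | one =>
      rw [parse, if_pos hi]
      exact (counts_skip_one (htake ▸ hskip hi)).mono (by omega)
    | atom =>
      rw [parse, dif_pos hi]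
      have hsplit : (List.finRange n).take i ++ ⟨i, hi⟩ :: (List.finRange n).drop (i + 1) =
          List.finRange n := by
        rw [← hdrop, List.take_append_drop]
      have hlength : ((List.finRange n).take i).length * k ≤ n * k := by
        gcongr
        simp
      exact (counts_skip_atom (hsplit ▸ hmain _)).mono (by omega)
    | _ => exact .dead nofun rfl
  · have hparse : parse n (some i) (t :: tok) fs = none := by
      cases t <;> simp [parse, hi.not_gt]
    rw [List.drop_eq_nil_of_le (by simpa using hi), hparse]
    exact (counts_skip_missing (T := 0) hk).mono (by omega)

theorem counts_parse (h : IsLasso σ s k) (tok : List Symb) :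
    (∀ fs, checker.Counts (.phase .main) (evalStk σ s k tok [] (List.finRange n) fs)
      (outcome σ (parse n none tok fs)) ((tok.length + 1) * (n * k + 4 * k + 5))) ∧
    ∀ i fs, checker.Counts (.phase .skip)
      (evalStk σ s k tok ((List.finRange n).take i) ((List.finRange n).drop i) fs)
      (outcome σ (parse n (some i) tok fs)) ((tok.length + 1) * (n * k + 4 * k + 5)) := by
  induction tok with
  | nil =>
    refine ⟨fun fs => (counts_main_nil (Nat.zero_lt_of_lt h.lt)).mono ?_, fun i fs =>
      .dead nofun rfl⟩
    simp only [List.length_nil]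
    omega
  | cons t tok ih =>
    obtain ⟨hmain, hskip⟩ := ih
    rw [List.length_cons, Nat.succ_mul]
    exact ⟨fun fs => (counts_main_cons h t hmain (hskip 0)).mono (by omega), fun i fs =>
      (counts_skip_cons (Nat.zero_lt_of_lt h.lt) t hmain fun _ => hskip (i + 1) fs).mono
        (by omega)⟩

end Evaluation

/-! ## Counting word-models is in #P -/

theorem bitSum_zero (j : ℕ) : ∀ W, bitSum (fun _ => 0) j W = 0 := by
  induction j with
  | zero => exact fun _ => rfl
  | succ j ih => intro W; rw [bitSum, ih, ih]

theorem coe_bitSum (p : List Bool → Prop) [DecidablePred p] (j : ℕ) : ∀ W : List Bool,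
    (bitSum (fun W => if p W then 1 else 0) j W : ℕ∞) =
      {V | V.length = j ∧ p (V ++ W)}.encard := by
  induction j with
  | zero =>
    intro W
    have hset : {V : List Bool | V.length = 0 ∧ p (V ++ W)} = {V | V = [] ∧ p W} := by
      ext V
      rw [Set.mem_ofPred_eq, Set.mem_ofPred_eq, List.length_eq_zero_iff]
      exact and_congr_right fun hV => by rw [hV, List.nil_append]
    rw [hset, bitSum]
    by_cases hp : p W <;> simp [hp]
  | succ j ih =>
    intro W
    have hset : {V : List Bool | V.length = j + 1 ∧ p (V ++ W)} =
        (· ++ [false]) '' {V | V.length = j ∧ p (V ++ false :: W)} ∪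
        (· ++ [true]) '' {V | V.length = j ∧ p (V ++ true :: W)} := by
      ext V
      rcases V.eq_nil_or_concat' with rfl | ⟨V, _ | _, rfl⟩ <;> simp
    have hdisjoint : Disjoint ((· ++ [false]) '' {V | V.length = j ∧ p (V ++ false :: W)})
        ((· ++ [true]) '' {V | V.length = j ∧ p (V ++ true :: W)}) := by
      rw [Set.disjoint_left]
      rintro _ ⟨V, -, rfl⟩ ⟨V', -, h⟩
      simp at h
    rw [hset, Set.encard_union_eq hdisjoint, (List.append_left_injective [false]).encard_image,
      (List.append_left_injective [true]).encard_image, ← ih, ← ih, bitSum, Nat.cast_add]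

section Letters

variable {n k : ℕ} {W : List Bool}

/-- The word over the sets of atomic propositions that is given by a list of bits, proposition by
proposition. -/
def letters (n k : ℕ) (W : List Bool) : List (Set (Fin n)) :=
  List.ofFn fun j : Fin k => {p | W[p * k + j]? = some true}

@[simp] theorem length_letters : (letters n k W).length = k := by
  simp [letters]

theorem mem_getElem_letters {p : Fin n} {j : ℕ} (hj : j < (letters n k W).length) :
    p ∈ (letters n k W)[j] ↔ W[p * k + j]? = some true := by
  simp [letters]

theorem mul_add_lt_mul {p j : ℕ} (hp : p < n) (hj : j < k) : p * k + j < n * k :=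
  calc p * k + j < p * k + k := by omega
    _ = (p + 1) * k := by ring
    _ ≤ n * k := Nat.mul_le_mul_right k hp

theorem reverse_row (f : ℕ → Bool) (k : ℕ) :
    (row f k).reverse = List.ofFn fun j : Fin k => bit (f j) := by
  induction k with
  | zero => rfl
  | succ k ih => rw [row, List.reverse_cons, ih, List.ofFn_succ_last]; simp

theorem map_bit_eq_wordStack {σ : ℕ → Set (Fin n)} (hW : W.length = n * k)
    (hσ : ∀ j (hj : j < (letters n k W).length), σ j = (letters n k W)[j]) :
    W.map bit = wordStack σ k (List.finRange n) := by
  have hbits : W.map bit = List.ofFn fun i : Fin (n * k) => bit (W[i]) := by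
    refine List.ext_getElem (by simp [hW]) fun i _ _ => ?_
    simp
  rw [hbits, List.ofFn_mul, wordStack, List.flatMap_def, ← List.ofFn_eq_map]
  congr 2
  funext p
  rw [reverse_row]
  congr 1
  funext j
  rw [Fin.getElem_fin]
  congr 1
  rw [Bool.eq_iff_iff, truth_eq_true, LTL.SatAt, hσ j (by simp), mem_getElem_letters,
    List.getElem?_eq_getElem (by rw [hW]; exact mul_add_lt_mul p.2 j.2), Option.some.injEq]

theorem letters_injOn (n k : ℕ) : Set.InjOn (letters n k) {W | W.length = n * k} := by
  intro W hW V hV h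
  have hbit : Function.Injective bit := Function.LeftInverse.injective isOne_bit
  refine hbit.list_map ?_
  rw [map_bit_eq_wordStack (σ := fun j => (letters n k W).getD j ∅) hW (by simp +contextual),
    map_bit_eq_wordStack (σ := fun j => (letters n k W).getD j ∅) hV (by simp +contextual [h])]

open Classical in
theorem exists_letters_eq (l : List (Set (Fin n))) :
    ∃ W, W.length = n * l.length ∧ letters n l.length W = l := by
  refine ⟨List.ofFn fun i : Fin (n * l.length) => decide (i.divNat ∈ l[i.modNat]), by simp,
    List.ext_getElem (by simp) fun j hj hjl => ?_⟩
  ext p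
  have hdiv : (⟨p * l.length + j, mul_add_lt_mul p.2 hjl⟩ : Fin (n * l.length)).divNat = p := by
    ext
    simp [Fin.divNat, Nat.mul_comm p.val, Nat.mul_add_div (by omega : l.length > 0),
      Nat.div_eq_of_lt hjl]
  rw [mem_getElem_letters, List.getElem?_ofFn, dif_pos (mul_add_lt_mul p.2 hjl), Option.some.injEq,
    decide_eq_true_eq, hdiv]
  simp [Fin.modNat, Nat.mod_eq_of_lt hjl]

/-- The pair of words given by a list of bits and the position at which the loop begins. -/
def wordPair (n k s : ℕ) (W : List Bool) : List (Set (Fin n)) × List (Set (Fin n)) :=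
  ((letters n k W).take s, (letters n k W).drop s)

theorem wordPair_injOn (n k s : ℕ) : Set.InjOn (wordPair n k s) {W | W.length = n * k} := by
  intro W hW V hV h
  refine letters_injOn n k hW hV ?_
  rw [← List.take_append_drop s (letters n k W), ← List.take_append_drop s (letters n k V)]
  exact congrArg (fun m => m.1 ++ m.2) h

theorem exists_wordPair_eq (u v : List (Set (Fin n))) (h : u.length + v.length = k) :
    ∃ W, W.length = n * k ∧ wordPair n k u.length W = (u, v) := by
  obtain ⟨W, hW, hletters⟩ := exists_letters_eq (u ++ v)
  rw [List.length_append, h] at hW hletters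
  exact ⟨W, hW, by simp [wordPair, hletters]⟩

theorem wordPair_snd_ne_nil {s : ℕ} (hs : s < k) : (wordPair n k s W).2 ≠ [] := by
  simpa [wordPair, ← List.length_pos_iff] using hs

theorem isWordModel_wordPair {s : ℕ} (hs : s < k) (φ : LTL (Fin n)) :
    φ.IsWordModel k (wordPair n k s W) ↔
      φ.Sat (omegaWord (wordPair n k s W).1 (wordPair n k s W).2 (wordPair_snd_ne_nil hs)) := by
  have hlength : (wordPair n k s W).1.length + (wordPair n k s W).2.length = k := by
    simp [wordPair]
    omega
  exact ⟨fun ⟨_, _, h⟩ => h, fun h => ⟨hlength, _, h⟩⟩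

open Classical in
theorem LTL.numWordModels_eq_sum (φ : LTL (Fin n)) (k : ℕ) :
    φ.numWordModels k = ∑ s ∈ Finset.range k,
      bitSum (fun W => if φ.IsWordModel k (wordPair n k s W) then 1 else 0) (n * k) [] := by
  set A : ℕ → Set (List Bool) := fun s =>
    {W | W.length = n * k ∧ φ.IsWordModel k (wordPair n k s W)}
  have hset : {m | φ.IsWordModel k m} =
      ⋃ s ∈ (Finset.range k : Set ℕ), wordPair n k s '' A s := by
    refine subset_antisymm ?_ (Set.iUnion₂_subset ?_)
    · rintro ⟨u, v⟩ h
      obtain ⟨W, hW, hpair⟩ := exists_wordPair_eq u v h.1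
      have hv := List.length_pos_iff.2 h.2.1
      exact Set.mem_biUnion (x := u.length) (by have := h.1; simp at this hv ⊢; omega)
        ⟨W, ⟨hW, by rwa [hpair]⟩, hpair⟩
    · rintro s - _ ⟨W, hW, rfl⟩
      exact hW.2
  have hdisjoint : (Finset.range k : Set ℕ).PairwiseDisjoint fun s => wordPair n k s '' A s := by
    rintro s hs t ht hst
    rw [Function.onFun, Set.disjoint_left]
    rintro _ ⟨W, -, rfl⟩ ⟨V, -, h⟩
    have hlength := congrArg (fun m => m.1.length) h
    simp only [wordPair, List.length_take, length_letters] at hlength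
    simp only [Finset.coe_range, Set.mem_Iio] at hs ht
    omega
  rw [numWordModels, Set.ncard, hset, (Finset.finite_toSet _).encard_biUnion hdisjoint,
    finsum_mem_coe_finset, ← ENat.toNat_natCast (∑ s ∈ _, _), Nat.cast_sum]
  congr 1
  refine Finset.sum_congr rfl fun s _ => ?_
  rw [((wordPair_injOn n k s).mono fun W hW => hW.1).encard_image, coe_bitSum]
  simp only [A, List.append_nil]

end Letters

theorem isLasso_omegaWord {α : Type} (u v : List α) (hv : v ≠ []) :
    IsLasso (omegaWord u v hv) u.length (u.length + v.length) := by
  have := List.length_pos_iff.2 hv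
  refine ⟨by omega, fun i hi => ?_⟩
  have hshift : ¬ i + (u.length + v.length - u.length) < u.length := by omega
  simp only [omegaWord, dif_neg hshift, dif_neg hi.not_gt]
  congr 1
  rw [show i + (u.length + v.length - u.length) - u.length = i - u.length + v.length by omega,
    Nat.add_mod_right]

theorem omegaWord_eq_getElem {α : Type} (u v : List α) (hv : v ≠ []) {i : ℕ}
    (hi : i < (u ++ v).length) : omegaWord u v hv i = (u ++ v)[i] := by
  rw [List.length_append] at hi
  unfold omegaWord
  split_ifs with hu
  · rw [List.getElem_append_left hu]
  · rw [List.getElem_append_right (by omega)]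
    congr 1
    exact Nat.mod_eq_of_lt (by omega)

theorem replicate_append_inj {α : Type*} {x : α} {l l' : List α} (h : l.head? ≠ some x)
    (h' : l'.head? ≠ some x) : ∀ {m n : ℕ},
    List.replicate m x ++ l = List.replicate n x ++ l' → m = n ∧ l = l'
  | 0, 0, heq => ⟨rfl, heq⟩
  | 0, n + 1, heq => by
    rw [List.replicate_zero, List.nil_append] at heq
    simp [heq, List.replicate_succ] at h
  | m + 1, 0, heq => by
    rw [List.replicate_zero, List.nil_append] at heq
    simp [← heq, List.replicate_succ] at h'
  | m + 1, n + 1, heq => by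
    rw [List.replicate_succ, List.replicate_succ, List.cons_append, List.cons_append,
      List.cons.injEq] at heq
    obtain ⟨rfl, rfl⟩ := replicate_append_inj h h' heq.2
    exact ⟨rfl, rfl⟩

open Classical in
theorem exists_replicate_append {α : Type*} (x : α) (l : List α) :
    ∃ n l', l = List.replicate n x ++ l' ∧ l'.head? ≠ some x := by
  induction l with
  | nil => exact ⟨0, [], rfl, nofun⟩
  | cons y l ih =>
    by_cases hy : y = x
    · obtain ⟨n, l', rfl, hl'⟩ := ih
      exact ⟨n + 1, l', by rw [hy]; rfl, hl'⟩
    · exact ⟨0, y :: l, rfl, by simpa using hy⟩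

theorem LTL.head?_reverse_encode_ne_one {n : ℕ} (φ : LTL (Fin n)) :
    φ.encode.reverse.head? ≠ some .one := by
  induction φ with
  | tt | atom p => simp [encode]
  | neg φ ih | next φ ih => cases h : φ.encode.getLast? <;> simp_all [encode]
  | and φ ψ ihφ ihψ | or φ ψ ihφ ihψ | untl φ ψ ihφ ihψ | release φ ψ ihφ ihψ =>
    cases hφ : φ.encode.getLast? <;> cases hψ : ψ.encode.getLast? <;> simp_all [encode]

theorem countWordModelsUnary_encode (x : Instance) :
    countWordModelsUnary x.encode = x.formula.numWordModels x.bound :=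
  Instance.encode_injective.extend_apply _ _ _

theorem countWordModelsUnary_eq_zero {w : List Symb} (h : ∀ x : Instance, x.encode ≠ w) :
    countWordModelsUnary w = 0 :=
  Function.extend_apply' _ _ _ fun ⟨x, hx⟩ => h x hx

section Checker

variable {n k : ℕ} {ts : List Symb}

theorem encode_eq_of_parse {φ : LTL (Fin n)} (h : parse n none ts [] = some [φ]) (k : ℕ) :
    (Instance.mk n φ k).encode =
      List.replicate n .one ++ .sep :: (ts.reverse ++ List.replicate k .one) := by
  have hencode : φ.encode = ts.reverse := by
    simpa using flatMap_encode_of_parse none ts [] [φ] h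
  rw [← hencode, Instance.encode]

theorem exists_parse_of_encode_eq (hts : ts.head? ≠ some .one) {x : Instance}
    (hx : x.encode = List.replicate n .one ++ .sep :: (ts.reverse ++ List.replicate k .one)) :
    ∃ φ, parse n none ts [] = some [φ] := by
  obtain ⟨m, φ, l⟩ := x
  obtain ⟨rfl, hrest⟩ := replicate_one_sep_inj _ _ _ _ hx
  have hreverse := congrArg List.reverse hrest
  simp only [List.reverse_append, List.reverse_replicate, List.reverse_reverse] at hreverse
  obtain ⟨-, rfl⟩ := replicate_append_inj φ.head?_reverse_encode_ne_one hts hreverse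
  refine ⟨φ, ?_⟩
  simpa [parse] using parse_encode φ [] []

theorem counts_main_wordPair {s : ℕ} (hs : s < k) {W : List Bool} (hW : W.length = n * k)
    (ts : List Symb) :
    checker.Counts (.phase .main)
      (stk [] [] ts (row (· == s) k) [] (W.map bit) [] [] [] [] [])
      (outcome (omegaWord (wordPair n k s W).1 (wordPair n k s W).2 (wordPair_snd_ne_nil hs))
        (parse n none ts []))
      ((ts.length + 1) * (n * k + 4 * k + 5)) := by
  have hlasso := isLasso_omegaWord (wordPair n k s W).1 _ (wordPair_snd_ne_nil (W := W) hs)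
  have hletters : (wordPair n k s W).1 ++ (wordPair n k s W).2 = letters n k W :=
    List.take_append_drop _ _
  have hlength : (wordPair n k s W).1.length = s := by simp [wordPair, hs.le]
  rw [← List.length_append, hletters, length_letters, hlength] at hlasso
  rw [map_bit_eq_wordStack hW]
  · exact (counts_parse hlasso ts).1 []
  · intro j hj
    simp only [omegaWord_eq_getElem _ _ _ (hletters ▸ hj), hletters]

theorem counts_readNum_of_forall {F : ℕ → List Bool → ℕ} {T : ℕ} (hts : ts.head? ≠ some .one)
    (h : ∀ s < k, ∀ W, W.length = n * k → checker.Counts (.phase .main)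
      (stk [] [] ts (row (· == s) k) [] (W.map bit) [] [] [] [] []) (F s W) T) :
    checker.Counts .readNum
      (stk (List.replicate n .one ++ .sep :: (ts.reverse ++ List.replicate k .one))
        [] [] [] [] [] [] [] [] [] [])
      (∑ s ∈ Finset.range k, bitSum (F s) (n * k) [])
      (T + n * (2 * k + 3) + 2 * k + ts.length + n + 4) := by
  have hguess : ∀ s < k, checker.Counts (.phase .guess)
      (stk [] (List.replicate n .one) ts (row (· == s) k) [] [] [] [] [] [] [])
      (bitSum (F s) (n * k) []) (T + n * (2 * k + 3) + 1) := fun s hs => by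
    simpa using counts_guess (pos := row (· == s) k) (m := 0) n (by simpa using h s hs) [] rfl
  have hbound := counts_readBound_false hts k 0 (by simpa using hguess)
  rw [Nat.zero_add, row, ← Finset.range_eq_Ico] at hbound
  have hreverse := counts_reverse (ts.reverse ++ List.replicate k .one) (tok := [])
    (by simpa using hbound)
  have hnum := counts_readNum n (num := []) (by simpa using hreverse)
  exact hnum.mono (by omega)

theorem counts_readNum_dead {w : List Symb} (hw : w.head? ≠ some .one) (hw' : w.head? ≠ some .sep)
    (n : ℕ) : ∀ num, checker.Counts .readNum
      (stk (List.replicate n .one ++ w) num [] [] [] [] [] [] [] [] []) 0 n := by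
  induction n with
  | zero =>
    refine fun num => .dead nofun ?_
    rcases w with _ | ⟨a, w⟩
    · rfl
    · cases a <;> first | rfl | exact absurd rfl hw | exact absurd rfl hw'
  | succ n ih =>
    exact fun num => .step nofun rfl (by funext k; cases k <;> rfl) (ih (.one :: num))

open Classical in
theorem counts_checker_of_sep (hts : ts.head? ≠ some .one) :
    checker.Counts .readNum
      (stk (List.replicate n .one ++ .sep :: (ts.reverse ++ List.replicate k .one))
        [] [] [] [] [] [] [] [] [] [])
      (countWordModelsUnary
        (List.replicate n .one ++ .sep :: (ts.reverse ++ List.replicate k .one)))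
      ((ts.length + 1) * (n * k + 4 * k + 5) + n * (2 * k + 3) + 2 * k + ts.length + n + 4) := by
  by_cases hparse : ∃ φ, parse n none ts [] = some [φ]
  · obtain ⟨φ, hφ⟩ := hparse
    rw [← encode_eq_of_parse hφ, countWordModelsUnary_encode, LTL.numWordModels_eq_sum,
      encode_eq_of_parse hφ]
    refine counts_readNum_of_forall hts fun s hs W hW => ?_
    convert counts_main_wordPair hs hW ts using 1
    simp only [hφ, outcome, isWordModel_wordPair hs]
  · rw [countWordModelsUnary_eq_zero fun x hx => hparse (exists_parse_of_encode_eq hts hx)]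
    have hzero (σ : ℕ → Set (Fin n)) : outcome σ (parse n none ts []) = 0 := by
      rw [outcome]
      exact fun φ hφ => hparse ⟨φ, hφ⟩
    simpa [bitSum_zero] using counts_readNum_of_forall (F := fun _ _ => 0) hts
      fun s hs W hW => hzero _ ▸ counts_main_wordPair hs hW ts

theorem counts_checker (w : List Symb) :
    checker.Counts .readNum (stk w [] [] [] [] [] [] [] [] [] []) (countWordModelsUnary w)
      ((w.length + 1) * (w.length * w.length + 4 * w.length + 5) +
        w.length * (2 * w.length + 3) + 3 * w.length + 4) := by
  obtain ⟨n, w, rfl, hw⟩ := exists_replicate_append .one w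
  by_cases hsep : w.head? = some .sep
  · obtain ⟨w, rfl⟩ := List.head?_eq_some_iff.1 hsep
    obtain ⟨k, ts, hts, hhead⟩ := exists_replicate_append .one w.reverse
    obtain rfl : w = ts.reverse ++ List.replicate k .one := by
      rw [← List.reverse_reverse w, hts, List.reverse_append, List.reverse_replicate]
    refine (counts_checker_of_sep hhead).mono ?_
    simp only [List.length_append, List.length_replicate, List.length_cons, List.length_reverse]
    set L := n + (ts.length + k + 1)
    have heval : (ts.length + 1) * (n * k + 4 * k + 5) ≤ (L + 1) * (L * L + 4 * L + 5) := by
      gcongr <;> omega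
    have hguess : n * (2 * k + 3) ≤ L * (2 * L + 3) := by gcongr <;> omega
    omega
  · have hzero : countWordModelsUnary (List.replicate n .one ++ w) = 0 := by
      refine countWordModelsUnary_eq_zero fun x hx => hsep ?_
      obtain ⟨-, rfl⟩ := replicate_append_inj (by simp) hw hx
      rfl
    rw [hzero]
    exact (counts_readNum_dead hw hsep n []).mono (by simp; omega)

end Checker

theorem inSharpP_countWordModelsUnary : InSharpP countWordModelsUnary := by
  refine checker.inSharpP_of_counts _
    ((.X + 1) * (.X * .X + 4 * .X + 5) + .X * (2 * .X + 3) + 3 * .X + 4) fun w => ?_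
  have hinput : (fun k => if k = checker.input then w else []) =
      stk w [] [] [] [] [] [] [] [] [] [] := by
    funext k
    cases k <;> rfl
  rw [hinput]
  exact (counts_checker w).mono (by simp)

/-! ## Polynomial-time generation of words -/

open Turing Function

/-- Programs that write a word, with loops over the letters of the input. They serve to construct
functions that are computable in polynomial time. -/
inductive Generator (A B : Type) where
  | emit (w : List B)
  | seq (g h : Generator A B)
  | foreach (f : A → Generator A B)

namespace Generator

variable {A B : Type}

/-- The word that a program writes on a given input. -/
def out : Generator A B → List A → List B
  | emit w, _ => w
  | seq g h, x => g.out x ++ h.out x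
  | foreach f, x => x.flatMap fun a => (f a).out x

/-- The number of steps of the machine for a program on a given input. -/
def time : Generator A B → List A → ℕ
  | emit _, _ => 1
  | seq g h, x => h.time x + g.time x
  | foreach f, x => x.length + 1 + (x.length + 1) + ((x.map fun a => (f a).time x + 1).sum + 1)

theorem exists_time_le [Finite A] (g : Generator A B) :
    ∃ p : Polynomial ℕ, ∀ x : List A, g.time x ≤ p.eval x.length := by
  have := Fintype.ofFinite A
  induction g with
  | emit w => exact ⟨1, fun x => by simp [time]⟩
  | seq g h ihg ihh =>
    obtain ⟨p, hp⟩ := ihg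
    obtain ⟨q, hq⟩ := ihh
    exact ⟨q + p, fun x => by rw [Polynomial.eval_add]; exact add_le_add (hq x) (hp x)⟩
  | foreach f ih =>
    choose p hp using ih
    refine ⟨.X + 1 + (.X + 1) + (.X * (∑ a, p a + 1) + 1), fun x => ?_⟩
    have hbody (a : A) : (f a).time x ≤ ∑ a, (p a).eval x.length :=
      (hp a x).trans <| Finset.single_le_sum (f := fun a => (p a).eval x.length)
        (fun _ _ => Nat.zero_le _) (Finset.mem_univ a)
    have hsum : (x.map fun a => (f a).time x + 1).sum ≤
        x.length * (∑ a, (p a).eval x.length + 1) := by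
      simpa using List.sum_le_card_nsmul (x.map fun a => (f a).time x + 1) _
        (List.forall_mem_map.2 fun a _ => Nat.add_le_add_right (hbody a) 1)
    simpa [time, Polynomial.eval_finsetSum] using hsum

/-- The phases of a loop: the input is moved to a buffer and to the stack of the loop, it is
restored from the buffer, and the body is executed for every letter on the stack of the loop. -/
inductive LoopPhase where
  | copy
  | restore
  | iterate

instance : Finite LoopPhase :=
  Finite.of_injective (fun p : LoopPhase => (p.rec 0 1 2 : Fin 3)) <| by
    rintro (_ | _ | _) (_ | _ | _) h <;> trivial

/-- The labels of the machine for a program. -/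
def Label : Generator A B → Type
  | emit _ => Unit
  | seq g h => g.Label ⊕ h.Label
  | foreach f => LoopPhase ⊕ Σ a, (f a).Label

theorem finite_label [Finite A] (g : Generator A B) : Finite g.Label := by
  induction g with
  | emit => exact inferInstanceAs (Finite Unit)
  | seq g h _ _ => exact inferInstanceAs (Finite (g.Label ⊕ h.Label))
  | foreach f _ => exact inferInstanceAs (Finite (LoopPhase ⊕ Σ a, (f a).Label))

/-- The label at which the execution of a program begins. Since words are written by pushing
symbols on a stack, they are written backwards, and `seq` executes its second part first. -/
def entry : ∀ g : Generator A B, g.Label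
  | emit _ => ()
  | seq _ h => Sum.inr h.entry
  | foreach _ => Sum.inl .copy

/-- The stacks that hold letters of the input. Every label has a stack of its own, but only the
labels of the phase `LoopPhase.iterate` use it. -/
inductive Register (Λ : Type) where
  | input
  | buffer
  | loop (l : Λ)
deriving DecidableEq

instance {Λ : Type} [Finite Λ] : Finite (Register Λ) :=
  Finite.of_surjective
    (fun i : Option (Option Λ) => i.elim .input fun j => j.elim .buffer .loop) <| by
    rintro (_ | _ | l)
    exacts [⟨none, rfl⟩, ⟨some none, rfl⟩, ⟨some (some l), rfl⟩]

/-- The stack alphabets; the stack `none` holds the output. -/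
abbrev Alphabet (A B Λ : Type) : Option (Register Λ) → Type
  | none => B
  | some _ => A

/-- The statements of the machines; their internal variable holds the letter that was popped
last. -/
abbrev Stmt (A B Λ : Type) := TM2.Stmt (Alphabet A B Λ) Λ (Option A)

/-- The configurations of the machines. -/
abbrev Cfg (A B Λ : Type) := TM2.Cfg (Alphabet A B Λ) Λ (Option A)

variable {Λ : Type}

open Classical in
/-- Push the letter that is held by the internal variable. -/
noncomputable def pushVar (i : Register Λ) (q : Stmt A B Λ) : Stmt A B Λ :=
  if h : Nonempty A then .push (some i) (fun v => v.getD h.some) q else q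

/-- Pop a letter into the internal variable and continue with `body`, or with `exit` if the stack
is empty. -/
def popElse (i : Register Λ) (body exit : Stmt A B Λ) : Stmt A B Λ :=
  .pop (some i) (fun _ s => s) (.branch Option.isSome body exit)

/-- The machine code of a program; `e` embeds its labels, and it ends at the label `exit`. -/
noncomputable def code : ∀ (g : Generator A B) (_e : g.Label → Λ) (_exit : Λ), g.Label → Stmt A B Λ
  | emit w, _, exit, _ => w.foldl (fun q b => .push none (fun _ => b) q) (.goto fun _ => exit)
  | seq g _, e, exit, .inl l => g.code (fun l => e (.inl l)) exit l
  | seq g h, e, _, .inr l => h.code (fun l => e (.inr l)) (e (.inl g.entry)) l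
  | foreach _, e, _, .inl .copy => popElse .input
      (pushVar .buffer (pushVar (.loop (e (.inl .iterate))) (.goto fun _ => e (.inl .copy))))
      (.goto fun _ => e (.inl .restore))
  | foreach _, e, _, .inl .restore => popElse .buffer
      (pushVar .input (.goto fun _ => e (.inl .restore)))
      (.goto fun _ => e (.inl .iterate))
  | foreach f, e, exit, .inl .iterate => popElse (.loop (e (.inl .iterate)))
      (.goto fun v => v.elim exit fun a => e (.inr ⟨a, (f a).entry⟩))
      (.goto fun _ => exit)
  | foreach f, e, _, .inr ⟨a, l⟩ => (f a).code (fun l => e (.inr ⟨a, l⟩)) (e (.inl .iterate)) l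

/-- The contents of the stacks that hold letters of the input. -/
def registers (x y : List A) (L : Λ → List A) : Register Λ → List A
  | .input => x
  | .buffer => y
  | .loop l => L l

/-- The contents of all stacks. -/
def contents (S : Register Λ → List A) (o : List B) : ∀ k, List (Alphabet A B Λ k)
  | none => o
  | some i => S i

/-- The machine `m` makes `t` steps from the configuration `c` to the configuration `c'`. -/
def Reach [DecidableEq Λ] (m : Λ → Stmt A B Λ) (t : ℕ) (c c' : Cfg A B Λ) : Prop :=
  (flip bind (TM2.step m))^[t] (some c) = some c'

variable [DecidableEq Λ]

theorem update_registers_input (x x' y : List A) (L : Λ → List A) :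
    update (registers x y L) .input x' = registers x' y L := by
  funext i
  cases i <;> simp [registers]

theorem update_registers_buffer (x y y' : List A) (L : Λ → List A) :
    update (registers x y L) .buffer y' = registers x y' L := by
  funext i
  cases i <;> simp [registers]

theorem update_registers_loop (x y l' : List A) (L : Λ → List A) (l : Λ) :
    update (registers x y L) (.loop l) l' = registers x y (update L l l') := by
  funext i
  cases i <;> simp [registers, update_apply]

theorem update_contents_none (S : Register Λ → List A) (o o' : List B) :
    update (contents S o) none o' = contents S o' := by
  funext k
  cases k <;> simp [contents]

theorem update_contents_some (S : Register Λ → List A) (o : List B) (i : Register Λ) (l : List A) :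
    update (contents S o) (some i) l = contents (update S i l) o := by
  funext k
  rcases k with _ | i'
  · simp [contents]
  · by_cases h : i' = i
    · subst h; simp [contents]
    · rw [update_of_ne (by simp [h])]; simp [contents, h]

theorem stepAux_pushVar (i : Register Λ) (q : Stmt A B Λ) (a : A) (S : Register Λ → List A)
    (o : List B) :
    TM2.stepAux (pushVar i q) (some a) (contents S o) =
      TM2.stepAux q (some a) (contents (update S i (a :: S i)) o) := by
  rw [pushVar, dif_pos ⟨a⟩, ← update_contents_some]
  rfl

theorem stepAux_popElse_nil {i : Register Λ} {S : Register Λ → List A} (h : S i = [])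
    (body exit : Stmt A B Λ) (v : Option A) (o : List B) :
    TM2.stepAux (popElse i body exit) v (contents S o) = TM2.stepAux exit none (contents S o) := by
  have hupdate : update S i [] = S := h ▸ update_eq_self i S
  simp [popElse, TM2.stepAux, update_contents_some, contents, h, hupdate]

theorem stepAux_popElse_cons {i : Register Λ} {S : Register Λ → List A} {a : A} {l : List A}
    (h : S i = a :: l) (body exit : Stmt A B Λ) (v : Option A) (o : List B) :
    TM2.stepAux (popElse i body exit) v (contents S o) =
      TM2.stepAux body (some a) (contents (update S i l) o) := by
  simp [popElse, TM2.stepAux, update_contents_some, contents, h]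

theorem stepAux_pushes (v : Option A) (S : Register Λ → List A) (w : List B) :
    ∀ (q : Stmt A B Λ) (o : List B),
      TM2.stepAux (w.foldl (fun q b => .push none (fun _ => b) q) q) v (contents S o) =
        TM2.stepAux q v (contents S (w ++ o)) := by
  induction w with
  | nil => exact fun _ _ => rfl
  | cons b w ih =>
    intro q o
    rw [List.foldl_cons, ih, TM2.stepAux, update_contents_none]
    rfl

variable {m : Λ → Stmt A B Λ}

theorem Reach.trans {s t : ℕ} {c c' c'' : Cfg A B Λ} (h : Reach m s c c') (h' : Reach m t c' c'') :
    Reach m (s + t) c c'' := by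
  unfold Reach at *
  rw [Nat.add_comm s t, iterate_add_apply, h, h']

theorem reach_one (l : Λ) (v : Option A) (S : ∀ k, List (Alphabet A B Λ k)) :
    Reach m 1 ⟨some l, v, S⟩ (TM2.stepAux (m l) v S) :=
  rfl

theorem reach_popElse {l : Λ} {i : Register Λ} {body exit : Stmt A B Λ}
    (hm : m l = popElse i body exit) (t : A → ℕ) (S : List A → List A → Register Λ → List A)
    (o : List A → List B) (hS : ∀ r w, S r w i = w)
    (hbody : ∀ r a w, ∃ v, Reach m (t a)
      (TM2.stepAux body (some a) (contents (update (S r (a :: w)) i w) (o r)))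
      ⟨some l, v, contents (S (a :: r) w) (o (a :: r))⟩) (w : List A) :
    ∀ (r : List A) (v : Option A), Reach m ((w.map fun a => t a + 1).sum + 1)
      ⟨some l, v, contents (S r w) (o r)⟩
      (TM2.stepAux exit none (contents (S (w.reverse ++ r) []) (o (w.reverse ++ r)))) := by
  induction w with
  | nil =>
    intro r v
    rw [List.reverse_nil, List.nil_append, ← stepAux_popElse_nil (hS r []) body exit v, ← hm]
    exact reach_one l v _
  | cons a w ih =>
    intro r v
    obtain ⟨v', hv'⟩ := hbody r a w
    rw [← stepAux_popElse_cons (hS r (a :: w)) body exit v, ← hm] at hv'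
    have h := ((reach_one l v _).trans hv').trans (ih (a :: r) v')
    rw [List.reverse_cons, List.append_assoc, List.map_cons, List.sum_cons]
    rwa [(by omega : 1 + t a + ((w.map fun a => t a + 1).sum + 1) =
      t a + 1 + (w.map fun a => t a + 1).sum + 1)] at h

section Foreach

variable {f : A → Generator A B} {e : (foreach f).Label → Λ} {exit : Λ}

theorem reach_copy (hm : ∀ l, m (e l) = (foreach f).code e exit l) (v : Option A) (x : List A)
    (L : Λ → List A) (hL : L (e (.inl .iterate)) = []) (o : List B) :
    Reach m (x.length + 1) ⟨some (e (.inl .copy)), v, contents (registers x [] L) o⟩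
      ⟨some (e (.inl .restore)), none,
        contents (registers [] x.reverse (update L (e (.inl .iterate)) x.reverse)) o⟩ := by
  have h := reach_popElse (hm (.inl .copy)) (fun _ => 0)
    (fun r w => registers w r (update L (e (.inl .iterate)) r)) (fun _ => o) (fun _ _ => rfl)
    (fun r a w => ⟨some a, by
      simp only [stepAux_pushVar, update_registers_input, update_registers_buffer,
        update_registers_loop, registers, update_self, update_idem]
      rfl⟩) x [] v
  rw [← hL, update_eq_self] at h
  simpa [hL] using h

theorem reach_restore (hm : ∀ l, m (e l) = (foreach f).code e exit l) (v : Option A) (x : List A)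
    (L : Λ → List A) (o : List B) :
    Reach m (x.length + 1) ⟨some (e (.inl .restore)), v, contents (registers [] x L) o⟩
      ⟨some (e (.inl .iterate)), none, contents (registers x.reverse [] L) o⟩ := by
  have h := reach_popElse (hm (.inl .restore)) (fun _ => 0) (fun r w => registers r w L)
    (fun _ => o) (fun _ _ => rfl)
    (fun r a w => ⟨some a, by
      simp only [stepAux_pushVar, update_registers_input, update_registers_buffer, registers]
      rfl⟩) x [] v
  simpa using h

end Foreach

theorem reach_code {x : List A} (g : Generator A B) :
    ∀ {e : g.Label → Λ} {exit : Λ}, Injective e → (∀ l, m (e l) = g.code e exit l) →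
      ∀ (L : Λ → List A), (∀ l, L (e l) = []) → ∀ (v : Option A) (o : List B),
      ∃ v', Reach m (g.time x) ⟨some (e g.entry), v, contents (registers x [] L) o⟩
        ⟨some exit, v', contents (registers x [] L) (g.out x ++ o)⟩ := by
  induction g with
  | emit w =>
    intro e exit _ hm L _ v o
    exact ⟨v, congrArg some <| (congrArg (TM2.stepAux · v _) (hm ())).trans
      (stepAux_pushes v _ w (.goto fun _ => exit) o)⟩
  | seq g h ihg ihh =>
    intro e exit he hm L hL v o
    obtain ⟨v₁, hv₁⟩ := ihh (he.comp Sum.inr_injective) (fun l => hm (.inr l)) L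
      (fun l => hL (.inr l)) v o
    obtain ⟨v₂, hv₂⟩ := ihg (he.comp Sum.inl_injective) (fun l => hm (.inl l)) L
      (fun l => hL (.inl l)) v₁ (h.out x ++ o)
    refine ⟨v₂, ?_⟩
    rw [out, List.append_assoc]
    exact hv₁.trans hv₂
  | foreach f ih =>
    intro e exit he hm L hL v o
    have hiterate := reach_popElse (hm (.inl .iterate)) (fun a => (f a).time x)
      (fun _ w => registers x [] (update L (e (.inl .iterate)) w))
      (fun r => (r.flatMap fun a => (f a).out x) ++ o) (fun _ _ => update_self _ _ _)
      (fun r a w => by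
        rw [update_registers_loop, update_idem, List.flatMap_cons, List.append_assoc]
        exact ih a (he.comp (Sum.inr_injective.comp sigma_mk_injective))
          (fun l => hm (.inr ⟨a, l⟩)) _
          (fun l => (update_of_ne (he.ne Sum.inr_ne_inl) _ _).trans (hL _)) (some a) _)
      x.reverse [] none
    rw [List.reverse_reverse, List.append_nil, List.map_reverse, List.sum_reverse,
      (hL (.inl .iterate) ▸ update_eq_self _ L : update L (e (.inl .iterate)) [] = L)] at hiterate
    have hcopy := reach_copy hm v x L (hL _) o
    have hrestore := reach_restore hm none x.reverse (update L (e (.inl .iterate)) x.reverse) o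
    rw [List.length_reverse, List.reverse_reverse] at hrestore
    exact ⟨none, (hcopy.trans hrestore).trans hiterate⟩

/-- The machine for a program: it runs the program and then empties the input stack. -/
noncomputable def machine (g : Generator A B) : Option g.Label → Stmt A B (Option g.Label)
  | none => popElse .input (.goto fun _ => none) .halt
  | some l => g.code some none l

theorem reach_machine (g : Generator A B) [DecidableEq g.Label] (x : List A) :
    Reach g.machine (g.time x + (x.length + 1))
      ⟨some (some g.entry), none, contents (registers x [] fun _ => []) []⟩
      ⟨none, none, contents (registers [] [] fun _ => []) (g.out x)⟩ := by
  obtain ⟨v, hrun⟩ := g.reach_code (m := g.machine) (x := x) (Option.some_injective _)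
    (fun _ => rfl) (fun _ => []) (fun _ => rfl) none []
  have hclear := reach_popElse (m := g.machine) (l := none) rfl (fun _ => 0)
    (fun _ w => registers w [] fun _ => []) (fun _ => g.out x) (fun _ _ => rfl)
    (fun _ a w => ⟨some a, by rw [update_registers_input]; rfl⟩) x [] v
  rw [List.append_nil] at hrun
  simpa using hrun.trans hclear

section

variable [Fintype A] (g : Generator A B) [DecidableEq g.Label] [Fintype g.Label]

/-- The machine for a program in the form of the library. -/
noncomputable def finTM2 : FinTM2 where
  K := Option (Register (Option g.Label))
  kFin := Fintype.ofFinite _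
  k₀ := some .input
  k₁ := none
  Γ := Alphabet A B (Option g.Label)
  Λ := Option g.Label
  main := some g.entry
  σ := Option A
  initialState := none
  Γk₀Fin := inferInstanceAs (Fintype A)
  m := g.machine

theorem initList_finTM2 (x : List A) :
    initList g.finTM2 x =
      ⟨some (some g.entry), none, contents (registers x [] fun _ => []) []⟩ := by
  refine congrArg (TM2.Cfg.mk _ _) (funext fun k => ?_)
  rcases k with _ | _ | _ | l <;> rfl

theorem haltList_finTM2 (w : List B) :
    haltList g.finTM2 w = ⟨none, none, contents (registers [] [] fun _ => []) w⟩ := by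
  refine congrArg (TM2.Cfg.mk _ _) (funext fun k => ?_)
  rcases k with _ | _ | _ | l <;> rfl

end

open Classical in
theorem polyTimeComputable_out [Finite A] (g : Generator A B) : PolyTimeComputable g.out := by
  have := Fintype.ofFinite A
  have := g.finite_label
  have := Fintype.ofFinite g.Label
  obtain ⟨p, hp⟩ := g.exists_time_le
  refine ⟨⟨⟨g.finTM2, Equiv.refl A, Equiv.refl B⟩, p + (.X + 1), fun x =>
    ⟨⟨g.time x + (x.length + 1), ?_⟩, by simpa using hp x⟩⟩⟩
  have hinit : initList g.finTM2 (x.map (Equiv.refl A).invFun) = _ :=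
    (congrArg _ x.map_id).trans (g.initList_finTM2 x)
  have hhalt : haltList g.finTM2 ((g.out x).map (Equiv.refl B).invFun) = _ :=
    (congrArg _ (g.out x).map_id).trans (g.haltList_finTM2 _)
  exact (congrArg (fun c => (flip bind g.finTM2.step)^[_] (some c)) hinit).trans
    (Eq.trans (g.reach_machine x) (congrArg some hhalt.symm))

end Generator

/-- A function on words that is computed by a generating program. -/
def IsGenerated {A B : Type} (r : List A → List B) : Prop :=
  ∃ g : Generator A B, ∀ x, g.out x = r x

/-- For every generated function `r`, the `f n`-fold repetition of `r x` is generated, where `n` is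
the length of `x`. -/
def IsGeneratedCount (A : Type) (f : ℕ → ℕ) : Prop :=
  ∀ ⦃B : Type⦄ ⦃r : List A → List B⦄, IsGenerated r →
    IsGenerated fun x => (List.replicate (f x.length) (r x)).flatten

section Generated

variable {A B : Type} {r s : List A → List B} {f g : ℕ → ℕ}

theorem IsGenerated.polyTimeComputable [Finite A] (hr : IsGenerated r) : PolyTimeComputable r := by
  obtain ⟨p, hp⟩ := hr
  rw [← funext hp]
  exact p.polyTimeComputable_out

theorem isGenerated_const (w : List B) : IsGenerated fun _ : List A => w :=
  ⟨.emit w, fun _ => rfl⟩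

theorem IsGenerated.append (hr : IsGenerated r) (hs : IsGenerated s) :
    IsGenerated fun x => r x ++ s x := by
  obtain ⟨p, hp⟩ := hr
  obtain ⟨q, hq⟩ := hs
  exact ⟨.seq p q, fun x => congrArg₂ (· ++ ·) (hp x) (hq x)⟩

theorem IsGenerated.cons (b : B) (hr : IsGenerated r) : IsGenerated fun x => b :: r x :=
  (isGenerated_const [b]).append hr

theorem isGenerated_flatMap (f : A → List B) : IsGenerated fun x : List A => x.flatMap f :=
  ⟨.foreach fun a => .emit (f a), fun _ => rfl⟩

theorem isGeneratedCount_id : IsGeneratedCount A fun n => n := by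
  rintro B r ⟨p, hp⟩
  refine ⟨.foreach fun _ => p, fun x => ?_⟩
  rw [Generator.out, hp, List.flatMap_def, List.map_const']

theorem IsGeneratedCount.add (hf : IsGeneratedCount A f) (hg : IsGeneratedCount A g) :
    IsGeneratedCount A fun n => f n + g n := by
  intro B r hr
  simpa only [List.replicate_add, List.flatten_append] using (hf hr).append (hg hr)

theorem isGeneratedCount_const (c : ℕ) : IsGeneratedCount A fun _ => c := by
  induction c with
  | zero => exact fun B r _ => isGenerated_const []
  | succ c ih => exact ih.add fun B r hr => by simpa using hr

theorem flatten_replicate_mul {α : Type*} (l : List α) (m n : ℕ) :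
    (List.replicate (m * n) l).flatten =
      (List.replicate m (List.replicate n l).flatten).flatten := by
  induction m with
  | zero => simp
  | succ m ih => rw [Nat.succ_mul, Nat.add_comm, List.replicate_add, List.flatten_append, ih]; rfl

theorem IsGeneratedCount.mul (hf : IsGeneratedCount A f) (hg : IsGeneratedCount A g) :
    IsGeneratedCount A fun n => f n * g n := by
  intro B r hr
  simpa only [flatten_replicate_mul] using hf (hg hr)

theorem isGeneratedCount_eval (p : Polynomial ℕ) : IsGeneratedCount A fun n => p.eval n := by
  induction p using Polynomial.induction_on with
  | C c => simpa using isGeneratedCount_const c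
  | add p q hp hq => simpa using hp.add hq
  | monomial n c h => simpa [pow_succ, mul_assoc] using h.mul isGeneratedCount_id

theorem IsGeneratedCount.replicate (hf : IsGeneratedCount A f) (b : B) :
    IsGenerated fun x : List A => List.replicate (f x.length) b := by
  simpa only [List.flatten_replicate_singleton] using hf (isGenerated_const [b])

end Generated

/-! ## Derived formulas -/

namespace LTL

section

variable {AP : Type}

/-- The disjunction of a list of formulas. -/
def disj : List (LTL AP) → LTL AP
  | [] => .neg .tt
  | φ :: l => .or φ (disj l)

/-- The conjunction of a list of formulas. -/
def conj : List (LTL AP) → LTL AP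
  | [] => .tt
  | φ :: l => .and φ (conj l)

/-- The formula `φ` holds in `n` steps. -/
def nexts (n : ℕ) (φ : LTL AP) : LTL AP :=
  next^[n] φ

/-- The formula `φ` holds from now on. -/
def always (φ : LTL AP) : LTL AP :=
  .release (.neg .tt) φ

/-- The formulas of a list hold one after the other. -/
def sequence : List (LTL AP) → LTL AP
  | [] => .tt
  | φ :: l => .and φ (.next (sequence l))

open Classical in
/-- The present letter is the singleton of `a`. -/
noncomputable def letter [Fintype AP] (a : AP) : LTL AP :=
  .and (.atom a) (conj ((Finset.univ.erase a).toList.map fun b => .neg (.atom b)))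

variable {σ : ℕ → Set AP} {i : ℕ} {φ : LTL AP} {l : List (LTL AP)}

theorem satAt_disj : (disj l).SatAt σ i ↔ ∃ φ ∈ l, φ.SatAt σ i := by
  induction l with
  | nil => simp [disj, SatAt]
  | cons φ l ih => simp [disj, SatAt, ih]

theorem satAt_conj : (conj l).SatAt σ i ↔ ∀ φ ∈ l, φ.SatAt σ i := by
  induction l with
  | nil => simp [conj, SatAt]
  | cons φ l ih => simp [conj, SatAt, ih]

theorem satAt_nexts (n : ℕ) : (nexts n φ).SatAt σ i ↔ φ.SatAt σ (i + n) := by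
  induction n generalizing i with
  | zero => rfl
  | succ n ih =>
    rw [nexts, Function.iterate_succ_apply', SatAt, ← nexts, ih, Nat.add_right_comm, Nat.add_assoc]

theorem satAt_always : (always φ).SatAt σ i ↔ ∀ j, i ≤ j → φ.SatAt σ j := by
  simp [always, SatAt]

theorem satAt_sequence :
    (sequence l).SatAt σ i ↔ ∀ j (hj : j < l.length), l[j].SatAt σ (i + j) := by
  induction l generalizing i with
  | nil => simp [sequence, SatAt]
  | cons φ l ih =>
    rw [sequence, SatAt, SatAt, ih]
    constructor
    · rintro ⟨hφ, hl⟩ (_ | j) hj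
      · exact hφ
      · have hj' := hl j (by simpa using hj)
        rwa [Nat.add_assoc, Nat.add_comm 1] at hj'
    · refine fun h => ⟨h 0 (by simp), fun j hj => ?_⟩
      rw [Nat.add_assoc, Nat.add_comm 1]
      exact h (j + 1) (by simpa using hj)

theorem satAt_letter [Fintype AP] {a : AP} : (letter a).SatAt σ i ↔ σ i = {a} := by
  classical
  simp only [letter, SatAt, satAt_conj, List.forall_mem_map, Finset.mem_toList, Finset.mem_erase,
    Finset.mem_univ, and_true, Set.eq_singleton_iff_unique_mem]
  refine and_congr_right fun _ => forall_congr' fun b => ?_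
  tauto

end

section Encode

variable {A ι : Type} {c : ℕ}

theorem encode_nexts (φ : LTL (Fin c)) (n : ℕ) :
    (nexts n φ).encode = List.replicate n .next ++ φ.encode := by
  induction n with
  | zero => rfl
  | succ n ih =>
    rw [nexts, Function.iterate_succ_apply', encode, ← nexts, ih]
    rfl

theorem encode_sequence (l : List (LTL (Fin c))) :
    (sequence l).encode = l.flatMap (fun φ => .and :: (φ.encode ++ [.next])) ++ [.tt] := by
  induction l with
  | nil => rfl
  | cons φ l ih => simp [sequence, encode, ih]

theorem isGenerated_encode_nexts {f : ℕ → ℕ} (hf : IsGeneratedCount A f) (φ : LTL (Fin c)) :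
    IsGenerated fun x : List A => (nexts (f x.length) φ).encode := by
  simpa only [encode_nexts] using (hf.replicate Symb.next).append (isGenerated_const φ.encode)

theorem isGenerated_encode_disj {φ : ι → List A → LTL (Fin c)}
    (hφ : ∀ i, IsGenerated fun x => (φ i x).encode) (l : List ι) :
    IsGenerated fun x => (disj (l.map fun i => φ i x)).encode := by
  induction l with
  | nil => exact isGenerated_const _
  | cons i l ih => exact ((hφ i).append ih).cons _

theorem isGenerated_encode_conj {φ : ι → List A → LTL (Fin c)}
    (hφ : ∀ i, IsGenerated fun x => (φ i x).encode) (l : List ι) :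
    IsGenerated fun x => (conj (l.map fun i => φ i x)).encode := by
  induction l with
  | nil => exact isGenerated_const _
  | cons i l ih => exact ((hφ i).append ih).cons _

end Encode

end LTL

/-! ## Formulas for words that are given by local constraints -/

theorem omegaWord_map_range {α : Type} (σ : ℕ → α) (n : ℕ) (b : α) (i : ℕ) :
    omegaWord ((List.range n).map σ) [b] (List.cons_ne_nil b []) i = if i < n then σ i else b := by
  simp [omegaWord, Nat.mod_one]

theorem eq_map_range_omegaWord {α : Type} {u v : List α} {hv : v ≠ []} {m : ℕ} {b : α}
    (hlength : u.length + v.length = m + 2) (hne : omegaWord u v hv m ≠ b)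
    (heq : ∀ i, m < i → omegaWord u v hv i = b) :
    (u, v) = ((List.range (m + 1)).map (omegaWord u v hv), [b]) := by
  have hpos := List.length_pos_iff.2 hv
  have hv_length : v.length = 1 := by
    by_contra hv_length
    refine hne ?_
    rw [← (isLasso_omegaWord u v hv).periodic m (by omega)]
    exact heq _ (by omega)
  have hget (i : ℕ) (hi : i < (u ++ v).length) : (u ++ v)[i] = omegaWord u v hv i :=
    (omegaWord_eq_getElem u v hv hi).symm
  have hu_length : u.length = m + 1 := by omega
  obtain ⟨a, rfl⟩ := List.length_eq_one_iff.1 hv_length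
  have ha : a = b := by
    rw [← heq (m + 1) (by omega), ← hget (m + 1) (by simp [hu_length])]
    simp [hu_length]
  refine Prod.ext (List.ext_getElem (by simp [hu_length]) fun i hi _ => ?_)
    (congrArg (fun c => [c]) ha)
  rw [List.getElem_map, List.getElem_range, ← hget i (by simp at hi ⊢; omega),
    List.getElem_append_left hi]

theorem LTL.numWordModels_eq_ncard {AP : Type} {φ : LTL AP} {m : ℕ} {b : Set AP}
    (hφ : ∀ σ, φ.Sat σ → σ m ≠ b ∧ ∀ i, m < i → σ i = b) :
    φ.numWordModels (m + 2) = {σ | φ.Sat σ}.ncard := by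
  have himage : {p | φ.IsWordModel (m + 2) p} =
      (fun σ => ((List.range (m + 1)).map σ, [b])) '' {σ | φ.Sat σ} := by
    refine subset_antisymm ?_ ?_
    · rintro ⟨u, v⟩ ⟨hlength, hv, hsat⟩
      obtain ⟨hne, heq⟩ := hφ _ hsat
      exact ⟨_, hsat, (eq_map_range_omegaWord hlength hne heq).symm⟩
    · rintro _ ⟨σ, hσ, rfl⟩
      have hword : omegaWord ((List.range (m + 1)).map σ) [b] (List.cons_ne_nil b []) = σ := by
        funext i
        rw [omegaWord_map_range]
        split_ifs with hi
        · rfl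
        · exact ((hφ σ hσ).2 i (by omega)).symm
      exact ⟨by simp, List.cons_ne_nil b [], hword.symm ▸ hσ⟩
  rw [numWordModels, himage, Set.InjOn.ncard_image]
  intro σ hσ τ hτ h
  funext i
  by_cases hi : i < m + 1
  · exact List.map_inj_left.1 (Prod.mk.inj h).1 i (List.mem_range.2 hi)
  · rw [(hφ σ hσ).2 i (by omega), (hφ τ hτ).2 i (by omega)]

/-- The infinite word `l` starts with `z`, its windows (the letters at the offsets `D` from some
position) satisfy `W`, and `pad` occurs at the position `m + 1` but not at the position `m`. -/
structure IsTiling {ι Λ : Type} (z : List Λ) (W : (ι → Λ) → Prop) (D : ι → ℕ) (pad : Λ) (m : ℕ)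
    (l : ℕ → Λ) : Prop where
  init : ∀ i (h : i < z.length), l i = z[i]
  window : ∀ i, W fun k => l (i + D k)
  ne_pad : l m ≠ pad
  eq_pad : l (m + 1) = pad

theorem IsTiling.eq_pad_of_lt {ι Λ : Type} {z : List Λ} {W : (ι → Λ) → Prop} {D : ι → ℕ}
    {pad : Λ} {m : ℕ} {l : ℕ → Λ} (h : IsTiling z W D pad m l) {k k' : ι} (hk : D k = 0)
    (hk' : D k' = 1) (hpad : ∀ q, W q → q k = pad → q k' = pad) {i : ℕ} (hi : m < i) :
    l i = pad := by
  induction i, hi using Nat.le_induction with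
  | base => exact h.eq_pad
  | succ i _ ih =>
    simpa only [hk'] using hpad _ (h.window i) (by simpa only [hk, Nat.add_zero] using ih)

section Tiling

variable {ι Λ : Type} [Fintype ι] [Finite Λ] {c : ℕ} (e : Λ ≃ Fin c) (z : List Λ)
  (W : (ι → Λ) → Prop) (D : ι → ℕ) (pad : Λ) (m : ℕ)

/-- The formula that describes a window. -/
noncomputable def windowFormula (q : ι → Λ) : LTL (Fin c) :=
  .conj (Finset.univ.toList.map fun k => .nexts (D k) (.letter (e (q k))))

/-- The formula that describes the words with the given local constraints. -/
noncomputable def tilingFormula : LTL (Fin c) :=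
  .and (.sequence (z.map fun a => .letter (e a)))
    (.and (.always (.disj ((Set.toFinite {q | W q}).toFinset.toList.map (windowFormula e D))))
      (.nexts m (.and (.neg (.letter (e pad))) (.next (.letter (e pad))))))

variable {e z W D pad m}

omit [Finite Λ] in
theorem satAt_windowFormula {q : ι → Λ} {σ : ℕ → Set (Fin c)} {i : ℕ} :
    (windowFormula e D q).SatAt σ i ↔ ∀ k, σ (i + D k) = {e (q k)} := by
  simp [windowFormula, LTL.satAt_conj, LTL.satAt_letter, LTL.satAt_nexts]

theorem sat_tilingFormula {k : ι} (hk : D k = 0) {σ : ℕ → Set (Fin c)} :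
    (tilingFormula e z W D pad m).Sat σ ↔
      ∃ l, IsTiling z W D pad m l ∧ (fun i => {e (l i)}) = σ := by
  simp only [LTL.Sat, tilingFormula, LTL.SatAt, LTL.satAt_sequence, LTL.satAt_always,
    LTL.satAt_disj, LTL.satAt_nexts, LTL.satAt_letter, satAt_windowFormula, List.getElem_map,
    List.length_map, Nat.zero_add, Nat.zero_le, forall_const, List.mem_map, Finset.mem_toList,
    Set.Finite.mem_toFinset, Set.mem_ofPred_eq, exists_exists_and_eq_and]
  constructor
  · rintro ⟨hinit, hwindow, hne, heq⟩
    have hletter (i : ℕ) : ∃ a, σ i = {e a} := by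
      obtain ⟨q, -, hq⟩ := hwindow i
      exact ⟨q k, by simpa [hk] using hq k⟩
    choose l hl using hletter
    obtain rfl : (fun i => {e (l i)}) = σ := funext fun i => (hl i).symm
    simp only [Set.singleton_eq_singleton_iff, EmbeddingLike.apply_eq_iff_eq] at *
    refine ⟨l, ⟨hinit, fun i => ?_, hne, heq⟩, rfl⟩
    obtain ⟨q, hW, hq⟩ := hwindow i
    rwa [funext hq]
  · rintro ⟨l, h, rfl⟩
    simp only [Set.singleton_eq_singleton_iff, EmbeddingLike.apply_eq_iff_eq]
    exact ⟨h.init, fun i => ⟨_, h.window i, fun _ => rfl⟩, h.ne_pad, h.eq_pad⟩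

theorem numWordModels_tilingFormula {k k' : ι} (hk : D k = 0) (hk' : D k' = 1)
    (hpad : ∀ q, W q → q k = pad → q k' = pad) :
    (tilingFormula e z W D pad m).numWordModels (m + 2) = {l | IsTiling z W D pad m l}.ncard := by
  have hinjective : Function.Injective fun (l : ℕ → Λ) i => ({e (l i)} : Set (Fin c)) :=
    Function.Injective.comp_left (Set.singleton_injective.comp e.injective)
  have hsat : {σ | (tilingFormula e z W D pad m).Sat σ} =
      (fun l i => {e (l i)}) '' {l | IsTiling z W D pad m l} :=
    Set.ext fun σ => sat_tilingFormula hk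
  rw [LTL.numWordModels_eq_ncard (b := {e pad}) ?_, hsat, Set.ncard_image_of_injective _ hinjective]
  intro σ hσ
  obtain ⟨l, h, rfl⟩ := (sat_tilingFormula hk).1 hσ
  exact ⟨by simpa using h.ne_pad,
    fun i hi => congrArg (fun a => {e a}) (h.eq_pad_of_lt hk hk' hpad hi)⟩

theorem isGenerated_encode_tilingFormula {A : Type} {z : List A → List Λ}
    (hz : ∀ f : Λ → List Symb, IsGenerated fun x => (z x).flatMap f) {D : ι → ℕ → ℕ}
    (hD : ∀ k, IsGeneratedCount A (D k)) {m : ℕ → ℕ} (hm : IsGeneratedCount A m) :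
    IsGenerated fun x => Instance.encode
      ⟨c, tilingFormula e (z x) W (fun k => D k x.length) pad (m x.length), m x.length + 2⟩ := by
  have hinit : IsGenerated fun x => (LTL.sequence ((z x).map fun a => .letter (e a))).encode := by
    simp only [LTL.encode_sequence, List.flatMap_map]
    exact (hz _).append (isGenerated_const _)
  have hwindow (q : ι → Λ) :
      IsGenerated fun x : List A => (windowFormula e (fun k => D k x.length) q).encode :=
    LTL.isGenerated_encode_conj (fun k => LTL.isGenerated_encode_nexts (hD k) _) _
  have halways : IsGenerated fun x : List A => (LTL.always (.disj
      ((Set.toFinite {q | W q}).toFinset.toList.map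
        (windowFormula e fun k => D k x.length)))).encode :=
    ((isGenerated_const _).append (LTL.isGenerated_encode_disj hwindow _)).cons _
  refine (isGenerated_const (List.replicate c Symb.one)).append (.cons Symb.sep (.append ?_
    ((hm.add (isGeneratedCount_const 2)).replicate Symb.one)))
  exact (hinit.append ((halways.append (LTL.isGenerated_encode_nexts hm _)).cons _)).cons _

end Tiling

/-! ## Accepting runs as sequences of transitions -/

namespace NTM

variable {A : Type}

/-- A transition of a machine: new state, symbols written, head movements. -/
abbrev Transition (M : NTM A) : Type := M.Q × (M.K → M.Γ) × (M.K → Move)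

open Classical in
/-- The possible transitions, where an accepting configuration is repeated forever. In this way all
computations are padded to the same length without changing the number of accepting runs. -/
noncomputable def transitions (M : NTM A) (q : M.Q) (r : M.K → M.Γ) : Set M.Transition :=
  if q ∈ M.accept then {(q, r, fun _ => .stay)} else M.δ q r

variable {M : NTM A}

theorem offset_injective : Function.Injective Move.offset := by
  rintro ⟨⟩ ⟨⟩ h <;> first | rfl | simp [Move.offset] at h

theorem Cfg.apply_injective (c : M.Cfg) : Function.Injective c.apply := by
  rintro ⟨q, w, m⟩ ⟨q', w', m'⟩ h
  have hstate : q = q' := congrArg Cfg.state h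
  have hwrite : w = w' := funext fun k => by
    simpa [apply] using congrFun (congrFun (congrArg Cfg.tape h) k) (c.head k)
  have hmove : m = m' := funext fun k =>
    offset_injective (by simpa [apply] using congrFun (congrArg Cfg.head h) k)
  rw [hstate, hwrite, hmove]

theorem Cfg.apply_stay (c : M.Cfg) : c.apply (c.state, c.read, fun _ => .stay) = c := by
  ext k
  · rfl
  · exact add_zero _
  · simp [apply, read]

/-- The transitions can be executed one after the other, from the given configuration to an
accepting one. -/
def IsScript : M.Cfg → List M.Transition → Prop
  | c, [] => c.state ∈ M.accept
  | c, t :: ts => t ∈ M.transitions c.state c.read ∧ IsScript (c.apply t) ts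

theorem isScript_iff {c : M.Cfg} {ts : List M.Transition} : IsScript c ts ↔
    (∀ t (h : t < ts.length), ts[t] ∈ M.transitions ((ts.take t).foldl Cfg.apply c).state
      ((ts.take t).foldl Cfg.apply c).read) ∧ (ts.foldl Cfg.apply c).state ∈ M.accept := by
  induction ts generalizing c with
  | nil => simp [IsScript]
  | cons t ts ih =>
    rw [IsScript, ih, ← and_assoc]
    refine and_congr_left fun _ => ⟨?_, fun h => ⟨h 0 (by simp), fun s hs => ?_⟩⟩
    · rintro ⟨hhead, htail⟩ (_ | s) hs
      · exact hhead
      · exact htail s (by simpa using hs)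
    · exact h (s + 1) (by simpa using hs)

open Classical in
/-- The run with the given transitions, up to the first accepting configuration. -/
noncomputable def runOf : M.Cfg → List M.Transition → List M.Cfg
  | c, [] => [c]
  | c, t :: ts => if c.state ∈ M.accept then [c] else c :: runOf (c.apply t) ts

theorem runOf_of_accept {c : M.Cfg} (h : c.state ∈ M.accept) (ts : List M.Transition) :
    runOf c ts = [c] := by
  cases ts <;> simp [runOf, h]

theorem head?_runOf (c : M.Cfg) (ts : List M.Transition) : (runOf c ts).head? = some c := by
  cases ts
  · rfl
  · rw [runOf]; split_ifs <;> rfl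

theorem IsScript.isChain_runOf {c : M.Cfg} {ts : List M.Transition} (h : IsScript c ts) :
    (runOf c ts).IsChain M.Step ∧ ∃ c', (runOf c ts).getLast? = some c' ∧ c'.state ∈ M.accept := by
  induction ts generalizing c with
  | nil => exact ⟨.singleton c, c, rfl, h⟩
  | cons t ts ih =>
    by_cases hc : c.state ∈ M.accept
    · rw [runOf_of_accept hc]
      exact ⟨.singleton c, c, rfl, hc⟩
    · obtain ⟨ht, hts⟩ := h
      obtain ⟨hchain, c', hlast, haccept⟩ := ih hts
      rw [transitions, if_neg hc] at ht
      rw [runOf, if_neg hc]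
      refine ⟨List.isChain_cons.2 ⟨fun d hd => ?_, hchain⟩, c', ?_, haccept⟩
      · rw [head?_runOf, Option.mem_some] at hd
        exact ⟨hc, t, ht, hd.symm⟩
      · rw [List.getLast?_cons, hlast]
        rfl

theorem IsScript.eq_of_runOf_eq {c : M.Cfg} {ts ts' : List M.Transition} (hts : IsScript c ts)
    (hts' : IsScript c ts') (hlength : ts.length = ts'.length) (hrun : runOf c ts = runOf c ts') :
    ts = ts' := by
  induction ts generalizing c ts' with
  | nil => exact (List.eq_nil_of_length_eq_zero hlength.symm).symm
  | cons t ts ih =>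
    obtain _ | ⟨t', ts'⟩ := ts'
    · simp at hlength
    obtain ⟨ht, hts⟩ := hts
    obtain ⟨ht', hts'⟩ := hts'
    obtain ⟨rfl, hrun⟩ : t = t' ∧ runOf (c.apply t) ts = runOf (c.apply t') ts' := by
      by_cases hc : c.state ∈ M.accept
      · rw [transitions, if_pos hc, Set.mem_singleton_iff] at ht ht'
        rw [ht, ht', Cfg.apply_stay, runOf_of_accept hc, runOf_of_accept hc]
        exact ⟨rfl, rfl⟩
      · rw [runOf, runOf, if_neg hc, if_neg hc, List.cons.injEq] at hrun
        have hhead := congrArg List.head? hrun.2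
        rw [head?_runOf, head?_runOf, Option.some_inj] at hhead
        exact ⟨c.apply_injective hhead, hrun.2⟩
    rw [ih hts hts' (by simpa using hlength) hrun]

theorem exists_isScript_of_accept {c : M.Cfg} (hc : c.state ∈ M.accept) (T : ℕ) :
    ∃ ts, ts.length = T ∧ IsScript c ts := by
  induction T with
  | zero => exact ⟨[], rfl, hc⟩
  | succ T ih =>
    obtain ⟨ts, hlength, hts⟩ := ih
    refine ⟨(c.state, c.read, fun _ => .stay) :: ts, by simp [hlength], ?_, ?_⟩
    · rw [transitions, if_pos hc]
      rfl
    · rwa [Cfg.apply_stay]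

theorem exists_runOf_eq {T : ℕ} {c : M.Cfg} {ρ : List M.Cfg} (hlength : ρ.length ≤ T + 1)
    (hhead : ρ.head? = some c) (hchain : ρ.IsChain M.Step)
    (hlast : ∃ c', ρ.getLast? = some c' ∧ c'.state ∈ M.accept) :
    ∃ ts, (ts.length = T ∧ IsScript c ts) ∧ runOf c ts = ρ := by
  induction ρ generalizing T c with
  | nil => simp at hhead
  | cons c₀ ρ ih =>
    obtain rfl : c₀ = c := by simpa using hhead
    obtain _ | ⟨c₁, ρ⟩ := ρ
    · obtain ⟨c', hc', haccept⟩ := hlast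
      obtain rfl : c₀ = c' := by simpa using hc'
      obtain ⟨ts, hts⟩ := exists_isScript_of_accept haccept T
      exact ⟨ts, hts, runOf_of_accept haccept ts⟩
    · rw [List.isChain_cons_cons] at hchain
      obtain ⟨⟨hc, t, ht, rfl⟩, hchain⟩ := hchain
      obtain _ | T := T
      · simp at hlength
      obtain ⟨ts, ⟨hts_length, hts⟩, hrun⟩ :=
        ih (by simpa using hlength) rfl hchain (by simpa using hlast)
      refine ⟨t :: ts, ⟨by simp [hts_length], ?_, hts⟩, ?_⟩
      · rwa [transitions, if_neg hc]
      · rw [runOf, if_neg hc, hrun]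

theorem numAcceptingRuns_eq_ncard_isScript {w : List A} {T : ℕ}
    (hT : ∀ ρ, M.IsRun w ρ → ρ.length ≤ T + 1) :
    M.numAcceptingRuns w = {ts | ts.length = T ∧ IsScript (M.init w) ts}.ncard := by
  have himage : {ρ | M.IsAcceptingRun w ρ} =
      runOf (M.init w) '' {ts | ts.length = T ∧ IsScript (M.init w) ts} := by
    ext ρ
    constructor
    · rintro ⟨hrun, hlast⟩
      exact exists_runOf_eq (hT ρ hrun) hrun.1 hrun.2 hlast
    · rintro ⟨ts, ⟨-, hts⟩, rfl⟩
      exact ⟨⟨head?_runOf _ _, hts.isChain_runOf.1⟩, hts.isChain_runOf.2⟩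
  rw [numAcceptingRuns, himage, Set.InjOn.ncard_image]
  rintro ts ⟨hlength, hts⟩ ts' ⟨hlength', hts'⟩ hrun
  exact hts.eq_of_runOf_eq hts' (hlength.trans hlength'.symm) hrun

end NTM

/-! ## Computation tableaux -/

namespace NTM

variable {A : Type}

/-- A cell of a row of a tableau. A row describes the contents of the tapes relative to the
positions of the heads; it carries the transition that has led to it. -/
@[ext]
structure Cell (M : NTM A) where
  /-- the cell is the first one of a row -/
  start : Bool
  /-- the next cell is the one under the heads -/
  pre : Bool
  /-- the transition of the row -/
  tr : M.Transition
  /-- the symbols on the tapes -/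
  sym : M.K → M.Γ

instance : Finite Move :=
  Finite.of_injective
    (fun m : Move => match m with | .left => (0 : Fin 3) | .stay => 1 | .right => 2)
    (by rintro ⟨⟩ ⟨⟩ h <;> first | rfl | simp at h)

instance (M : NTM A) : Finite M.Cell :=
  Finite.of_injective (fun c : M.Cell => (c.start, c.pre, c.tr, c.sym)) fun c d h => by
    simp only [Prod.mk.injEq] at h
    exact Cell.ext h.1 h.2.1 h.2.2.1 h.2.2.2

variable {M : NTM A}

/-- The symbol in the cell `b` with left neighbour `a` after writing. -/
def Cell.written (a b : M.Cell) (t : M.Transition) (k : M.K) : M.Γ :=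
  if a.pre then t.2.1 k else b.sym k

/-- The symbol in the cell below `b` after writing and moving the heads, where `a', a, b, c` are
consecutive cells of a row. -/
def Cell.moved (a' a b c : M.Cell) (t : M.Transition) (k : M.K) : M.Γ :=
  match t.2.2 k with
  | .left => Cell.written a' a t k
  | .stay => Cell.written a b t k
  | .right => Cell.written b c t k

/-- The local constraints on a tableau whose rows are written one after the other: `x₀, x₁, x₂, x₃`
are consecutive cells and `y` is the cell below `x₂`. The padding symbol is `none`. -/
structure Window (x₀ x₁ x₂ x₃ y : Option M.Cell) : Prop where
  eq_none : x₀ = none → x₁ = none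
  tr_eq : ∀ a b, x₀ = some a → x₁ = some b → b.start = false → b.tr = a.tr
  below : ∀ a' a b c d, x₀ = some a' → x₁ = some a → x₂ = some b → x₃ = some c → y = some d →
    d.start = b.start ∧ d.pre = b.pre ∧ d.sym = Cell.moved a' a b c d.tr
  step : ∀ a b d, x₁ = some a → x₂ = some b → y = some d → a.pre = true →
    d.tr ∈ M.transitions b.tr.1 b.sym
  accept : ∀ a b, x₁ = some a → x₂ = some b → y = none → a.pre = true → b.tr.1 ∈ M.accept

section

variable (x : List A) (T : ℕ)

/-- The number of cells of a row, which has room for the input and for `T` cells on either side of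
the heads. The window constraint computes the symbols near the ends of a row from an adjacent row,
but these symbols do not reach the heads within `T` steps. -/
def width : ℕ := 2 * T + x.length + 3

/-- The transition of the first row. -/
def startTransition : M.Transition :=
  (M.start, fun _ => M.blank, fun _ => .stay)

/-- The symbols on the tapes where the first row has the input symbol `a`, if any. -/
def startSym (a : Option A) (k : M.K) : M.Γ :=
  if k = M.inputTape then a.elim M.blank M.symb else M.blank

/-- A cell of the first row. -/
def initialCell (start pre : Bool) (a : Option A) : M.Cell :=
  ⟨start, pre, startTransition, startSym a⟩

/-- The input symbol at a position of the first row. -/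
def inputAt (s : ℕ) : Option A :=
  if T + 4 ≤ s then x[s - (T + 4)]? else none

/-- The cells of the first row. It begins at the position `2`, since the constraint on the cell
below `x₂` refers to two cells on the left of `x₂`; the heads are at the position `T + 4`. -/
def startCell (s : ℕ) : M.Cell :=
  initialCell (s = 2) (s = T + 3) (inputAt x T s)

/-- The first row with the two cells before it. -/
def startRow : List M.Cell :=
  (List.range (width x T + 2)).map (startCell x T)

variable (ts : List M.Transition)

/-- The transition of the row with the given number. -/
def rowTransition (t : ℕ) : M.Transition :=
  ((startTransition :: ts)[t]?).getD startTransition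

/-- The transition at a position of the tableau. -/
def trAt (s : ℕ) : M.Transition :=
  rowTransition ts ((s - 2) / width x T)

/-- The positions before the heads. -/
def preAt (s : ℕ) : Bool :=
  decide (2 ≤ s ∧ (s - 2) % width x T = T + 1)

/-- The symbols at a position of the tableau. -/
def symAt (s : ℕ) (k : M.K) : M.Γ :=
  if _h : s < width x T + 2 then startSym (inputAt x T s) k
  else
    have : 3 ≤ width x T := Nat.le_add_left 3 _
    match (trAt x T ts s).2.2 k with
    | .left => if preAt x T (s - width x T - 2) then (trAt x T ts s).2.1 k
      else symAt (s - width x T - 1) k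
    | .stay => if preAt x T (s - width x T - 1) then (trAt x T ts s).2.1 k
      else symAt (s - width x T) k
    | .right => if preAt x T (s - width x T) then (trAt x T ts s).2.1 k
      else symAt (s - width x T + 1) k
termination_by s

/-- The cell at a position of the tableau. -/
def cellAt (s : ℕ) : M.Cell :=
  ⟨decide (2 ≤ s ∧ (s - 2) % width x T = 0), preAt x T s, trAt x T ts s, symAt x T ts s⟩

/-- The tableau with the given transitions. -/
def tableau (s : ℕ) : Option M.Cell :=
  if s < (T + 1) * width x T + 2 then some (cellAt x T ts s) else none

theorem width_eq : width x T = 2 * T + x.length + 3 := rfl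

variable {x T ts}

theorem add_width_add_two_sub (s : ℕ) : s + (width x T + 2) - 2 = s + width x T := by
  omega

theorem row_lt_iff {t j : ℕ} (hj : 2 ≤ j) (hj' : j < width x T + 2) :
    t * width x T + j < (T + 1) * width x T + 2 ↔ t ≤ T := by
  constructor
  · intro h
    by_contra ht
    have := Nat.mul_le_mul_right (width x T) (show T + 1 ≤ t by omega)
    omega
  · intro h
    have := Nat.mul_le_mul_right (width x T) h
    rw [Nat.succ_mul]
    omega

theorem cellAt_of_lt {s : ℕ} (hs : s < width x T + 2) : cellAt x T ts s = startCell x T s := by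
  have hw := width_eq x T
  have hlt : s - 2 < width x T := by omega
  refine Cell.ext ?_ ?_ ?_ (funext fun k => ?_)
  · simp only [cellAt, startCell, initialCell, Nat.mod_eq_of_lt hlt]
    exact decide_eq_decide.2 (by omega)
  · simp only [cellAt, startCell, initialCell, preAt, Nat.mod_eq_of_lt hlt]
    exact decide_eq_decide.2 (by omega)
  · simp [cellAt, startCell, initialCell, trAt, rowTransition, Nat.div_eq_of_lt hlt]
  · simp only [cellAt, startCell, initialCell]
    rw [symAt, dif_pos hs]

theorem sym_cellAt_add (s : ℕ) : (cellAt x T ts (s + (width x T + 2))).sym =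
    Cell.moved (cellAt x T ts s) (cellAt x T ts (s + 1)) (cellAt x T ts (s + 2))
      (cellAt x T ts (s + 3)) (cellAt x T ts (s + (width x T + 2))).tr := by
  funext k
  simp only [cellAt]
  rw [symAt, dif_neg (by omega), Cell.moved]
  simp only [Cell.written]
  rw [show s + (width x T + 2) - width x T - 2 = s by omega,
    show s + (width x T + 2) - width x T - 1 = s + 1 by omega,
    show s + (width x T + 2) - width x T = s + 2 by omega]

theorem start_cellAt_add (s : ℕ) :
    (cellAt x T ts (s + (width x T + 2))).start = (cellAt x T ts (s + 2)).start := by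
  simp only [cellAt]
  rw [add_width_add_two_sub, Nat.add_mod_right, Nat.add_sub_cancel]
  exact decide_eq_decide.2 (by omega)

theorem pre_cellAt_add (s : ℕ) :
    (cellAt x T ts (s + (width x T + 2))).pre = (cellAt x T ts (s + 2)).pre := by
  simp only [cellAt, preAt]
  rw [add_width_add_two_sub, Nat.add_mod_right, Nat.add_sub_cancel]
  exact decide_eq_decide.2 (by omega)

theorem tr_cellAt_succ {s : ℕ} (h : (cellAt x T ts (s + 1)).start = false) :
    (cellAt x T ts (s + 1)).tr = (cellAt x T ts s).tr := by
  rcases s with _ | _ | s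
  · rfl
  · rfl
  · simp only [cellAt, decide_eq_false_iff_not] at h
    simp only [cellAt, trAt]
    rw [show s + 1 + 1 + 1 - 2 = s + 1 by omega, show s + 1 + 1 - 2 = s by omega, Nat.succ_div,
      if_neg, Nat.add_zero]
    exact fun hdvd => h ⟨by omega, Nat.mod_eq_zero_of_dvd hdvd⟩

theorem tr_cellAt_row {t j : ℕ} (hj : 2 ≤ j) (hj' : j < width x T + 2) :
    (cellAt x T ts (t * width x T + j)).tr = rowTransition ts t := by
  simp only [cellAt, trAt]
  rw [show t * width x T + j - 2 = j - 2 + t * width x T by omega,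
    Nat.add_mul_div_right _ _ (by omega), Nat.div_eq_of_lt (by omega), Nat.zero_add]

theorem pre_cellAt_iff {s : ℕ} :
    (cellAt x T ts s).pre = true ↔ ∃ t, s = t * width x T + (T + 3) := by
  have hw := width_eq x T
  simp only [cellAt, preAt, decide_eq_true_eq]
  constructor
  · intro h
    have hdiv := Nat.div_add_mod' (s - 2) (width x T)
    exact ⟨(s - 2) / width x T, by omega⟩
  · rintro ⟨t, rfl⟩
    rw [show t * width x T + (T + 3) - 2 = T + 1 + t * width x T by omega,
      Nat.add_mul_mod_self_right, Nat.mod_eq_of_lt (by omega)]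
    omega

theorem pre_cellAt_row {t j : ℕ} (hj : 2 ≤ j) (hj' : j < width x T + 2) :
    (cellAt x T ts (t * width x T + j)).pre = true ↔ j = T + 3 := by
  simp only [cellAt, preAt, decide_eq_true_eq]
  rw [show t * width x T + j - 2 = j - 2 + t * width x T by omega, Nat.add_mul_mod_self_right,
    Nat.mod_eq_of_lt (by omega)]
  omega

theorem exists_of_start_cellAt {s : ℕ} (h : (cellAt x T ts s).start = true) :
    ∃ t, s = t * width x T + 2 := by
  simp only [cellAt, decide_eq_true_eq] at h
  have hdiv := Nat.div_add_mod' (s - 2) (width x T)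
  exact ⟨(s - 2) / width x T, by omega⟩

theorem rowTransition_succ {t : ℕ} (ht : t < ts.length) : rowTransition ts (t + 1) = ts[t] := by
  rw [rowTransition, List.getElem?_cons_succ, List.getElem?_eq_getElem ht, Option.getD_some]

/-- The configuration after the first `t` transitions. -/
def cfgAt (x : List A) (ts : List M.Transition) (t : ℕ) : M.Cfg :=
  (ts.take t).foldl Cfg.apply (M.init x)

theorem cfgAt_succ {t : ℕ} (ht : t < ts.length) :
    cfgAt x ts (t + 1) = (cfgAt x ts t).apply ts[t] := by
  rw [cfgAt, List.take_succ_eq_append_getElem ht, List.foldl_append]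
  rfl

theorem state_cfgAt {t : ℕ} (ht : t ≤ ts.length) :
    (cfgAt x ts t).state = (rowTransition ts t).1 := by
  rcases t with _ | t
  · rfl
  · rw [cfgAt_succ ht, rowTransition_succ ht]
    rfl

theorem startSym_inputAt (j : ℕ) (k : M.K) :
    startSym (inputAt x T j) k = (M.init x).tape k (j - (T + 4)) := by
  simp only [startSym, inputAt, init]
  by_cases hj : T + 4 ≤ j
  · rw [show (j : ℤ) - (T + 4) = ((j - (T + 4) : ℕ) : ℤ) by omega]
    simp only [hj, if_true, Int.toNat_natCast, Int.natCast_nonneg, and_true]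
  · have hneg : ¬(k = M.inputTape ∧ 0 ≤ (j : ℤ) - (T + 4)) := fun h => hj (by omega)
    rw [if_neg hj, if_neg hneg]
    exact ite_self _

theorem written_cellAt_row {t j : ℕ} (hj : 2 ≤ j) (hj' : j < width x T + 2) {c : M.Cfg} {k : M.K}
    (hsym : symAt x T ts (t * width x T + (j + 1)) k =
      c.tape k (c.head k + ((j + 1 : ℕ) - (T + 4)))) (τ : M.Transition) :
    Cell.written (cellAt x T ts (t * width x T + j)) (cellAt x T ts (t * width x T + (j + 1))) τ k =
      (c.apply τ).tape k (c.head k + ((j + 1 : ℕ) - (T + 4))) := by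
  rw [Cell.written]
  simp only [pre_cellAt_row hj hj', Cfg.apply]
  split_ifs with hhead
  · rw [show ((j + 1 : ℕ) : ℤ) - (T + 4) = 0 by omega, add_zero, Function.update_self]
  · rw [Function.update_of_ne (by omega)]
    exact hsym

/-- The rows describe the configurations near the heads; in every step, the symbols at one more
position at either end of a row become meaningless. -/
theorem symAt_row {t : ℕ} (ht : t ≤ ts.length) {j : ℕ} (k : M.K) (hj : t + 4 ≤ j)
    (hj' : j + t ≤ 2 * T + 4) : symAt x T ts (t * width x T + j) k =
      (cfgAt x ts t).tape k ((cfgAt x ts t).head k + (j - (T + 4))) := by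
  have hw := width_eq x T
  induction t generalizing j with
  | zero =>
    rw [symAt, dif_pos (by omega), Nat.zero_mul, Nat.zero_add, startSym_inputAt]
    exact congrArg _ (zero_add _).symm
  | succ t ih =>
    have hwritten (i : ℕ) (hi : t + 3 ≤ i) (hi' : i + 1 + t ≤ 2 * T + 4) :=
      written_cellAt_row (by omega) (by omega) (ih (by omega) (by omega) hi') ts[t]
    obtain ⟨i, rfl⟩ := Nat.exists_eq_add_of_le' (show 2 ≤ j by omega)
    have hrow : (t + 1) * width x T + (i + 2) = t * width x T + i + (width x T + 2) := by
      rw [Nat.succ_mul]; omega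
    have htr : (cellAt x T ts ((t + 1) * width x T + (i + 2))).tr = ts[t] :=
      (tr_cellAt_row (by omega) (by omega)).trans (rowTransition_succ ht)
    have hsym := congrFun (sym_cellAt_add (x := x) (T := T) (ts := ts) (t * width x T + i)) k
    rw [← hrow, htr, Cell.moved] at hsym
    refine hsym.trans ?_
    rw [cfgAt_succ ht]
    have hhead : ((cfgAt x ts t).apply ts[t]).head k =
        (cfgAt x ts t).head k + (ts[t].2.2 k).offset := rfl
    rw [hhead]
    cases ts[t].2.2 k with
    | left =>
      refine (hwritten i (by omega) (by omega)).trans (congrArg _ ?_)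
      simp only [Move.offset]
      omega
    | stay =>
      refine (hwritten (i + 1) (by omega) (by omega)).trans (congrArg _ ?_)
      simp only [Move.offset]
      omega
    | right =>
      refine (hwritten (i + 2) (by omega) (by omega)).trans (congrArg _ ?_)
      simp only [Move.offset]
      omega

theorem sym_cellAt_head {t : ℕ} (ht : t ≤ ts.length) (hT : t ≤ T) :
    (cellAt x T ts (t * width x T + (T + 4))).sym = (cfgAt x ts t).read := by
  funext k
  refine (symAt_row ht k (by omega) (by omega)).trans ?_
  simp [Cfg.read]

theorem state_cellAt_head {t : ℕ} (ht : t ≤ ts.length) :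
    (cellAt x T ts (t * width x T + (T + 4))).tr.1 = (cfgAt x ts t).state := by
  rw [tr_cellAt_row (by omega) (by rw [width_eq]; omega), state_cfgAt ht]

theorem tr_cellAt_below_head {t : ℕ} (ht : t < ts.length) :
    (cellAt x T ts (t * width x T + (T + 2) + (width x T + 2))).tr = ts[t] := by
  rw [show t * width x T + (T + 2) + (width x T + 2) = (t + 1) * width x T + (T + 4) by
    rw [Nat.succ_mul]; omega, tr_cellAt_row (by omega) (by rw [width_eq]; omega),
    rowTransition_succ ht]

theorem step_cellAt_head_iff {t : ℕ} (ht : t < ts.length) (hT : t ≤ T) :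
    (cellAt x T ts (t * width x T + (T + 2) + (width x T + 2))).tr ∈
      M.transitions (cellAt x T ts (t * width x T + (T + 2) + 2)).tr.1
        (cellAt x T ts (t * width x T + (T + 2) + 2)).sym ↔
    ts[t] ∈ M.transitions (cfgAt x ts t).state (cfgAt x ts t).read := by
  rw [tr_cellAt_below_head ht, Nat.add_assoc, state_cellAt_head ht.le, sym_cellAt_head ht.le hT]

theorem tableau_of_lt {s : ℕ} (h : s < (T + 1) * width x T + 2) :
    tableau x T ts s = some (cellAt x T ts s) := if_pos h

theorem tableau_eq_some {s : ℕ} {a : M.Cell} : tableau x T ts s = some a ↔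
    s < (T + 1) * width x T + 2 ∧ cellAt x T ts s = a := by
  simp [tableau]

theorem tableau_eq_none {s : ℕ} : tableau x T ts s = none ↔ (T + 1) * width x T + 2 ≤ s := by
  simp [tableau]

end

end NTM

namespace NTM

section

variable {A : Type} {M : NTM A} {x : List A} {T : ℕ} {ts : List M.Transition}
  {l : ℕ → Option M.Cell}

/-- The words that describe accepting computations of `T` steps on `x`. -/
def IsTableau (x : List A) (T : ℕ) (l : ℕ → Option M.Cell) : Prop :=
  IsTiling ((startRow x T).map some)
    (fun q : Fin 5 → Option M.Cell => Window (q 0) (q 1) (q 2) (q 3) (q 4))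
    ![0, 1, 2, 3, width x T + 2] none ((T + 1) * width x T + 1) l

theorem IsTableau.window (h : IsTableau x T l) (s : ℕ) :
    Window (l s) (l (s + 1)) (l (s + 2)) (l (s + 3)) (l (s + (width x T + 2))) :=
  IsTiling.window h s

theorem IsTableau.eq_none (h : IsTableau x T l) {s : ℕ} (hs : (T + 1) * width x T + 2 ≤ s) :
    l s = none :=
  h.eq_pad_of_lt (k := 0) (k' := 1) rfl rfl (fun _ hq => hq.eq_none) hs

theorem IsTableau.ne_none (h : IsTableau x T l) {s : ℕ} (hs : s < (T + 1) * width x T + 2) :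
    l s ≠ none := by
  intro hnone
  have hall (i : ℕ) (hi : s ≤ i) : l i = none := by
    induction i, hi using Nat.le_induction with
    | base => exact hnone
    | succ i _ ih => exact (h.window i).eq_none ih
  exact h.ne_pad (hall _ (by omega))

theorem isScript_of_isTableau_tableau (hts : ts.length = T) (h : IsTableau x T (tableau x T ts)) :
    IsScript (M.init x) ts := by
  have hw := width_eq x T
  have hpre (t : ℕ) : (cellAt x T ts (t * width x T + (T + 2) + 1)).pre = true :=
    pre_cellAt_iff.2 ⟨t, by omega⟩
  have hrow {t : ℕ} (ht : t ≤ T) : t * width x T + (T + 4) < (T + 1) * width x T + 2 :=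
    (row_lt_iff (by omega) (by omega)).2 ht
  rw [isScript_iff]
  constructor
  · intro t ht
    have hnext := hrow (show t + 1 ≤ T by omega)
    rw [Nat.succ_mul] at hnext
    exact (step_cellAt_head_iff ht (by omega)).1 <|
      (h.window (t * width x T + (T + 2))).step _ _ _ (tableau_of_lt (by omega))
        (tableau_of_lt (by omega)) (tableau_of_lt (by omega)) (hpre t)
  · have hlast := hrow le_rfl
    have hend : (T + 1) * width x T = T * width x T + width x T := Nat.succ_mul _ _
    have haccept := (h.window (T * width x T + (T + 2))).accept _ _ (tableau_of_lt (by omega))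
      (tableau_of_lt (by omega)) (tableau_eq_none.2 (by omega)) (hpre T)
    rwa [Nat.add_assoc, state_cellAt_head hts.ge, cfgAt, List.take_of_length_le hts.le] at haccept

theorem window_tableau (hts : ts.length = T) (h : IsScript (M.init x) ts) (s : ℕ) :
    Window (tableau x T ts s) (tableau x T ts (s + 1)) (tableau x T ts (s + 2))
      (tableau x T ts (s + 3)) (tableau x T ts (s + (width x T + 2))) := by
  have hw := width_eq x T
  obtain ⟨hstep, haccept⟩ := isScript_iff.1 h
  have hrow {t : ℕ} : t * width x T + (T + 4) < (T + 1) * width x T + 2 ↔ t ≤ T :=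
    row_lt_iff (by omega) (by omega)
  refine ⟨fun h => ?_, ?_, ?_, ?_, ?_⟩
  · rw [tableau_eq_none] at h ⊢
    omega
  · simp only [tableau_eq_some]
    rintro _ _ ⟨-, rfl⟩ ⟨-, rfl⟩ hstart
    exact tr_cellAt_succ hstart
  · simp only [tableau_eq_some]
    rintro _ _ _ _ _ ⟨-, rfl⟩ ⟨-, rfl⟩ ⟨-, rfl⟩ ⟨-, rfl⟩ ⟨-, rfl⟩
    exact ⟨start_cellAt_add s, pre_cellAt_add s, sym_cellAt_add s⟩
  · simp only [tableau_eq_some]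
    rintro _ _ _ ⟨-, rfl⟩ ⟨-, rfl⟩ ⟨hs, rfl⟩ hpre
    obtain ⟨t, ht⟩ := pre_cellAt_iff.1 hpre
    obtain rfl : s = t * width x T + (T + 2) := by omega
    have htT : t + 1 ≤ T := hrow.1 (by rw [Nat.succ_mul]; omega)
    exact (step_cellAt_head_iff (by omega) (by omega)).2 (hstep t (by omega))
  · simp only [tableau_eq_some, tableau_eq_none]
    rintro _ _ ⟨-, rfl⟩ ⟨hs, rfl⟩ hbelow hpre
    obtain ⟨t, ht⟩ := pre_cellAt_iff.1 hpre
    obtain rfl : s = t * width x T + (T + 2) := by omega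
    have htT : ¬ t + 1 ≤ T := fun hle => by
      have := hrow.2 hle
      rw [Nat.succ_mul] at this
      omega
    obtain rfl : t = T := le_antisymm (hrow.1 hs) (by omega)
    rwa [Nat.add_assoc, state_cellAt_head hts.ge, cfgAt, List.take_of_length_le hts.le]

theorem isTableau_tableau_iff (hts : ts.length = T) :
    IsTableau x T (tableau x T ts) ↔ IsScript (M.init x) ts := by
  refine ⟨isScript_of_isTableau_tableau hts, fun h => ⟨fun s hs => ?_, window_tableau hts h, ?_,
    tableau_eq_none.2 le_rfl⟩⟩
  · rw [startRow, List.length_map, List.length_map, List.length_range] at hs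
    simp only [startRow, List.getElem_map, List.getElem_range]
    rw [tableau_of_lt (by rw [Nat.succ_mul]; omega),
      cellAt_of_lt hs]
  · rw [tableau_of_lt (by omega)]
    exact Option.some_ne_none _

/-- The transitions that a tableau carries in the first cells of its rows. -/
def scriptOf (x : List A) (T : ℕ) (l : ℕ → Option M.Cell) : List M.Transition :=
  (List.range T).map fun t =>
    ((l ((t + 1) * width x T + 2)).map Cell.tr).getD startTransition

theorem length_scriptOf : (scriptOf x T l).length = T := by
  simp [scriptOf]

theorem tr_cellAt_scriptOf_of_start {s : ℕ} (hs : width x T + 2 ≤ s)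
    (hs' : s < (T + 1) * width x T + 2)
    (hstart : (cellAt x T (scriptOf x T l) s).start = true) {d : M.Cell} (hd : l s = some d) :
    d.tr = (cellAt x T (scriptOf x T l) s).tr := by
  have hw := width_eq x T
  obtain ⟨_ | t, rfl⟩ := exists_of_start_cellAt hstart
  · omega
  have ht : t + 1 ≤ T := (row_lt_iff le_rfl (by omega)).1 hs'
  rw [tr_cellAt_row le_rfl (by omega), rowTransition_succ (by rwa [length_scriptOf])]
  simp [scriptOf, hd]

theorem IsTableau.eq_cellAt_scriptOf (h : IsTableau x T l) {s : ℕ}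
    (hs : s < (T + 1) * width x T + 2) : l s = some (cellAt x T (scriptOf x T l) s) := by
  have hw := width_eq x T
  induction s using Nat.strong_induction_on with
  | _ s ih =>
  by_cases hs' : s < width x T + 2
  · rw [cellAt_of_lt hs', h.init s (by simpa [startRow] using hs')]
    simp [startRow]
  obtain ⟨i, rfl⟩ := Nat.exists_eq_add_of_le' (not_lt.1 hs')
  obtain ⟨d, hd⟩ := Option.ne_none_iff_exists'.1 (h.ne_none hs)
  obtain ⟨hstart, hpre, hsym⟩ := (h.window i).below _ _ _ _ _ (ih i (by omega) (by omega))
    (ih (i + 1) (by omega) (by omega)) (ih (i + 2) (by omega) (by omega))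
    (ih (i + 3) (by omega) (by omega)) hd
  rw [← start_cellAt_add] at hstart
  rw [← pre_cellAt_add] at hpre
  have htr : d.tr = (cellAt x T (scriptOf x T l) (i + (width x T + 2))).tr := by
    cases hfirst : (cellAt x T (scriptOf x T l) (i + (width x T + 2))).start with
    | true => exact tr_cellAt_scriptOf_of_start (by omega) hs hfirst hd
    | false =>
      exact ((h.window (i + (width x T + 1))).tr_eq _ d (ih _ (by omega) (by omega)) hd
        (hstart.trans hfirst)).trans (tr_cellAt_succ hfirst).symm
  rw [htr, ← sym_cellAt_add] at hsym
  rw [hd, Option.some_inj]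
  exact Cell.ext hstart hpre htr hsym

theorem IsTableau.eq_tableau_scriptOf (h : IsTableau x T l) :
    l = tableau x T (scriptOf x T l) := by
  funext s
  by_cases hs : s < (T + 1) * width x T + 2
  · rw [h.eq_cellAt_scriptOf hs, tableau_of_lt hs]
  · rw [tableau_eq_none.2 (not_lt.1 hs), h.eq_none (not_lt.1 hs)]

theorem scriptOf_tableau (hts : ts.length = T) : scriptOf x T (tableau x T ts) = ts := by
  have hw := width_eq x T
  refine List.ext_getElem (length_scriptOf.trans hts.symm) fun t ht ht' => ?_
  simp only [scriptOf, List.getElem_map, List.getElem_range]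
  rw [tableau_of_lt ((row_lt_iff le_rfl (by omega)).2 (by omega)), Option.map_some,
    Option.getD_some, tr_cellAt_row le_rfl (by omega), rowTransition_succ ht']

theorem numAcceptingRuns_eq_ncard_isTableau (hT : ∀ ρ, M.IsRun x ρ → ρ.length ≤ T + 1) :
    M.numAcceptingRuns x = {l : ℕ → Option M.Cell | IsTableau x T l}.ncard := by
  rw [numAcceptingRuns_eq_ncard_isScript hT]
  refine Set.ncard_congr (fun ts _ => tableau x T ts)
    (fun ts hts => (isTableau_tableau_iff hts.1).2 hts.2) (fun ts ts' hts hts' heq => ?_)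
    fun l hl => ⟨scriptOf x T l, ⟨length_scriptOf, ?_⟩, hl.eq_tableau_scriptOf.symm⟩
  · rw [← scriptOf_tableau (x := x) hts.1, heq, scriptOf_tableau hts'.1]
  · rw [← isTableau_tableau_iff length_scriptOf, ← hl.eq_tableau_scriptOf]
    exact hl

theorem startCell_eq_blank {s : ℕ} (h : s < T + 4 ∨ T + 4 + x.length ≤ s) :
    startCell (M := M) x T s = initialCell (s = 2) (s = T + 3) none := by
  rw [startCell, inputAt]
  split_ifs
  · rw [List.getElem?_eq_none (by omega)]
  · rfl

theorem map_startCell_eq_replicate (i n : ℕ)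
    (h : ∀ s, i ≤ s → s < i + n → (s < T + 4 ∨ T + 4 + x.length ≤ s) ∧ s ≠ 2 ∧ s ≠ T + 3) :
    (List.range n).map (fun s => startCell (M := M) x T (i + s)) =
      List.replicate n (initialCell false false none) := by
  refine List.eq_replicate_iff.2 ⟨by simp, ?_⟩
  simp only [List.forall_mem_map, List.mem_range]
  intro s hs
  obtain ⟨hblank, hstart, hpre⟩ := h (i + s) (by omega) (by omega)
  rw [startCell_eq_blank hblank, decide_eq_false hstart, decide_eq_false hpre]

theorem startCell_input {s : ℕ} (hs : s < x.length) :
    startCell (M := M) x T (T + 4 + s) = initialCell false false (some x[s]) := by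
  rw [startCell, inputAt, decide_eq_false (by omega), decide_eq_false (by omega),
    if_pos (by omega), Nat.add_sub_cancel_left, List.getElem?_eq_getElem hs]

theorem startRow_eq : startRow (M := M) x T =
    [initialCell false false none, initialCell false false none, initialCell true false none] ++
      (List.replicate T (initialCell false false none) ++ ([initialCell false true none] ++
        (x.map (fun a => initialCell false false (some a)) ++
          List.replicate (T + 1) (initialCell false false none)))) := by
  rw [startRow, show width x T + 2 = 3 + (T + (1 + (x.length + (T + 1)))) by rw [width_eq]; omega,
    List.range_add, List.range_add, List.range_add, List.range_add]
  simp only [List.map_append, List.map_map, Function.comp_def, ← Nat.add_assoc]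
  refine congrArg₂ _ rfl (congrArg₂ _ ?_ (congrArg₂ _ ?_ (congrArg₂ _ ?_ ?_)))
  · exact map_startCell_eq_replicate 3 T (by omega)
  · simp [startCell_eq_blank, Nat.add_comm 3 T]
  · refine List.ext_getElem (by simp) fun s _ hs => ?_
    rw [List.length_map] at hs
    simp only [List.getElem_map, List.getElem_range]
    rw [← startCell_input hs, show 3 + T + 1 + s = T + 4 + s by omega]
  · exact map_startCell_eq_replicate (3 + T + 1 + x.length) (T + 1) (by omega)

end

end NTM

theorem sharpPHard_countWordModelsUnary : SharpPHard countWordModelsUnary := by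
  rintro A _ f ⟨M, ⟨p, hp⟩, hf⟩
  obtain ⟨c, ⟨e⟩⟩ := Finite.exists_equiv_fin (Option M.Cell)
  have hT : IsGeneratedCount A fun n => p.eval n := isGeneratedCount_eval p
  have hT' : IsGeneratedCount A fun n => p.eval n + 1 := hT.add (isGeneratedCount_const 1)
  have hwidth : IsGeneratedCount A fun n => 2 * p.eval n + n + 3 :=
    (((isGeneratedCount_const 2).mul hT).add isGeneratedCount_id).add (isGeneratedCount_const 3)
  have hgen := isGenerated_encode_tilingFormula (A := A) (e := e) (pad := none)
    (W := fun q : Fin 5 → Option M.Cell => NTM.Window (q 0) (q 1) (q 2) (q 3) (q 4))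
    (z := fun x => (NTM.startRow x (p.eval x.length)).map some)
    (D := fun k n => ![0, 1, 2, 3, 2 * p.eval n + n + 3 + 2] k)
    (fun g => by
      simp only [NTM.startRow_eq, List.flatMap_append, List.flatMap_map, List.flatMap_replicate]
      exact (isGenerated_const _).append <| (hT (isGenerated_const _)).append <|
        (isGenerated_const _).append <| (isGenerated_flatMap _).append <|
          hT' (isGenerated_const _))
    (by
      intro k
      fin_cases k
      · exact isGeneratedCount_const 0
      · exact isGeneratedCount_const 1
      · exact isGeneratedCount_const 2
      · exact isGeneratedCount_const 3
      · exact hwidth.add (isGeneratedCount_const 2))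
    ((hT'.mul hwidth).add (isGeneratedCount_const 1))
  refine ⟨_, hgen.polyTimeComputable, fun x => ?_⟩
  rw [hf, countWordModelsUnary, Instance.encode_injective.extend_apply,
    numWordModels_tilingFormula (k := 0) (k' := 1) rfl rfl fun _ hq => hq.eq_none]
  exact NTM.numAcceptingRuns_eq_ncard_isTableau (hp x)

end LTLCount

theorem mainTheorem1 : LTLCount.SharpPComplete LTLCount.countWordModelsUnary :=
  ⟨LTLCount.sharpPHard_countWordModelsUnary, LTLCount.inSharpP_countWordModelsUnary⟩
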